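/- Theorem 2.6. Let $C$ be a finite simplicial complex, linearly embedded in some $\mathbb{R}^k$, whose underlying space $|C|\subset\mathbb{R}^k$ is a topological $3$-manifold, possibly with boundary. Let $\pi\in\mathbb{R}^k$ be a nonzero vector such that: (a) $\pi$ is in general position with respect to $C$: no two distinct vertices of $C$ have the same value under $\langle\pi,-\rangle$; (b) $|C|$ is $\pi$-tight: for every affine hyperplane $h=\{x:\langle\pi,x\rangle=c\}$, $c\in\mathbb{R}$, with corresponding open halfspace $h^+=\{x:\langle\pi,x\rangle>c\}$, and for every $i\ge 0$, the homomorphism $H_i(h^+\cap|C|;\mathbb{Z}_2)\to H_i(|C|;\mathbb{Z}_2)$ induced by inclusion is injective. Then $C$ admits a perfect discrete Morse function. That is, there is a map $f$ from the set of nonempty faces of $C$ to $\mathbb{Z}$ that is weakly increasing with respect to inclusion of faces, takes each value at most twice, and for every $i\ge 0$ has exactly $\beta_i(C)=\dim_{\mathbb{Z}_2}H_i(|C|;\mathbb{Z}_2)$ critical $i$-dimensional faces. Here a face $\sigma$ is critical if $f(\rho)<f(\sigma)<f(\tau)$ for all nonempty faces $\rho\subsetneq\sigma$ and all faces $\tau\supsetneq\sigma$.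 -/

import Mathlib

open CategoryTheory

noncomputable section

namespace TightMorse

/-- The ambient Euclidean space `ℝᵏ`. -/
abbrev Euc (k : ℕ) : Type := EuclideanSpace ℝ (Fin k)

/-- The singular homology functor `H_i(-; ℤ/2)`. -/
abbrev homologyFunctor (i : ℕ) : TopCat.{0} ⥤ ModuleCat.{0} (ZMod 2) :=
  (AlgebraicTopology.singularHomologyFunctor (ModuleCat.{0} (ZMod 2)) i).obj
    (ModuleCat.of (ZMod 2) (ZMod 2))

/-- The inclusion `A ⊆ X` of subspaces of a topological space, as a continuous map. -/
def inclusionMap {E : Type} [TopologicalSpace E] {A X : Set E} (h : A ⊆ X) :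
    TopCat.of A ⟶ TopCat.of X :=
  TopCat.ofHom ⟨Set.inclusion h, continuous_inclusion h⟩

/-- The open halfspace `{x | c < ⟪π, x⟫}`, delimited in direction `π` by the affine hyperplane
`{x | ⟪π, x⟫ = c}`.  For `π ≠ 0` these are, as `c` varies, all hyperplanes orthogonal to `π`. -/
def upperHalfspace {k : ℕ} (π : Euc k) (c : ℝ) : Set (Euc k) :=
  {x | c < inner ℝ π x}

/-- The part of `|K|` in any halfspace in direction `π` injects into `|K|` in homology. -/
def IsTight {k : ℕ} (π : Euc k) (K : Geometry.SimplicialComplex ℝ (Euc k)) : Prop :=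
  ∀ (c : ℝ) (i : ℕ),
    Function.Injective ((homologyFunctor i).map
      (inclusionMap (Set.inter_subset_right : upperHalfspace π c ∩ K.space ⊆ K.space)))

/-- No two vertices of `K` have the same value under `⟪π, -⟫`. -/
def InGeneralPosition {k : ℕ} (π : Euc k) (K : Geometry.SimplicialComplex ℝ (Euc k)) : Prop :=
  Set.InjOn (fun v : Euc k => inner ℝ π v) K.vertices

/-- `|K|` is a topological `3`-manifold, possibly with boundary.  (As a subspace of `ℝᵏ`, it is
automatically Hausdorff and second countable.) -/
def TriangulatesThreeManifold {k : ℕ} (K : Geometry.SimplicialComplex ℝ (Euc k)) : Prop :=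
  Nonempty (ChartedSpace (EuclideanHalfSpace 3) K.space)

/-- The `i`-th Betti number of `K`, that is, of its underlying space `|K|`, over `ℤ/2`. -/
def bettiNumber {k : ℕ} (K : Geometry.SimplicialComplex ℝ (Euc k)) (i : ℕ) : ℕ :=
  Module.finrank (ZMod 2) ((homologyFunctor i).obj (TopCat.of K.space))

/-- A discrete Morse function: a weakly increasing, at most `2`-to-`1` map from the poset of
(nonempty) faces, ordered by inclusion, to the integers. -/
structure IsDiscreteMorse {k : ℕ} {K : Geometry.SimplicialComplex ℝ (Euc k)}
    (f : K.faces → ℤ) : Prop where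
  monotone : Monotone f
  two_to_one : ∀ n : ℤ, (f ⁻¹' {n}).encard ≤ 2

/-- A face is critical if `f` is strictly increasing at it. -/
def IsCritical {k : ℕ} {K : Geometry.SimplicialComplex ℝ (Euc k)}
    (f : K.faces → ℤ) (σ : K.faces) : Prop :=
  (∀ τ : K.faces, σ < τ → f σ < f τ) ∧ (∀ τ : K.faces, τ < σ → f τ < f σ)

/-- The set of critical faces of dimension `i`, i.e. with `i + 1` vertices. -/
def criticalFaces {k : ℕ} {K : Geometry.SimplicialComplex ℝ (Euc k)}
    (f : K.faces → ℤ) (i : ℕ) : Set K.faces :=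
  {σ | IsCritical f σ ∧ σ.1.card = i + 1}

/-- A discrete Morse function is perfect if, for every `i`, it has exactly as many critical
`i`-faces as the `i`-th Betti number. -/
def IsPerfectMorse {k : ℕ} {K : Geometry.SimplicialComplex ℝ (Euc k)}
    (f : K.faces → ℤ) : Prop :=
  IsDiscreteMorse f ∧ ∀ i : ℕ, (criticalFaces f i).encard = bettiNumber K i

end TightMorse

end

/-! Add the vertices one at a time, in decreasing order of `⟪π, -⟫`. When `v` arrives, the new faces
are the joins `v * σ` with `σ` in the upper link `L` of `v`, the empty `σ` included. Here `L` has
dimension at most two and each of its edges lies in at most two of its triangles. Such a complex can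
be taken apart perfectly (`build_of_edges_le_two`): if a facet of a top-dimensional simplex is free,
collapse it; if none is, there is a nonzero top-dimensional cycle mod 2, and removing a simplex of
that cycle lowers the homology by one. Read backwards, this builds `L` from matched pairs and
critical simplices, each critical one closing a cycle.

Tightness transfers this to `K` (`Build.join`). A cycle of `L` bounds its cone from `v`, so it dies
in `|K|`; by injectivity it already dies in the open halfspace above `v`, and hence in the
subcomplex spanned by the vertices above `v` (`exists_fd_eq_of_tight`). If adding `σ` to `L` closes
the cycle `σ + z`, and `y` above `v` bounds it, then `v * σ + v * z + y` is a cycle, so `v * σ` may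
be added to `K` as a critical face that creates homology. Pairs in `L` join to pairs in `K`.
Numbering the steps gives the Morse function; since no critical face ever destroys homology, a rank
count (`Build.exists_morse`, `finrank_homology`) identifies the numbers of critical faces with the
Betti numbers.

The manifold hypothesis enters through `card_le_four` and `card_tetrahedra_le_two`, both
consequences of `subset_of_book`: two tetrahedra sharing a triangle contain an embedded 3-ball
around the barycenter of the triangle; by invariance of domain this ball is a neighbourhood in `|K|`
and leaves no room for a further face. Invariance of domain is deduced from Brouwer's theorem, and
that from Sperner's lemma.

Singular and simplicial chains are compared directly, without exact sequences: a singular chain is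
subdivided until it is small, its vertices are labelled by vertices of `K` in whose open stars they
lie, and the labels form a simplicial chain. These chain groups are graded by the number of vertices
and augmented in degree `0`. The uniqueness statement `eq_single_of_carried` serves both this
comparison and Sperner's lemma. -/

noncomputable section

namespace TightMorse

/-! ### Tuple chains -/

/-- Formal sums, with coefficients in `ℤ/2`, of `n`-tuples of elements of `V`. -/
abbrev Ch (V : Type*) (n : ℕ) := (Fin n → V) →₀ ZMod 2

/-- The linear map of free modules sending a generator to the sum of its faces. -/
def sumFaces {A B : Type*} {n : ℕ} (face : Fin n → A → B) :
    (A →₀ ZMod 2) →ₗ[ZMod 2] (B →₀ ZMod 2) :=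
  Finsupp.linearCombination (ZMod 2) fun a => ∑ i, Finsupp.single (face i a) 1

@[simp]
lemma sumFaces_single {A B : Type*} {n : ℕ} (face : Fin n → A → B) (a : A) :
    sumFaces face (Finsupp.single a 1) = ∑ i, Finsupp.single (face i a) 1 := by
  simp [sumFaces]

lemma sumFaces_mapDomain {A B A' B' : Type*} {n : ℕ} (face : Fin n → A → B)
    (face' : Fin n → A' → B') (f : A → A') (g : B → B')
    (h : ∀ i a, face' i (f a) = g (face i a)) (c : A →₀ ZMod 2) :
    sumFaces face' (Finsupp.lmapDomain (ZMod 2) (ZMod 2) f c) =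
      Finsupp.lmapDomain (ZMod 2) (ZMod 2) g (sumFaces face c) := by
  have : sumFaces face' ∘ₗ Finsupp.lmapDomain (ZMod 2) (ZMod 2) f =
      Finsupp.lmapDomain (ZMod 2) (ZMod 2) g ∘ₗ sumFaces face := by
    refine Finsupp.lhom_ext' fun a => LinearMap.ext_ring ?_
    simp [h]
  exact LinearMap.congr_fun this c

/-- Linear maps out of free modules agree if they agree on generators. -/
lemma lin_ext {A M : Type*} [AddCommGroup M] [Module (ZMod 2) M]
    {f g : (A →₀ ZMod 2) →ₗ[ZMod 2] M}
    (h : ∀ a, f (Finsupp.single a 1) = g (Finsupp.single a 1)) : f = g :=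
  Finsupp.lhom_ext' fun a => LinearMap.ext_ring (h a)

/-- The boundary of tuple chains. -/
def bd {V : Type*} {n : ℕ} : Ch V (n + 1) →ₗ[ZMod 2] Ch V n :=
  sumFaces fun i t => t ∘ i.succAbove

/-- The cone operator prepending `v`. -/
def cone {V : Type*} {n : ℕ} (v : V) : Ch V n →ₗ[ZMod 2] Ch V (n + 1) :=
  Finsupp.lmapDomain _ _ fun t => (Fin.cons v t : Fin (n + 1) → V)

@[simp]
lemma cone_single {V : Type*} {n : ℕ} (v : V) (t : Fin n → V) :
    cone v (Finsupp.single t 1) = Finsupp.single (Fin.cons v t : Fin (n + 1) → V) 1 := by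
  simp [cone]

lemma bd_single {V : Type*} {n : ℕ} (t : Fin (n + 1) → V) :
    bd (Finsupp.single t 1) = ∑ i : Fin (n + 1), Finsupp.single (t ∘ i.succAbove) 1 := by
  simp [bd]

lemma bd_cone_zero {V : Type*} (v : V) (c : Ch V 0) : bd (cone v c) = c := by
  have : bd ∘ₗ cone v = (LinearMap.id : Ch V 0 →ₗ[ZMod 2] Ch V 0) := by
    refine lin_ext fun t => ?_
    simp only [LinearMap.comp_apply, cone_single, bd_single, LinearMap.id_apply]
    simp [Subsingleton.elim _ t]
  exact LinearMap.congr_fun this c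

lemma bd_cone {V : Type*} {n : ℕ} (v : V) (c : Ch V (n + 1)) :
    bd (cone v c) = c + cone v (bd c) := by
  have : bd ∘ₗ cone v = LinearMap.id + (cone v ∘ₗ bd : Ch V (n + 1) →ₗ[ZMod 2] _) := by
    refine lin_ext fun t => ?_
    simp only [LinearMap.comp_apply, cone_single, bd_single, LinearMap.id_apply,
      LinearMap.add_apply, map_sum, Fin.sum_univ_succ (n := n + 1)]
    congr 1
    refine Finset.sum_congr rfl fun i _ => ?_
    congr 1
    funext j
    refine Fin.cases ?_ (fun j => ?_) j
    · simp
    · simp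
  exact LinearMap.congr_fun this c

lemma bd_bd {V : Type*} : ∀ {n : ℕ} (c : Ch V (n + 2)), bd (bd c) = 0 := by
  intro n
  induction n with
  | zero =>
    intro c
    have : bd ∘ₗ bd = (0 : Ch V 2 →ₗ[ZMod 2] _) := by
      refine lin_ext fun t => ?_
      rw [LinearMap.comp_apply, ← Fin.cons_self_tail t, ← cone_single, bd_cone, map_add,
        bd_cone_zero, LinearMap.zero_apply, ZModModule.add_self]
    exact LinearMap.congr_fun this c
  | succ n ih =>
    intro c
    have : bd ∘ₗ bd = (0 : Ch V (n + 3) →ₗ[ZMod 2] _) := by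
      refine lin_ext fun t => ?_
      rw [LinearMap.comp_apply, ← Fin.cons_self_tail t, ← cone_single, bd_cone, map_add,
        bd_cone, ih, map_zero, add_zero, LinearMap.zero_apply, ZModModule.add_self]
    exact LinearMap.congr_fun this c

/-- Pushing tuple chains forward along a map. -/
def chMap {V W : Type*} (f : V → W) (n : ℕ) : Ch V n →ₗ[ZMod 2] Ch W n :=
  Finsupp.lmapDomain _ _ fun t => f ∘ t

@[simp]
lemma chMap_single {V W : Type*} (f : V → W) {n : ℕ} (t : Fin n → V) :
    chMap f n (Finsupp.single t 1) = Finsupp.single (f ∘ t) 1 := by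
  simp [chMap]

lemma bd_chMap {V W : Type*} (f : V → W) {n : ℕ} (c : Ch V (n + 1)) :
    bd (chMap f (n + 1) c) = chMap f n (bd c) :=
  sumFaces_mapDomain (fun (i : Fin (n + 1)) t => t ∘ i.succAbove) (fun i t => t ∘ i.succAbove)
    (fun t => f ∘ t) (fun t => f ∘ t) (fun _ _ => rfl) c

lemma chMap_cone {V W : Type*} (f : V → W) {n : ℕ} (v : V) (c : Ch V n) :
    chMap f (n + 1) (cone v c) = cone (f v) (chMap f n c) := by
  have : chMap f (n + 1) ∘ₗ cone v = cone (f v) ∘ₗ chMap f n := by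
    refine lin_ext fun t => ?_
    simp [Fin.comp_cons]
  exact LinearMap.congr_fun this c

/-- The acyclic carrier construction: a null-homotopy of a family `h` of maps of tuple chains,
obtained by coning off recursively with apices `c`. -/
def coneHtpy {V W : Type*} (h : ∀ n, Ch V n →ₗ[ZMod 2] Ch W n)
    (c : ∀ n, (Fin (n + 1) → V) → W) : ∀ n, Ch V n →ₗ[ZMod 2] Ch W (n + 1)
  | 0 => 0
  | n + 1 => Finsupp.linearCombination (ZMod 2) fun t =>
      cone (c n t) (h (n + 1) (Finsupp.single t 1) + coneHtpy h c n (bd (Finsupp.single t 1)))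

@[simp]
lemma coneHtpy_zero {V W : Type*} (h : ∀ n, Ch V n →ₗ[ZMod 2] Ch W n)
    (c : ∀ n, (Fin (n + 1) → V) → W) : coneHtpy h c 0 = 0 := rfl

lemma coneHtpy_single {V W : Type*} (h : ∀ n, Ch V n →ₗ[ZMod 2] Ch W n)
    (c : ∀ n, (Fin (n + 1) → V) → W) (n : ℕ) (t : Fin (n + 1) → V) :
    coneHtpy h c (n + 1) (Finsupp.single t 1) =
      cone (c n t) (h (n + 1) (Finsupp.single t 1) + coneHtpy h c n (bd (Finsupp.single t 1))) := by
  simp [coneHtpy]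

/-- The chain being coned off is a cycle: by the formula one degree lower, its boundary is `h (bd
t)` taken twice. So `bd_cone` returns it unchanged. The recursion starts from `0`, which is why `h`
has to vanish on the empty tuple. -/
lemma bd_coneHtpy {V W : Type*} (h : ∀ n, Ch V n →ₗ[ZMod 2] Ch W n)
    (c : ∀ n, (Fin (n + 1) → V) → W) (h0 : h 0 = 0)
    (hbd : ∀ n x, bd (h (n + 1) x) = h n (bd x)) (n : ℕ) (x : Ch V (n + 1)) :
    bd (coneHtpy h c (n + 1) x) + coneHtpy h c n (bd x) = h (n + 1) x := by
  induction n with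
  | zero =>
    have : bd ∘ₗ coneHtpy h c 1 = h 1 := by
      refine lin_ext fun t => ?_
      rw [LinearMap.comp_apply, coneHtpy_single, bd_cone]
      simp [hbd, h0]
    simpa using LinearMap.congr_fun this x
  | succ n ih =>
    have : bd ∘ₗ coneHtpy h c (n + 2) + coneHtpy h c (n + 1) ∘ₗ bd = h (n + 2) := by
      refine lin_ext fun t => ?_
      rw [LinearMap.add_apply, LinearMap.comp_apply, LinearMap.comp_apply, coneHtpy_single,
        bd_cone, map_add bd, hbd, ← ih (bd (Finsupp.single t 1)), bd_bd, map_zero, add_zero,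
        ZModModule.add_self, map_zero, add_zero, add_assoc, ZModModule.add_self, add_zero]
    exact LinearMap.congr_fun this x

/-- The support of the recursive null-homotopy, in terms of a family of tuples closed under
faces. -/
lemma coneHtpy_mem {V W : Type*} (h : ∀ n, Ch V n →ₗ[ZMod 2] Ch W n)
    (c : ∀ n, (Fin (n + 1) → V) → W) (B : Set V → Set W) (hB : Monotone B)
    (hh : ∀ n t, h n (Finsupp.single t 1) ∈
      Finsupp.supported (ZMod 2) (ZMod 2) {u | ∀ i, u i ∈ B (Set.range t)})
    (hc : ∀ n t, c n t ∈ B (Set.range t)) (n : ℕ) (t : Fin n → V) :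
    coneHtpy h c n (Finsupp.single t 1) ∈
      Finsupp.supported (ZMod 2) (ZMod 2) {u | ∀ i, u i ∈ B (Set.range t)} := by
  induction n with
  | zero => simp
  | succ n ih =>
    rw [coneHtpy_single]
    have key : h (n + 1) (Finsupp.single t 1) + coneHtpy h c n (bd (Finsupp.single t 1)) ∈
        Finsupp.supported (ZMod 2) (ZMod 2) {u | ∀ i, u i ∈ B (Set.range t)} := by
      refine Submodule.add_mem _ (hh _ _) ?_
      rw [bd_single, map_sum]
      refine Submodule.sum_mem _ fun i _ => ?_
      refine Finsupp.supported_mono ?_ (ih (t ∘ i.succAbove))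
      exact fun u hu j => hB (Set.range_comp_subset_range _ _) (hu j)
    rw [Finsupp.mem_supported] at key ⊢
    intro u hu
    classical
    have := Finsupp.mapDomain_support hu
    simp only [Finset.mem_image] at this
    obtain ⟨w, hw, rfl⟩ := this
    refine Fin.cases (by simpa using hc n t) fun i => ?_
    simpa using key hw i

/-! ### Set chains -/

/-- Formal sums of finite sets, with coefficients in `ℤ/2`; the augmented simplicial chains of the
full simplex on `V`. -/
abbrev FC (V : Type*) := Finset V →₀ ZMod 2

section SetChains

variable {V : Type*} [DecidableEq V]

/-- The augmented simplicial boundary. -/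
def fd : FC V →ₗ[ZMod 2] FC V :=
  Finsupp.linearCombination (ZMod 2) fun F => ∑ x ∈ F, Finsupp.single (F.erase x) 1

lemma fd_single (F : Finset V) :
    fd (Finsupp.single F 1) = ∑ x ∈ F, Finsupp.single (F.erase x) 1 := by
  simp [fd]

/-- The join with the vertex `v`. -/
def fcone (v : V) : FC V →ₗ[ZMod 2] FC V :=
  Finsupp.linearCombination (ZMod 2) fun F => if v ∈ F then 0 else Finsupp.single (insert v F) 1

lemma fcone_single (v : V) (F : Finset V) :
    fcone v (Finsupp.single F 1) = if v ∈ F then 0 else Finsupp.single (insert v F) 1 := by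
  simp [fcone]

/-- If `v ∈ F`, the left side vanishes, and on the right only the facet `F.erase v` survives the
join and restores `F`. -/
lemma fd_fcone (v : V) (c : FC V) : fd (fcone v c) = c + fcone v (fd c) := by
  have : fd ∘ₗ fcone v = LinearMap.id + (fcone v ∘ₗ fd : FC V →ₗ[ZMod 2] _) := by
    refine lin_ext fun F => ?_
    simp only [LinearMap.comp_apply, LinearMap.add_apply, LinearMap.id_apply, fd_single, map_sum,
      fcone_single]
    by_cases hv : v ∈ F
    · rw [if_pos hv, map_zero, Finset.sum_eq_single_of_mem v hv, if_neg (by simp),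
        Finset.insert_erase hv, ZModModule.add_self]
      intro x _ hx
      rw [if_pos (Finset.mem_erase.2 ⟨hx.symm, hv⟩)]
    · rw [if_neg hv, fd_single, Finset.sum_insert hv, Finset.erase_insert hv]
      congr 1
      refine Finset.sum_congr rfl fun x hx => ?_
      have hxv : x ≠ v := fun h => hv (h ▸ hx)
      rw [if_neg fun h => hv (Finset.mem_of_mem_erase h),
        Finset.erase_insert_of_ne hxv.symm]
  exact LinearMap.congr_fun this c

lemma fd_fd (c : FC V) : fd (fd c) = 0 := by
  have : fd ∘ₗ fd = (0 : FC V →ₗ[ZMod 2] _) := by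
    refine lin_ext fun F => ?_
    induction F using Finset.induction_on with
    | empty => simp [fd_single]
    | insert v F hv ih =>
      have h : Finsupp.single (insert v F) (1 : ZMod 2) = fcone v (Finsupp.single F 1) := by
        rw [fcone_single, if_neg hv]
      simp only [LinearMap.comp_apply, LinearMap.zero_apply] at ih ⊢
      rw [h, fd_fcone, map_add, fd_fcone, ih, map_zero, add_zero, ZModModule.add_self]
  exact LinearMap.congr_fun this c

/-- Forgetting the order in tuples of distinct elements, and killing the other tuples. -/
def toSets (n : ℕ) : Ch V n →ₗ[ZMod 2] FC V :=
  Finsupp.linearCombination (ZMod 2) fun t =>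
    if (Finset.univ.image t).card = n then Finsupp.single (Finset.univ.image t) 1 else 0

lemma toSets_single (n : ℕ) (t : Fin n → V) :
    toSets n (Finsupp.single t 1) =
      if (Finset.univ.image t).card = n then Finsupp.single (Finset.univ.image t) 1 else 0 := by
  simp [toSets]

lemma image_cons_univ {n : ℕ} (v : V) (t : Fin n → V) :
    Finset.univ.image (Fin.cons v t : Fin (n + 1) → V) = insert v (Finset.univ.image t) := by
  ext x
  simp [Fin.exists_fin_succ, eq_comm]

lemma toSets_cone (n : ℕ) (v : V) (c : Ch V n) :
    toSets (n + 1) (cone v c) = fcone v (toSets n c) := by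
  have : toSets (n + 1) ∘ₗ cone v = fcone v ∘ₗ toSets n := by
    refine lin_ext fun t => ?_
    simp only [LinearMap.comp_apply, cone_single, toSets_single, image_cons_univ]
    have hle : (Finset.univ.image t).card ≤ n := by
      simpa using Finset.card_image_le (s := Finset.univ) (f := t)
    by_cases hv : v ∈ Finset.univ.image t
    · rw [Finset.insert_eq_of_mem hv, if_neg (by omega)]
      split_ifs
      · rw [fcone_single, if_pos hv]
      · simp
    · rw [Finset.card_insert_of_notMem hv]
      by_cases h : (Finset.univ.image t).card = n
      · rw [if_pos (by omega), if_pos h, fcone_single, if_neg hv]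
      · rw [if_neg (by omega), if_neg h, map_zero]
  exact LinearMap.congr_fun this c

/-- Every tuple is the cone on its tail, and `toSets` turns `cone` into `fcone`, so the two cone
formulas reduce the claim to the tail. The cancellation among faces of degenerate tuples never has
to be examined. -/
lemma fd_toSets (n : ℕ) (c : Ch V (n + 1)) : fd (toSets (n + 1) c) = toSets n (bd c) := by
  have : fd ∘ₗ toSets (n + 1) = (toSets n ∘ₗ bd : Ch V (n + 1) →ₗ[ZMod 2] _) := by
    clear c
    induction n with
    | zero =>
      refine lin_ext fun t => ?_
      rw [LinearMap.comp_apply, LinearMap.comp_apply, ← Fin.cons_self_tail t, ← cone_single,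
        toSets_cone, fd_fcone, bd_cone_zero]
      simp [toSets_single, fd_single]
    | succ n ih =>
      refine lin_ext fun t => ?_
      have ih' := LinearMap.congr_fun ih (Finsupp.single (Fin.tail t) 1)
      simp only [LinearMap.comp_apply] at ih'
      rw [LinearMap.comp_apply, LinearMap.comp_apply, ← Fin.cons_self_tail t, ← cone_single,
        toSets_cone, fd_fcone, bd_cone, ih', map_add, toSets_cone]
  exact LinearMap.congr_fun this c

lemma toSets_mem {n : ℕ} {A : Set V} {c : Ch V n}
    (hc : c ∈ Finsupp.supported (ZMod 2) (ZMod 2) {u : Fin n → V | ∀ i, u i ∈ A}) :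
    toSets n c ∈ Finsupp.supported (ZMod 2) (ZMod 2) {F : Finset V | ↑F ⊆ A ∧ F.card = n} := by
  rw [Finsupp.supported_eq_span_single] at hc
  induction hc using Submodule.span_induction with
  | zero => simp
  | add x y _ _ hx hy => rw [map_add]; exact Submodule.add_mem _ hx hy
  | smul a x _ hx => rw [map_smul]; exact Submodule.smul_mem _ _ hx
  | mem x hx =>
    obtain ⟨t, ht, rfl⟩ := hx
    rw [toSets_single]
    split_ifs with h
    · refine Finsupp.single_mem_supported _ _ ⟨?_, h⟩
      simpa [Set.range_subset_iff] using ht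
    · simp

/-- A choice of orderings of finite sets, compatible with boundaries: a chain map from set chains
to tuple chains. -/
def toTuples : ∀ n, FC V →ₗ[ZMod 2] Ch V n
  | 0 => Finsupp.linearCombination (ZMod 2) fun F =>
      if F = ∅ then Finsupp.single Fin.elim0 1 else 0
  | n + 1 => Finsupp.linearCombination (ZMod 2) fun F =>
      if h : F.Nonempty then cone h.choose (toTuples n (fd (Finsupp.single F 1))) else 0

lemma toTuples_zero_single (F : Finset V) : toTuples 0 (Finsupp.single F 1) =
    if F = ∅ then Finsupp.single Fin.elim0 1 else 0 := by
  simp [toTuples]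

lemma toTuples_succ_single (n : ℕ) (F : Finset V) : toTuples (n + 1) (Finsupp.single F 1) =
    if h : F.Nonempty then cone h.choose (toTuples n (fd (Finsupp.single F 1))) else 0 := by
  simp [toTuples]

/-- Inductively `toTuples n (fd F)` is a cycle, so it is the boundary of its cone from any vertex of
`F`; the chosen vertices need not be consistent between different sets. -/
lemma bd_toTuples (n : ℕ) (c : FC V) : bd (toTuples (n + 1) c) = toTuples n (fd c) := by
  have : bd ∘ₗ toTuples (n + 1) = (toTuples n ∘ₗ fd : FC V →ₗ[ZMod 2] _) := by
    induction n with
    | zero =>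
      refine lin_ext fun F => ?_
      rw [LinearMap.comp_apply, LinearMap.comp_apply, toTuples_succ_single]
      split_ifs with hF
      · rw [bd_cone_zero]
      · rw [Finset.not_nonempty_iff_eq_empty.1 hF, fd_single]; simp
    | succ n ih =>
      refine lin_ext fun F => ?_
      have ih' := LinearMap.congr_fun ih (fd (Finsupp.single F 1))
      simp only [LinearMap.comp_apply] at ih'
      rw [LinearMap.comp_apply, LinearMap.comp_apply, toTuples_succ_single]
      split_ifs with hF
      · rw [bd_cone, ih', fd_fd, map_zero, map_zero, add_zero]
      · rw [Finset.not_nonempty_iff_eq_empty.1 hF, fd_single]; simp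
  exact LinearMap.congr_fun this c

lemma toTuples_mem (n : ℕ) (F : Finset V) : toTuples n (Finsupp.single F 1) ∈
    Finsupp.supported (ZMod 2) (ZMod 2) {u : Fin n → V | ∀ i, u i ∈ F} := by
  induction n generalizing F with
  | zero =>
    rw [toTuples_zero_single]
    split_ifs
    · exact Finsupp.single_mem_supported _ _ fun i => i.elim0
    · simp
  | succ n ih =>
    rw [toTuples_succ_single]
    split_ifs with hF
    · have key : toTuples n (fd (Finsupp.single F 1)) ∈
          Finsupp.supported (ZMod 2) (ZMod 2) {u : Fin n → V | ∀ i, u i ∈ F} := by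
        rw [fd_single, map_sum]
        refine Submodule.sum_mem _ fun x _ => Finsupp.supported_mono ?_ (ih (F.erase x))
        exact fun u hu i => Finset.mem_of_mem_erase (hu i)
      rw [Finsupp.mem_supported] at key ⊢
      intro u hu
      have := Finsupp.mapDomain_support hu
      simp only [Finset.mem_image] at this
      obtain ⟨w, hw, rfl⟩ := this
      exact Fin.cases (by simpa using hF.choose_spec) fun i => by simpa using key hw i
    · simp

/-- A chain map of set chains that is the identity on the empty set and carried by the simplices
of a simplicial complex is the identity on that complex. -/
lemma eq_single_of_carried (f : ℕ → FC V →ₗ[ZMod 2] FC V) (A : Set (Finset V))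
    (hA : IsLowerSet A) (h0 : f 0 (Finsupp.single ∅ 1) = Finsupp.single ∅ 1)
    (hd : ∀ n x, fd (f (n + 1) x) = f n (fd x))
    (hf : ∀ F ∈ A, f F.card (Finsupp.single F 1) ∈
      Finsupp.supported (ZMod 2) (ZMod 2) {G : Finset V | G ⊆ F ∧ G.card = F.card})
    {F : Finset V} (hF : F ∈ A) :
    f F.card (Finsupp.single F 1) = Finsupp.single F 1 := by
  induction hn : F.card generalizing F with
  | zero => rw [Finset.card_eq_zero.1 hn, h0]
  | succ n ih =>
    -- The only subset of `F` of full cardinality is `F`, so the image is a multiple of `F`. Its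
    -- boundary is that of `F` by induction on the facets, and this is nonzero, so the scalar is
    -- `1`.
    have h1 : f (n + 1) (Finsupp.single F 1) ∈ Finsupp.supported (ZMod 2) (ZMod 2) {F} := by
      have := hf F hF
      rw [hn] at this
      refine Finsupp.supported_mono ?_ this
      rintro G ⟨hG, hG'⟩
      exact Finset.eq_of_subset_of_card_le hG (by omega)
    obtain ⟨a, ha⟩ : ∃ a : ZMod 2, f (n + 1) (Finsupp.single F 1) = a • Finsupp.single F 1 := by
      refine ⟨f (n + 1) (Finsupp.single F 1) F, ?_⟩
      ext G
      by_cases hG : G = F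
      · simp [hG]
      · rw [Finsupp.smul_apply, Finsupp.single_eq_of_ne hG, smul_zero]
        by_contra hne
        exact hG (h1 (Finsupp.mem_support_iff.2 hne))
    have h2 : fd (f (n + 1) (Finsupp.single F 1)) = fd (Finsupp.single F 1) := by
      rw [hd, fd_single, map_sum]
      refine Finset.sum_congr rfl fun x hx => ?_
      exact ih (hA (F.erase_subset x) hF) (by rw [Finset.card_erase_of_mem hx, hn]; rfl)
    have h3 : fd (Finsupp.single F (1 : ZMod 2)) ≠ 0 := by
      obtain ⟨x, hx⟩ : F.Nonempty := Finset.card_pos.1 (by omega)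
      intro h
      have := DFunLike.congr_fun h (F.erase x)
      rw [fd_single, Finsupp.finsetSum_apply, Finset.sum_eq_single_of_mem x hx] at this
      · simp at this
      · intro y hy hyx
        refine Finsupp.single_eq_of_ne fun h => ?_
        have hxx : x ∈ F.erase y := Finset.mem_erase.2 ⟨hyx.symm, hx⟩
        rw [← h] at hxx
        simp at hxx
    rw [ha]
    rcases (by decide : ∀ a : ZMod 2, a = 0 ∨ a = 1) a with rfl | rfl
    · rw [ha, zero_smul, map_zero] at h2
      exact absurd h2.symm h3
    · rw [one_smul]

end SetChains

/-! ### Building complexes of dimension at most two by pairs and critical sets. -/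

section Build

variable {V : Type*} [DecidableEq V]

/-- Chains supported on the members of cardinality `n` of a family of finite sets. -/
abbrev chains (A : Set (Finset V)) (n : ℕ) : Submodule (ZMod 2) (FC V) :=
  Finsupp.supported (ZMod 2) (ZMod 2) {F | F ∈ A ∧ F.card = n}

/-- A family of finite sets is built by adding, one after the other, either a set whose boundary
is already a boundary (a critical set), or a set together with a facet of it (a matched pair). -/
inductive Build (D : FC V →ₗ[ZMod 2] FC V) : Finset (Finset V) → Prop
  | nil : Build D ∅
  | crit {A : Finset (Finset V)} {σ : Finset V} {z : FC V} (hA : Build D A)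
      (hσ : ∀ ρ ∈ A, ¬ σ ⊆ ρ) (hz : z ∈ chains (A : Set (Finset V)) σ.card)
      (hD : D (Finsupp.single σ 1) = D z) : Build D (insert σ A)
  | pair {A : Finset (Finset V)} {σ : Finset V} {x : V} (hA : Build D A)
      (hσ : ∀ ρ ∈ A, ¬ σ ⊆ ρ) (hx : x ∉ σ)
      (hD : D (Finsupp.single (insert x σ) 1) + Finsupp.single σ 1 ∈
        chains (A : Set (Finset V)) σ.card) : Build D (insert (insert x σ) (insert σ A))

lemma fd_single_apply (t e : Finset V) : fd (Finsupp.single t 1) e =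
    if e ⊆ t ∧ t.card = e.card + 1 then 1 else 0 := by
  rw [fd_single, Finsupp.finsetSum_apply]
  split_ifs with h
  · obtain ⟨x, hx⟩ := Finset.card_eq_one.1
      (show (t \ e).card = 1 by rw [Finset.card_sdiff_of_subset h.1]; omega)
    have hxt : x ∈ t \ e := by rw [hx]; simp
    rw [Finset.mem_sdiff] at hxt
    rw [Finset.sum_eq_single_of_mem x hxt.1]
    · have : t.erase x = e := by rw [Finset.erase_eq, ← hx]; exact Finset.sdiff_sdiff_eq_self h.1
      rw [this, Finsupp.single_eq_same]
    · intro y hy hyx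
      refine Finsupp.single_eq_of_ne fun hh => ?_
      have : y ∈ t \ e := Finset.mem_sdiff.2 ⟨hy, by rw [hh]; simp⟩
      rw [hx] at this
      exact hyx (Finset.mem_singleton.1 this)
  · refine Finset.sum_eq_zero fun x hx => Finsupp.single_eq_of_ne fun hh => h ?_
    rw [hh]
    exact ⟨Finset.erase_subset _ _, (Finset.card_erase_add_one hx).symm⟩

lemma fd_mem_chains {A : Set (Finset V)} (hA : IsLowerSet A) {n : ℕ} {z : FC V}
    (hz : z ∈ chains A (n + 1)) : fd z ∈ chains A n := by
  rw [chains, Finsupp.supported_eq_span_single] at hz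
  induction hz using Submodule.span_induction with
  | zero => simp
  | add x y _ _ hx hy => rw [map_add]; exact Submodule.add_mem _ hx hy
  | smul a x _ hx => rw [map_smul]; exact Submodule.smul_mem _ _ hx
  | mem x hx =>
    obtain ⟨t, ⟨ht, hn⟩, rfl⟩ := hx
    rw [fd_single]
    refine Submodule.sum_mem _ fun y hy => Finsupp.single_mem_supported _ _ ⟨?_, ?_⟩
    · exact hA (t.erase_subset y) ht
    · have := Finset.card_erase_add_one hy; omega

lemma finrank_supported {α : Type*} (s : Finset α) :
    Module.finrank (ZMod 2) (Finsupp.supported (ZMod 2) (ZMod 2) (s : Set α)) = s.card := by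
  rw [(Finsupp.supportedEquivFinsupp (M := ZMod 2) (R := ZMod 2) (s : Set α)).finrank_eq,
    Module.finrank_finsupp_self]
  simp

instance {α : Type*} (s : Finset α) :
    FiniteDimensional (ZMod 2) (Finsupp.supported (ZMod 2) (ZMod 2) (s : Set α)) :=
  Module.Finite.equiv (Finsupp.supportedEquivFinsupp (M := ZMod 2) (R := ZMod 2) (s : Set α)).symm

lemma mem_chains_coe {V : Type*} {A : Finset (Finset V)} {n : ℕ} : chains (A : Set (Finset V)) n =
    Finsupp.supported (ZMod 2) (ZMod 2) ((A.filter fun F => F.card = n : Finset _) : Set _) := by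
  simp [chains]

/-- A finite graph without leaves but with an edge has a nonzero `ℤ/2`-cycle. -/
lemma exists_cycle_of_graph (M : Finset (Finset V)) (hM : IsLowerSet (M : Set (Finset V)))
    (h : ∀ σ ∈ M, σ.card = 1 → (M.filter fun τ => σ ⊆ τ ∧ τ.card = 2).card ≠ 1)
    {e : Finset V} (he : e ∈ M) (he2 : e.card = 2) :
    ∃ z ∈ chains (M : Set (Finset V)) 2, z ≠ 0 ∧ fd z = 0 := by
  set T := M.filter fun F => F.card = 2 with hT
  set P := M.filter fun σ => σ.card = 1 ∧ ∃ τ ∈ T, σ ⊆ τ with hP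
  -- Double count incidences: every vertex in `P` lies on at least two edges, and every edge has at
  -- most two ends in `P`.
  have hcount : P.card ≤ T.card := by
    have h1 := Finset.sum_card_bipartiteAbove_eq_sum_card_bipartiteBelow
      (s := P) (t := T) (fun σ τ => σ ⊆ τ)
    have h2 : P.card * 2 ≤ ∑ σ ∈ P, (T.bipartiteAbove (fun σ τ => σ ⊆ τ) σ).card := by
      rw [← smul_eq_mul]
      refine Finset.card_nsmul_le_sum _ _ _ fun σ hσ => ?_
      rw [hP, Finset.mem_filter] at hσ
      obtain ⟨hσM, hσ1, τ, hτ, hστ⟩ := hσ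
      have h3 := h σ hσM hσ1
      have h4 : T.bipartiteAbove (fun σ τ => σ ⊆ τ) σ =
          M.filter fun τ => σ ⊆ τ ∧ τ.card = 2 := by
        ext; simp only [Finset.bipartiteAbove, hT, Finset.mem_filter]; tauto
      rw [h4]
      have : 0 < (M.filter fun τ => σ ⊆ τ ∧ τ.card = 2).card := by
        refine Finset.card_pos.2 ⟨τ, ?_⟩
        rw [hT, Finset.mem_filter] at hτ
        exact Finset.mem_filter.2 ⟨hτ.1, hστ, hτ.2⟩
      omega
    have h3 : ∑ τ ∈ T, (P.bipartiteBelow (fun σ τ => σ ⊆ τ) τ).card ≤ T.card * 2 := by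
      rw [← smul_eq_mul]
      refine Finset.sum_le_card_nsmul _ _ _ fun τ hτ => ?_
      rw [hT, Finset.mem_filter] at hτ
      have : P.bipartiteBelow (fun σ τ => σ ⊆ τ) τ ⊆ τ.powersetCard 1 := by
        intro σ hσ
        simp only [Finset.bipartiteBelow, hP, Finset.mem_filter] at hσ
        exact Finset.mem_powersetCard.2 ⟨hσ.2, hσ.1.2.1⟩
      calc _ ≤ _ := Finset.card_le_card this
        _ = 2 := by simp [hτ.2]
    omega
  set S := Finsupp.supported (ZMod 2) (ZMod 2) (T : Set (Finset V))
  set Q := Finsupp.supported (ZMod 2) (ZMod 2) (P : Set (Finset V))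
  have hS : S = chains (M : Set (Finset V)) 2 := by rw [mem_chains_coe]
  have hle : LinearMap.range (fd.domRestrict S) ≤ Q ⊓ LinearMap.ker fd := by
    rintro _ ⟨⟨z, hz⟩, rfl⟩
    refine ⟨?_, fd_fd z⟩
    simp only [LinearMap.domRestrict_apply]
    change z ∈ Finsupp.supported _ _ _ at hz
    rw [Finsupp.supported_eq_span_single] at hz
    induction hz using Submodule.span_induction with
    | zero => simp
    | add x y _ _ hx hy => rw [map_add]; exact Submodule.add_mem _ hx hy
    | smul a x _ hx => rw [map_smul]; exact Submodule.smul_mem _ _ hx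
    | mem x hx =>
      obtain ⟨t, ht, rfl⟩ := hx
      have ht' := ht
      rw [hT, Finset.mem_coe, Finset.mem_filter] at ht
      rw [fd_single]
      refine Submodule.sum_mem _ fun y hy => Finsupp.single_mem_supported _ _ ?_
      rw [hP, Finset.mem_coe, Finset.mem_filter]
      refine ⟨hM (t.erase_subset y) ht.1, ?_, t, ht', t.erase_subset y⟩
      have := Finset.card_erase_add_one hy; omega
  -- Boundaries of edges have augmentation zero, a single vertex does not. Hence the boundary map
  -- has rank less than `P.card ≤ T.card`, and its kernel is nonzero.
  have hlt : Q ⊓ LinearMap.ker fd < Q := by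
    refine lt_of_le_of_ne inf_le_left fun heq => ?_
    obtain ⟨x, hx⟩ : e.Nonempty := Finset.card_pos.1 (by omega)
    have hxP : {x} ∈ P := by
      rw [hP, Finset.mem_filter]
      exact ⟨hM (Finset.singleton_subset_iff.2 hx) he, by simp, e,
        Finset.mem_filter.2 ⟨he, he2⟩, Finset.singleton_subset_iff.2 hx⟩
    have : Finsupp.single {x} (1 : ZMod 2) ∈ Q ⊓ LinearMap.ker fd := by
      rw [heq]; exact Finsupp.single_mem_supported _ _ hxP
    have := DFunLike.congr_fun (LinearMap.mem_ker.1 this.2) ∅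
    rw [fd_single_apply, if_pos (by simp)] at this
    simp at this
  have hrank := LinearMap.finrank_range_add_finrank_ker (K := ZMod 2) (V := S) (V₂ := FC V)
    (fd.domRestrict S)
  have h1 : Module.finrank (ZMod 2) (LinearMap.range (fd.domRestrict S)) < P.card := by
    have hfin : FiniteDimensional (ZMod 2) (Q ⊓ LinearMap.ker fd : Submodule _ _) :=
      Submodule.finiteDimensional_of_le hlt.le
    calc _ ≤ _ := Submodule.finrank_mono hle
      _ < _ := Submodule.finrank_lt_finrank_of_lt hlt
      _ = _ := finrank_supported P
  have h2 : LinearMap.ker (fd.domRestrict S) ≠ ⊥ := by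
    intro h
    rw [h, finrank_bot, finrank_supported] at hrank
    omega
  obtain ⟨⟨z, hz⟩, hz1, hz2⟩ := Submodule.exists_mem_ne_zero_of_ne_bot h2
  refine ⟨z, hS ▸ hz, fun h => hz2 (Subtype.ext h), hz1⟩

/-- In top cardinality `n + 1`, the absence of free faces forces a cycle, for complexes of
dimension at most two all of whose edges are in at most two triangles. -/
lemma exists_top_cycle (M : Finset (Finset V)) (hM : IsLowerSet (M : Set (Finset V))) {n : ℕ}
    (hn : n ≤ 2)
    (h2 : ∀ e ∈ M, e.card = 2 → (M.filter fun t => e ⊆ t ∧ t.card = 3).card ≤ 2)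
    (h : ∀ σ ∈ M, σ.card = n → (M.filter fun τ => σ ⊆ τ ∧ τ.card = n + 1).card ≠ 1)
    {e : Finset V} (he : e ∈ M) (hen : e.card = n + 1) :
    ∃ z ∈ chains (M : Set (Finset V)) (n + 1), z ≠ 0 ∧ fd z = 0 := by
  interval_cases n
  -- That the empty set is not free means that there is a second vertex, and the sum of two vertices
  -- is an augmented cycle.
  · have h0 := h ∅ (hM (Finset.empty_subset e) he) rfl
    obtain ⟨e', he', hne⟩ : ∃ e' : Finset V, e' ∈ M.filter (fun τ : Finset V => ∅ ⊆ τ ∧ τ.card = 0 + 1) ∧ e' ≠ e := by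
      by_contra hcon
      push Not at hcon
      exact h0 (Finset.card_eq_one.2 ⟨e, Finset.eq_singleton_iff_unique_mem.2
        ⟨Finset.mem_filter.2 ⟨he, by simp, hen⟩, hcon⟩⟩)
    rw [Finset.mem_filter] at he'
    refine ⟨Finsupp.single e 1 + Finsupp.single e' 1, Submodule.add_mem _
      (Finsupp.single_mem_supported _ _ ⟨he, hen⟩)
      (Finsupp.single_mem_supported _ _ ⟨he'.1, he'.2.2⟩), fun hz => ?_, ?_⟩
    · have := DFunLike.congr_fun hz e
      simp [Finsupp.single_eq_of_ne hne.symm] at this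
    · obtain ⟨x, rfl⟩ := Finset.card_eq_one.1 hen
      obtain ⟨y, rfl⟩ := Finset.card_eq_one.1 he'.2.2
      rw [map_add, fd_single, fd_single]
      simp [ZModModule.add_self]
  · exact exists_cycle_of_graph M hM h he hen
  -- With no free edge, each edge lies in zero or two triangles, so the sum of all triangles is a
  -- cycle.
  · refine ⟨∑ t ∈ M.filter (fun t => t.card = 3), Finsupp.single t 1, ?_, fun hz => ?_, ?_⟩
    · refine Submodule.sum_mem _ fun t ht => Finsupp.single_mem_supported _ _ ?_
      exact ⟨Finset.mem_coe.2 (Finset.mem_filter.1 ht).1, (Finset.mem_filter.1 ht).2⟩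
    · have := DFunLike.congr_fun hz e
      rw [Finsupp.finsetSum_apply, Finset.sum_eq_single_of_mem e (Finset.mem_filter.2 ⟨he, hen⟩)
        (fun b _ hb => Finsupp.single_eq_of_ne hb.symm)] at this
      simp at this
    · ext σ
      rw [map_sum, Finsupp.finsetSum_apply]
      simp only [fd_single_apply, Finset.sum_boole, Finsupp.zero_apply, Finset.filter_filter]
      have hset : (M.filter fun t => t.card = 3 ∧ σ ⊆ t ∧ t.card = σ.card + 1) =
          if σ.card = 2 then M.filter fun t => σ ⊆ t ∧ t.card = 3 else ∅ := by
        split_ifs with hc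
        · ext; simp only [Finset.mem_filter, hc]; tauto
        · ext; simp only [Finset.mem_filter, Finset.notMem_empty, iff_false]; omega
      rw [hset]
      split_ifs with hc
      · by_cases hσ : σ ∈ M
        · have h3 := h σ hσ hc
          have h4 := h2 σ hσ hc
          generalize (M.filter fun t => σ ⊆ t ∧ t.card = 3).card = k at h3 h4
          interval_cases k
          · rfl
          · exact absurd rfl h3
          · rfl
        · rw [Finset.filter_eq_empty_iff.2]; · simp
          exact fun t ht hs => hσ (hM hs.1 ht)
      · simp

/-- A simplicial complex of dimension at most two, with every edge in at most two triangles, can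
be built perfectly above `ℤ/2`. -/
theorem build_of_edges_le_two (M : Finset (Finset V)) (hM : IsLowerSet (M : Set (Finset V)))
    (h3 : ∀ F ∈ M, F.card ≤ 3)
    (h2 : ∀ e ∈ M, e.card = 2 → (M.filter fun t => e ⊆ t ∧ t.card = 3).card ≤ 2) :
    Build fd M := by
  induction hc : M.card using Nat.strong_induction_on generalizing M with
  | _ m ih =>
  rcases M.eq_empty_or_nonempty with rfl | hne
  · exact Build.nil
  obtain ⟨F, hF, hmax⟩ := Finset.exists_max_image M Finset.card hne
  have sub : ∀ M' ⊆ M, M' ≠ M → IsLowerSet (M' : Set (Finset V)) → Build fd M' := by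
    intro M' hsub hne' hlow
    refine ih M'.card ?_ M' hlow (fun F hF => h3 F (hsub hF)) (fun e he h => ?_) rfl
    · exact hc ▸ Finset.card_lt_card (lt_of_le_of_ne hsub hne')
    · exact (Finset.card_le_card (Finset.filter_subset_filter _ hsub)).trans (h2 e (hsub he) h)
  have maximal : ∀ G ∈ M, G.card = F.card → ∀ ρ ∈ M, G ⊆ ρ → ρ = G := fun G _ hGF ρ hρ hG =>
    (Finset.eq_of_subset_of_card_le hG (hGF ▸ hmax ρ hρ)).symm
  -- A simplex of top cardinality occurring in a cycle can be the last one added, as a critical one: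
  -- the rest of the cycle has the same boundary.
  have crit : ∀ z ∈ chains (M : Set (Finset V)) F.card, z ≠ 0 → fd z = 0 → Build fd M := by
    intro z hz hz0 hdz
    obtain ⟨σ, hσz⟩ := Finsupp.support_nonempty_iff.2 hz0
    obtain ⟨hσM, hσc⟩ := hz hσz
    have hσ1 : z σ = 1 :=
      ((by decide : ∀ a : ZMod 2, a = 0 ∨ a = 1) (z σ)).resolve_left (Finsupp.mem_support_iff.1 hσz)
    have hB : Build fd (M.erase σ) := by
      refine sub _ (Finset.erase_subset _ _) (fun h => ?_) ?_
      · rw [← h] at hσM; simp at hσM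
      · intro a b hba ha
        rw [Finset.mem_coe, Finset.mem_erase] at ha ⊢
        refine ⟨?_, hM hba ha.2⟩
        rintro rfl
        exact ha.1 (maximal b hσM hσc a ha.2 hba)
    rw [← Finset.insert_erase hσM]
    refine Build.crit (z := z + Finsupp.single σ 1) hB ?_ ?_ ?_
    · intro ρ hρ hs
      rw [Finset.mem_erase] at hρ
      exact hρ.1 (maximal σ hσM hσc ρ hρ.2 hs)
    · intro ρ hρ
      have hne : ρ ≠ σ := by
        rintro rfl
        rw [Finset.mem_coe, Finsupp.mem_support_iff, Finsupp.add_apply, hσ1,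
          Finsupp.single_eq_same] at hρ
        exact hρ (by decide)
      rw [Finset.mem_coe, Finsupp.mem_support_iff, Finsupp.add_apply,
        Finsupp.single_eq_of_ne hne, add_zero] at hρ
      obtain ⟨h1, h2⟩ := hz (Finsupp.mem_support_iff.2 hρ)
      exact ⟨Finset.mem_coe.2 (Finset.mem_erase.2 ⟨hne, h1⟩), h2.trans hσc.symm⟩
    · rw [map_add, hdz, zero_add]
  rcases hn : F.card with _ | n
  -- Here `M` consists of the empty set alone, which is a cycle by itself.
  · refine crit (Finsupp.single F 1) (Finsupp.single_mem_supported _ _ ⟨hF, rfl⟩) (by simp) ?_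
    rw [Finset.card_eq_zero.1 hn, fd_single]; simp
  by_cases hfree : ∃ σ ∈ M, σ.card = n ∧ (M.filter fun τ => σ ⊆ τ ∧ τ.card = n + 1).card = 1
  · obtain ⟨σ, hσM, hσn, hσ1⟩ := hfree
    obtain ⟨τ, hτ⟩ := Finset.card_eq_one.1 hσ1
    have hτ' : τ ∈ M.filter fun τ => σ ⊆ τ ∧ τ.card = n + 1 := by rw [hτ]; simp
    obtain ⟨hτM, hστ, hτn⟩ := Finset.mem_filter.1 hτ'
    obtain ⟨x, hxσ, rfl⟩ : ∃ x, x ∉ σ ∧ insert x σ = τ := by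
      obtain ⟨x, hx⟩ := Finset.exists_eq_insert_iff.2 ⟨hστ, by omega⟩
      exact ⟨x, hx⟩
    -- Since `n + 1` is the largest cardinality in `M`, freeness controls all cofaces of `σ`, so `σ`
    -- and `insert x σ` can be added last as a pair.
    have above : ∀ ρ ∈ M, σ ⊆ ρ → ρ = σ ∨ ρ = insert x σ := by
      intro ρ hρ hs
      rcases (Finset.card_le_card hs).lt_or_eq with hlt | heq
      · right
        have : ρ ∈ M.filter fun τ => σ ⊆ τ ∧ τ.card = n + 1 :=
          Finset.mem_filter.2 ⟨hρ, hs, by have := hmax ρ hρ; omega⟩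
        rw [hτ] at this
        exact Finset.mem_singleton.1 this
      · exact Or.inl (Finset.eq_of_subset_of_card_le hs heq.ge).symm
    have hMeq : insert (insert x σ) (insert σ ((M.erase σ).erase (insert x σ))) = M := by
      rw [Finset.insert_comm, Finset.insert_erase, Finset.insert_erase hσM]
      refine Finset.mem_erase.2 ⟨fun h => hxσ ?_, hτM⟩
      rw [← h]; simp
    rw [← hMeq]
    refine Build.pair (sub _ ?_ (fun h => ?_) ?_) ?_ hxσ ?_
    · exact (Finset.erase_subset _ _).trans (Finset.erase_subset _ _)
    · rw [← h] at hσM; simp at hσM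
    · intro a b hba ha
      simp only [Finset.mem_coe, Finset.mem_erase] at ha ⊢
      refine ⟨?_, ?_, hM hba ha.2.2⟩
      · rintro rfl
        rcases above a ha.2.2 ((Finset.subset_insert _ _).trans hba) with h | h
        exacts [ha.2.1 h, ha.1 h]
      · rintro rfl
        rcases above a ha.2.2 hba with h | h
        exacts [ha.2.1 h, ha.1 h]
    · intro ρ hρ hs
      simp only [Finset.mem_erase] at hρ
      rcases above ρ hρ.2.2 hs with h | h
      exacts [hρ.2.1 h, hρ.1 h]
    · rw [fd_single, Finset.sum_insert hxσ, Finset.erase_insert hxσ, add_comm, ← add_assoc,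
        ZModModule.add_self, zero_add]
      refine Submodule.sum_mem _ fun y hy => Finsupp.single_mem_supported _ _ ⟨?_, ?_⟩
      · simp only [Finset.coe_erase, Set.mem_sdiff, Finset.mem_coe, Set.mem_singleton_iff]
        refine ⟨⟨hM (Finset.erase_subset _ _) hτM, fun h => ?_⟩, fun h => ?_⟩
        · rw [← h] at hy; simp at hy
        · have : y ∈ (insert x σ).erase y := by rw [h]; exact Finset.mem_insert_of_mem hy
          simp at this
      · rw [Finset.card_erase_of_mem (Finset.mem_insert_of_mem hy), hτn, hσn]; rfl
  · push Not at hfree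
    have h33 := h3 F hF
    obtain ⟨z, hz, hz0, hdz⟩ := exists_top_cycle M hM (by omega : n ≤ 2) h2 hfree hF hn
    exact crit z (hn ▸ hz) hz0 hdz

end Build

/-! ### From a building sequence to a Morse function and a rank count. -/

section Count

variable {V : Type*} [DecidableEq V]

lemma finrank_sup_span_singleton {M : Type*} [AddCommGroup M] [Module (ZMod 2) M]
    (W : Submodule (ZMod 2) M) [FiniteDimensional (ZMod 2) W] {v : M} (hv : v ∉ W) :
    Module.finrank (ZMod 2) (W ⊔ Submodule.span (ZMod 2) {v} : Submodule (ZMod 2) M) =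
      Module.finrank (ZMod 2) W + 1 := by
  have hv0 : v ≠ 0 := fun h => hv (h ▸ W.zero_mem)
  have h := Submodule.finrank_sup_add_finrank_inf_eq W (Submodule.span (ZMod 2) {v})
  have hd : W ⊓ Submodule.span (ZMod 2) {v} = ⊥ :=
    ((Submodule.disjoint_span_singleton' hv0).2 hv).eq_bot
  rw [hd, finrank_bot, finrank_span_singleton hv0] at h
  exact h

lemma chains_insert_of_card_ne (A : Finset (Finset V)) {σ : Finset V} {n : ℕ} (h : σ.card ≠ n) :
    chains ((insert σ A : Finset _) : Set (Finset V)) n = chains (A : Set (Finset V)) n := by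
  rw [mem_chains_coe, mem_chains_coe, Finset.filter_insert, if_neg h]

lemma chains_insert (A : Finset (Finset V)) (σ : Finset V) :
    chains ((insert σ A : Finset _) : Set (Finset V)) σ.card =
      chains (A : Set (Finset V)) σ.card ⊔ Submodule.span (ZMod 2) {Finsupp.single σ 1} := by
  have : Submodule.span (ZMod 2) {Finsupp.single σ (1 : ZMod 2)} =
      Finsupp.supported (ZMod 2) (ZMod 2) {σ} := by
    rw [Finsupp.supported_eq_span_single, Set.image_singleton]
  rw [this, chains, chains, ← Finsupp.supported_union]
  congr 1
  ext F
  simp only [Finset.coe_insert, Set.mem_insert_iff, Set.mem_ofPred_eq, Set.mem_union,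
    Set.mem_singleton_iff]
  constructor
  · rintro ⟨rfl | h1, h2⟩
    exacts [Or.inr rfl, Or.inl ⟨h1, h2⟩]
  · rintro (h1 | rfl)
    exacts [⟨Or.inr h1.1, h1.2⟩, ⟨Or.inl rfl, rfl⟩]

/-- The rank of the boundary map `D` on chains of cardinality `n`. -/
def bdRank (D : FC V →ₗ[ZMod 2] FC V) (A : Finset (Finset V)) (n : ℕ) : ℕ :=
  Module.finrank (ZMod 2) ((chains (A : Set (Finset V)) n).map D)

lemma bdRank_insert_of_card_ne (D : FC V →ₗ[ZMod 2] FC V) (A : Finset (Finset V))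
    {σ : Finset V} {n : ℕ} (h : σ.card ≠ n) : bdRank D (insert σ A) n = bdRank D A n := by
  rw [bdRank, chains_insert_of_card_ne A h, bdRank]

lemma bdRank_insert_of_mem (D : FC V →ₗ[ZMod 2] FC V) (A : Finset (Finset V))
    {σ : Finset V} (h : D (Finsupp.single σ 1) ∈ (chains (A : Set (Finset V)) σ.card).map D)
    (n : ℕ) : bdRank D (insert σ A) n = bdRank D A n := by
  by_cases hn : σ.card = n
  · subst hn
    rw [bdRank, chains_insert, Submodule.map_sup, Submodule.map_span, Set.image_singleton,
      sup_eq_left.2 ((Submodule.span_singleton_le_iff_mem _ _).2 h), bdRank]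
  · exact bdRank_insert_of_card_ne D A hn

lemma bdRank_insert_of_notMem (D : FC V →ₗ[ZMod 2] FC V) (A : Finset (Finset V))
    {σ : Finset V} (h : D (Finsupp.single σ 1) ∉ (chains (A : Set (Finset V)) σ.card).map D) :
    bdRank D (insert σ A) σ.card = bdRank D A σ.card + 1 := by
  rw [bdRank, chains_insert, Submodule.map_sup, Submodule.map_span, Set.image_singleton]
  have : FiniteDimensional (ZMod 2) ((chains (A : Set (Finset V)) σ.card).map D) := by
    rw [mem_chains_coe]; infer_instance
  exact finrank_sup_span_singleton _ h

lemma card_filter_insert (A : Finset (Finset V)) {σ : Finset V} (hσ : σ ∉ A) (n : ℕ) :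
    ((insert σ A).filter fun F => F.card = n).card =
      (A.filter fun F => F.card = n).card + if σ.card = n then 1 else 0 := by
  rw [Finset.filter_insert]
  split_ifs
  · rw [Finset.card_insert_of_notMem (by simp [hσ])]
  · rfl

/-- A built family carries a monotone, at most two-to-one function, whose set `C` of critical sets
has, in each cardinality, as many members as the dimension of homology. -/
theorem Build.exists_morse {D : FC V →ₗ[ZMod 2] FC V} (hDD : ∀ c, D (D c) = 0)
    (hDs : ∀ ρ, D (Finsupp.single ρ 1) ∈ Finsupp.supported (ZMod 2) (ZMod 2) {G | G ⊆ ρ})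
    {A : Finset (Finset V)} (h : Build D A) :
    ∃ (f : Finset V → ℤ) (N : ℤ) (C : Finset (Finset V)), C ⊆ A ∧ (∀ σ ∈ A, f σ < N) ∧
      (∀ σ ∈ A, ∀ τ ∈ A, σ ⊆ τ → f σ ≤ f τ) ∧
      (∀ m : ℤ, (A.filter fun σ => f σ = m).card ≤ 2) ∧
      (∀ σ ∈ A, ∀ τ ∈ A, f σ = f τ → σ ⊆ τ ∨ τ ⊆ σ) ∧
      (∀ σ ∈ A, σ ∈ C ↔ ∀ τ ∈ A, f τ = f σ → τ = σ) ∧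
      ∀ n, (A.filter fun F => F.card = n).card =
        (C.filter fun F => F.card = n).card + bdRank D A n + bdRank D A (n + 1) := by
  induction h with
  | nil => 
    have h (n : ℕ) : bdRank D ∅ n = 0 := by
      have : chains ((∅ : Finset (Finset V)) : Set (Finset V)) n = ⊥ := by simp [chains]
      rw [bdRank, this, Submodule.map_bot, finrank_bot]
    exact ⟨0, 0, ∅, by simp [h]⟩
  | @crit A σ z hA hσ hz hD ih =>
    obtain ⟨f, N, C, hCA, hN, hmono, htwo, hcomp, hcrit, hcount⟩ := ih
    have hσA : σ ∉ A := fun h => hσ σ h subset_rfl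
    have hne : ∀ ρ ∈ A, ρ ≠ σ := fun ρ hρ h => hσA (h ▸ hρ)
    -- `N` exceeds all earlier values, so the new set receives a level of its own.
    set g : Finset V → ℤ := fun ρ => if ρ = σ then N else f ρ with hg
    have hgσ : g σ = N := by simp [hg]
    have hgA : ∀ ρ ∈ A, g ρ = f ρ := fun ρ hρ => by simp [hg, hne ρ hρ]
    have cases : ∀ ρ ∈ insert σ A, (g ρ = N ∧ ρ = σ) ∨ (ρ ∈ A ∧ g ρ = f ρ ∧ f ρ < N) := by
      intro ρ hρ
      rcases Finset.mem_insert.1 hρ with rfl | hρ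
      · exact Or.inl ⟨hgσ, rfl⟩
      · exact Or.inr ⟨hρ, hgA ρ hρ, hN ρ hρ⟩
    refine ⟨g, N + 1, insert σ C, Finset.insert_subset_insert _ hCA, ?_, ?_, ?_, ?_, ?_, ?_⟩
    · intro ρ hρ
      rcases cases ρ hρ with ⟨h, _⟩ | ⟨_, h, h'⟩ <;> omega
    · intro ρ hρ ρ' hρ' hs
      rcases cases ρ hρ with ⟨h1, h2⟩ | ⟨h1, h2, h3⟩ <;>
        rcases cases ρ' hρ' with ⟨h4, h5⟩ | ⟨h4, h5, h6⟩
      · omega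
      · exact absurd (h2 ▸ hs) (hσ ρ' h4)
      · omega
      · rw [h2, h5]; exact hmono ρ h1 ρ' h4 hs
    · intro m
      rw [Finset.filter_insert, Finset.filter_congr fun ρ hρ => by rw [hgA ρ hρ]]
      split_ifs with hm
      · rw [Finset.filter_eq_empty_iff.2 fun ρ hρ => by have := hN ρ hρ; omega]
        simp
      · exact htwo m
    · intro ρ hρ ρ' hρ' heq
      rcases cases ρ hρ with ⟨h1, h2⟩ | ⟨h1, h2, h3⟩ <;>
        rcases cases ρ' hρ' with ⟨h4, h5⟩ | ⟨h4, h5, h6⟩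
      · exact Or.inl (h2.trans h5.symm).le
      · omega
      · omega
      · exact hcomp ρ h1 ρ' h4 (by omega)
    · intro ρ hρ
      rcases cases ρ hρ with ⟨h1, h2⟩ | ⟨h1, h2, h3⟩
      · refine ⟨fun _ ρ' hρ' heq => ?_, fun _ => h2 ▸ Finset.mem_insert_self _ _⟩
        rcases cases ρ' hρ' with ⟨h4, h5⟩ | ⟨h4, h5, h6⟩
        · exact h5.trans h2.symm
        · omega
      · rw [Finset.mem_insert, or_iff_right (hne ρ h1), hcrit ρ h1]
        constructor
        · intro h ρ' hρ' heq
          rcases cases ρ' hρ' with ⟨h4, h5⟩ | ⟨h4, h5, h6⟩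
          · omega
          · exact h ρ' h4 (by omega)
        · intro h ρ' hρ' heq
          exact h ρ' (by simp [hρ']) (by rw [h2, hgA ρ' hρ', heq])
    · intro n
      -- The new boundary already lies in the image, so no rank changes and the new set is balanced
      -- by `C` alone.
      have hr := bdRank_insert_of_mem D A (σ := σ) ⟨z, hz, hD.symm⟩
      rw [card_filter_insert A hσA, card_filter_insert C (fun h => hσA (hCA h)), hr, hr, hcount n]
      ring
  | @pair A σ x hA hσ hx hD ih =>
    obtain ⟨f, N, C, hCA, hN, hmono, htwo, hcomp, hcrit, hcount⟩ := ih
    set τ := insert x σ with hτ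
    have hστ : σ ⊆ τ := Finset.subset_insert _ _
    have hστ' : σ ≠ τ := fun h => hx (h ▸ Finset.mem_insert_self x σ)
    have hτc : τ.card = σ.card + 1 := Finset.card_insert_of_notMem hx
    have hσA : σ ∉ A := fun h => hσ σ h subset_rfl
    have hτA : τ ∉ A := fun h => hσ τ h hστ
    have hneσ : ∀ ρ ∈ A, ρ ≠ σ := fun ρ hρ h => hσA (h ▸ hρ)
    have hneτ : ∀ ρ ∈ A, ρ ≠ τ := fun ρ hρ h => hτA (h ▸ hρ)
    have hτA' : τ ∉ insert σ A := by simp [hτA, hστ'.symm]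
    -- Both members of the pair share the new level, so neither joins `C`.
    set g : Finset V → ℤ := fun ρ => if ρ = σ ∨ ρ = τ then N else f ρ with hg
    have hgσ : g σ = N := by simp [hg]
    have hgτ : g τ = N := by simp [hg]
    have hgA : ∀ ρ ∈ A, g ρ = f ρ := fun ρ hρ => by simp [hg, hneσ ρ hρ, hneτ ρ hρ]
    have cases : ∀ ρ ∈ insert τ (insert σ A), (g ρ = N ∧ (ρ = σ ∨ ρ = τ)) ∨
        (ρ ∈ A ∧ g ρ = f ρ ∧ f ρ < N) := by
      intro ρ hρ
      rcases Finset.mem_insert.1 hρ with rfl | hρ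
      · exact Or.inl ⟨hgτ, Or.inr rfl⟩
      rcases Finset.mem_insert.1 hρ with rfl | hρ
      · exact Or.inl ⟨hgσ, Or.inl rfl⟩
      · exact Or.inr ⟨hρ, hgA ρ hρ, hN ρ hρ⟩
    refine ⟨g, N + 1, C, ?_, ?_, ?_, ?_, ?_, ?_, ?_⟩
    · exact hCA.trans ((Finset.subset_insert _ _).trans (Finset.subset_insert _ _))
    · intro ρ hρ
      rcases cases ρ hρ with ⟨h, _⟩ | ⟨_, h, h'⟩ <;> omega
    · intro ρ hρ ρ' hρ' hs
      rcases cases ρ hρ with ⟨h1, h2⟩ | ⟨h1, h2, h3⟩ <;>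
        rcases cases ρ' hρ' with ⟨h4, h5⟩ | ⟨h4, h5, h6⟩
      · omega
      · rcases h2 with rfl | rfl
        · exact absurd hs (hσ ρ' h4)
        · exact absurd (hστ.trans hs) (hσ ρ' h4)
      · omega
      · rw [h2, h5]; exact hmono ρ h1 ρ' h4 hs
    · intro m
      by_cases hm : m = N
      · subst hm
        refine (Finset.card_le_card (t := {σ, τ}) fun ρ hρ => ?_).trans Finset.card_le_two
        obtain ⟨h1, h2⟩ := Finset.mem_filter.1 hρ
        rcases cases ρ h1 with ⟨_, h⟩ | ⟨_, h, h'⟩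
        · simpa using h
        · omega
      · refine (Finset.card_le_card fun ρ hρ => ?_).trans (htwo m)
        obtain ⟨h1, h2⟩ := Finset.mem_filter.1 hρ
        rcases cases ρ h1 with ⟨h, _⟩ | ⟨h0, h, h'⟩
        · omega
        · exact Finset.mem_filter.2 ⟨h0, by omega⟩
    · intro ρ hρ ρ' hρ' heq
      rcases cases ρ hρ with ⟨h1, h2⟩ | ⟨h1, h2, h3⟩ <;>
        rcases cases ρ' hρ' with ⟨h4, h5⟩ | ⟨h4, h5, h6⟩
      · rcases h2 with rfl | rfl <;> rcases h5 with rfl | rfl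
        exacts [Or.inl subset_rfl, Or.inl hστ, Or.inr hστ, Or.inl subset_rfl]
      · omega
      · omega
      · exact hcomp ρ h1 ρ' h4 (by omega)
    · intro ρ hρ
      have hσm : σ ∈ insert τ (insert σ A) := by simp
      have hτm : τ ∈ insert τ (insert σ A) := by simp
      rcases cases ρ hρ with ⟨h1, h2⟩ | ⟨h1, h2, h3⟩
      · constructor
        · intro h
          rcases h2 with rfl | rfl
          exacts [absurd (hCA h) hσA, absurd (hCA h) hτA]
        · intro h
          have e1 := h σ hσm (by omega)
          have e2 := h τ hτm (by omega)
          exact absurd (e1.trans e2.symm) hστ'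
      · rw [hcrit ρ h1]
        constructor
        · intro h ρ' hρ' heq
          rcases cases ρ' hρ' with ⟨h4, h5⟩ | ⟨h4, h5, h6⟩
          · omega
          · exact h ρ' h4 (by omega)
        · intro h ρ' hρ' heq
          exact h ρ' (by simp [hρ']) (by rw [h2, hgA ρ' hρ', heq])
    · intro n
      set w := D (Finsupp.single τ 1) + Finsupp.single σ 1 with hw
      have hDτ : D (Finsupp.single τ 1) = w + Finsupp.single σ 1 := by
        rw [hw, add_assoc, ZModModule.add_self, add_zero]
      -- From `D (D τ) = 0`, the boundary of `σ` is that of the older chain `w`, so adding `σ`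
      -- raises no rank.
      have hDσ : D (Finsupp.single σ 1) = D w := by
        have := hDD (Finsupp.single τ 1)
        rw [hDτ, map_add] at this
        rw [← zero_add (D w), ← this, add_comm (D w), add_assoc, ZModModule.add_self, add_zero]
      have hr1 := bdRank_insert_of_mem D A (σ := σ) ⟨w, hD, hDσ.symm⟩
      have hzero : ∀ c ∈ chains ((insert σ A : Finset _) : Set (Finset V)) τ.card,
          D c σ = 0 := by
        rw [chains_insert_of_card_ne A (by omega), chains, Finsupp.supported_eq_span_single]
        intro c hc
        induction hc using Submodule.span_induction with
        | zero => simp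
        | add x y _ _ hx hy => simp [hx, hy]
        | smul a x _ hx => simp [hx]
        | mem c hc =>
          obtain ⟨ρ, ⟨hρ, _⟩, rfl⟩ := hc
          by_contra hne
          exact hσ ρ hρ (hDs ρ (Finsupp.mem_support_iff.2 hne))
      -- The boundary of `τ` contains `σ`, which is a face of no earlier set. Adding `τ` thus raises
      -- one rank by one, and that rank enters the count in the cardinalities of both `σ` and `τ`.
      have hnot : D (Finsupp.single τ 1) ∉
          (chains ((insert σ A : Finset _) : Set (Finset V)) τ.card).map D := by
        rintro ⟨c, hc, hcτ⟩
        have h0 := hzero c hc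
        rw [hcτ, hDτ, Finsupp.add_apply, Finsupp.single_eq_same] at h0
        have hwσ : w σ = 0 := by
          by_contra hne
          exact hσA (hD (Finsupp.mem_support_iff.2 hne)).1
        rw [hwσ] at h0
        exact absurd h0 (by decide)
      have hr2 := bdRank_insert_of_notMem D (insert σ A) hnot
      rw [card_filter_insert _ hτA', card_filter_insert A hσA, hcount n]
      by_cases h1 : n = σ.card
      · subst h1
        rw [bdRank_insert_of_card_ne D (insert σ A) (by omega : τ.card ≠ σ.card), hr1]
        rw [hτc] at hr2
        rw [hr2, hr1, if_pos rfl, if_neg (by omega)]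
        ring
      by_cases h2 : n = τ.card
      · subst h2
        rw [bdRank_insert_of_card_ne D (insert σ A) (by omega : τ.card ≠ τ.card + 1), hr1, hr2,
          hr1, if_pos rfl, if_neg (by omega)]
        ring
      · rw [bdRank_insert_of_card_ne D (insert σ A) (by omega : τ.card ≠ n),
          bdRank_insert_of_card_ne D (insert σ A) (by omega : τ.card ≠ n + 1), hr1, hr1,
          if_neg (by omega), if_neg (by omega)]
        ring

end Count

/-! ### Adding the star of a vertex along its link. -/

section Join

variable {V : Type*} [DecidableEq V]

/-- The projection killing the empty set. -/
def dropEmpty : FC V →ₗ[ZMod 2] FC V :=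
  Finsupp.linearCombination (ZMod 2) fun F => if F = ∅ then 0 else Finsupp.single F 1

lemma dropEmpty_single (F : Finset V) :
    dropEmpty (Finsupp.single F 1) = if F = ∅ then 0 else Finsupp.single F 1 := by
  simp [dropEmpty]

lemma dropEmpty_of_mem {c : FC V}
    (hc : c ∈ Finsupp.supported (ZMod 2) (ZMod 2) {F : Finset V | F ≠ ∅}) : dropEmpty c = c := by
  rw [Finsupp.supported_eq_span_single] at hc
  induction hc using Submodule.span_induction with
  | zero => simp
  | add x y _ _ hx hy => rw [map_add, hx, hy]
  | smul a x _ hx => rw [map_smul, hx]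
  | mem c hc =>
    obtain ⟨F, hF, rfl⟩ := hc
    rw [dropEmpty_single, if_neg hF]

lemma fd_dropEmpty (c : FC V) : fd (dropEmpty c) = fd c := by
  have : fd ∘ₗ dropEmpty = (fd : FC V →ₗ[ZMod 2] _) := by
    refine lin_ext fun F => ?_
    rw [LinearMap.comp_apply, dropEmpty_single]
    split_ifs with h
    · rw [h, fd_single]; simp
    · rfl
  exact LinearMap.congr_fun this c

/-- The unaugmented simplicial boundary. -/
def ud : FC V →ₗ[ZMod 2] FC V := dropEmpty ∘ₗ fd

lemma ud_apply (c : FC V) : ud c = dropEmpty (fd c) := rfl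

lemma ud_ud (c : FC V) : ud (ud c) = 0 := by
  rw [ud_apply, ud_apply, fd_dropEmpty, fd_fd, map_zero]

lemma dropEmpty_mem_supported {S : Set (Finset V)} {c : FC V}
    (hc : c ∈ Finsupp.supported (ZMod 2) (ZMod 2) S) :
    dropEmpty c ∈ Finsupp.supported (ZMod 2) (ZMod 2) S := by
  rw [Finsupp.supported_eq_span_single] at hc
  induction hc using Submodule.span_induction with
  | zero => simp
  | add x y _ _ hx hy => rw [map_add]; exact Submodule.add_mem _ hx hy
  | smul a x _ hx => rw [map_smul]; exact Submodule.smul_mem _ _ hx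
  | mem c hc =>
    obtain ⟨F, hF, rfl⟩ := hc
    rw [dropEmpty_single]
    split_ifs
    · simp
    · exact Finsupp.single_mem_supported _ _ hF

lemma ud_single_mem (ρ : Finset V) :
    ud (Finsupp.single ρ 1) ∈ Finsupp.supported (ZMod 2) (ZMod 2) {G | G ⊆ ρ} := by
  refine dropEmpty_mem_supported ?_
  rw [fd_single]
  exact Submodule.sum_mem _ fun x _ => Finsupp.single_mem_supported _ _ (ρ.erase_subset x)

lemma fcone_mem {v : V} {A B : Set (Finset V)} {n : ℕ} {c : FC V} (hc : c ∈ chains A n)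
    (hAB : ∀ F ∈ A, v ∉ F → insert v F ∈ B) : fcone v c ∈ chains B (n + 1) := by
  rw [chains, Finsupp.supported_eq_span_single] at hc
  induction hc using Submodule.span_induction with
  | zero => simp
  | add x y _ _ hx hy => rw [map_add]; exact Submodule.add_mem _ hx hy
  | smul a x _ hx => rw [map_smul]; exact Submodule.smul_mem _ _ hx
  | mem c hc =>
    obtain ⟨F, ⟨hF, hn⟩, rfl⟩ := hc
    rw [fcone_single]
    split_ifs with h
    · simp
    · exact Finsupp.single_mem_supported _ _ ⟨hAB F hF h,
        by rw [Finset.card_insert_of_notMem h, hn]⟩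

/-- Adding the star of a vertex `v` to a built complex `A`, where the link `L` of `v` in `A` is
built and all cycles of `L` bound in `A`. -/
theorem Build.join {v : V} {A L : Finset (Finset V)} (hA : Build ud A)
    (hvA : ∀ ρ ∈ A, v ∉ ρ) (hvL : ∀ ρ ∈ L, v ∉ ρ) (hLA : ∀ ρ ∈ L, ρ ≠ ∅ → ρ ∈ A)
    (hcyc : ∀ n ≠ 0, ∀ z ∈ chains (L : Set (Finset V)) n, fd z = 0 →
      ∃ z' ∈ chains (A : Set (Finset V)) (n + 1), fd z' = z)
    {M : Finset (Finset V)} (hM : Build fd M) (hML : M ⊆ L) :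
    Build ud (A ∪ M.image (insert v)) := by
  have inj : ∀ σ ρ : Finset V, v ∉ σ → insert v σ ⊆ insert v ρ → σ ⊆ ρ := fun σ ρ hσ h y hy =>
    Finset.mem_of_mem_insert_of_ne (h (Finset.mem_insert_of_mem hy)) fun e => hσ (e ▸ hy)
  have notSub : ∀ M : Finset (Finset V), ∀ σ, v ∉ σ → (∀ ρ ∈ M, ¬ σ ⊆ ρ) →
      ∀ ρ ∈ A ∪ M.image (insert v), ¬ insert v σ ⊆ ρ := by
    intro M σ hσ h ρ hρ hs
    rcases Finset.mem_union.1 hρ with hρ | hρ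
    · exact hvA ρ hρ (hs (Finset.mem_insert_self _ _))
    · obtain ⟨ρ', hρ', rfl⟩ := Finset.mem_image.1 hρ
      exact h ρ' hρ' (inj σ ρ' hσ hs)
  have coneMem : ∀ (M : Finset (Finset V)) (n : ℕ) (c : FC V), c ∈ chains (M : Set (Finset V)) n →
      fcone v c ∈ chains ((A ∪ M.image (insert v) : Finset _) : Set (Finset V)) (n + 1) := by
    intro M n c hc
    exact fcone_mem hc fun F hF _ => Finset.mem_coe.2
      (Finset.mem_union_right _ (Finset.mem_image_of_mem _ hF))
  have subMem : ∀ (M : Finset (Finset V)) (n : ℕ) (c : FC V), c ∈ chains (A : Set (Finset V)) n →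
      c ∈ chains ((A ∪ M.image (insert v) : Finset _) : Set (Finset V)) n := by
    intro M n c hc
    exact Finsupp.supported_mono (fun F hF => show F ∈ _ ∧ _ from ⟨Finset.mem_coe.2
      (Finset.mem_union_left _ hF.1), hF.2⟩) hc
  -- The induction follows the building of the link, with `M` a partial stage inside the fixed `L`;
  -- each step for `σ` becomes a step of the same kind for `insert v σ`.
  induction hM with
  | nil => simpa using hA
  | @crit M σ z hM hσ hz hD ih =>
    have hσL : σ ∈ L := hML (Finset.mem_insert_self _ _)
    have hvσ := hvL σ hσL
    have hML' : M ⊆ L := (Finset.subset_insert _ _).trans hML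
    rw [Finset.image_insert, Finset.union_insert]
    by_cases h0 : σ = ∅
    -- The joined face is `{v}`, a cycle for the unaugmented boundary.
    · subst h0
      refine Build.crit (z := 0) (ih hML') (notSub M _ hvσ hσ) (Submodule.zero_mem _) ?_
      rw [map_zero, ud_apply, fd_single]
      simp [dropEmpty_single]
    · have hcard : σ.card ≠ 0 := fun h => h0 (Finset.card_eq_zero.1 h)
      -- The cycle `σ + z` of the link bounds both `y` in `A` and its cone from `v`; together these
      -- form a cycle through `insert v σ`.
      obtain ⟨y, hy, hyz⟩ := hcyc σ.card hcard (Finsupp.single σ 1 + z)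
        (Submodule.add_mem _ (Finsupp.single_mem_supported _ _ ⟨hσL, rfl⟩)
          (Finsupp.supported_mono (fun F hF => show F ∈ _ ∧ _ from ⟨hML' hF.1, hF.2⟩) hz))
        (by rw [map_add, hD, ZModModule.add_self])
      refine Build.crit (z := fcone v z + y) (ih hML') (notSub M _ hvσ hσ) ?_ ?_
      · rw [Finset.card_insert_of_notMem hvσ]
        exact Submodule.add_mem _ (coneMem M _ z hz) (subMem M _ y hy)
      · have h1 : Finsupp.single (insert v σ) (1 : ZMod 2) = fcone v (Finsupp.single σ 1) := by
          rw [fcone_single, if_neg hvσ]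
        rw [ud_apply, ud_apply, h1, fd_fcone, map_add fd, fd_fcone, hyz, hD]
        congr 1
        rw [add_comm (z + _), add_assoc, ← add_assoc z, ZModModule.add_self, zero_add]
  | @pair M σ x hM hσ hx hD ih =>
    have hτL : insert x σ ∈ L := hML (Finset.mem_insert_self _ _)
    have hσL : σ ∈ L := hML (Finset.mem_insert_of_mem (Finset.mem_insert_self _ _))
    have hvσ := hvL σ hσL
    have hvτ := hvL _ hτL
    have hML' : M ⊆ L :=
      ((Finset.subset_insert _ _).trans (Finset.subset_insert _ _)).trans hML
    have hxv : x ≠ v := fun h => hvτ (h ▸ Finset.mem_insert_self _ _)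
    rw [Finset.image_insert, Finset.image_insert, Finset.union_insert, Finset.union_insert,
      Finset.insert_comm v x]
    refine Build.pair (ih hML') (notSub M _ hvσ hσ) (by simp [hxv, hx]) ?_
    have h1 : Finsupp.single (insert x (insert v σ)) (1 : ZMod 2) =
        fcone v (Finsupp.single (insert x σ) 1) := by
      rw [fcone_single, if_neg hvτ, Finset.insert_comm]
    have h2 : Finsupp.single (insert v σ) (1 : ZMod 2) = fcone v (Finsupp.single σ 1) := by
      rw [fcone_single, if_neg hvσ]
    set w := fd (Finsupp.single (insert x σ) 1) + Finsupp.single σ 1 with hw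
    have h3 : fd (Finsupp.single (insert x σ) 1) = w + Finsupp.single σ 1 := by
      rw [hw, add_assoc, ZModModule.add_self, add_zero]
    -- Write `τ` for `insert x σ`. The boundary of `v * τ` is `τ`, an old face, plus `v * σ`, its
    -- partner, plus `v * w`, which was added at earlier stages.
    have h4 : ud (Finsupp.single (insert x (insert v σ)) 1) + Finsupp.single (insert v σ) 1 =
        Finsupp.single (insert x σ) 1 + dropEmpty (fcone v w) := by
      rw [h1, ud_apply, fd_fcone, h3, map_add (fcone v), ← h2, map_add, map_add,
        dropEmpty_single, dropEmpty_single, if_neg (Finset.insert_ne_empty _ _),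
        if_neg (Finset.insert_ne_empty _ _), add_assoc, add_assoc, ZModModule.add_self, add_zero]
    rw [h4, Finset.card_insert_of_notMem hvσ]
    refine Submodule.add_mem _ (subMem M _ _ (Finsupp.single_mem_supported _ _
      ⟨hLA _ hτL (Finset.insert_ne_empty _ _), Finset.card_insert_of_notMem hx⟩)) ?_
    exact dropEmpty_mem_supported (coneMem M _ w hD)

end Join

/-! ### Barycentric subdivision of tuple chains -/

section Subdivision

variable {V W : Type*}

lemma cone_mem {n : ℕ} {v : V} {P : Set (Fin n → V)} {Q : Set (Fin (n + 1) → V)} {c : Ch V n}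
    (hc : c ∈ Finsupp.supported (ZMod 2) (ZMod 2) P)
    (h : ∀ u ∈ P, (Fin.cons v u : Fin (n + 1) → V) ∈ Q) :
    cone v c ∈ Finsupp.supported (ZMod 2) (ZMod 2) Q := by
  classical
  intro u hu
  have := Finsupp.mapDomain_support hu
  simp only [Finset.mem_image] at this
  obtain ⟨w, hw, rfl⟩ := this
  exact h w (hc hw)

/-- Linear maps respect supports as soon as they do so on generators. -/
lemma map_mem_supported {A B : Type*} {P : Set A} {Q : Set B}
    (f : (A →₀ ZMod 2) →ₗ[ZMod 2] (B →₀ ZMod 2))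
    (h : ∀ a ∈ P, f (Finsupp.single a 1) ∈ Finsupp.supported (ZMod 2) (ZMod 2) Q)
    {c : A →₀ ZMod 2} (hc : c ∈ Finsupp.supported (ZMod 2) (ZMod 2) P) :
    f c ∈ Finsupp.supported (ZMod 2) (ZMod 2) Q := by
  rw [Finsupp.supported_eq_span_single] at hc
  induction hc using Submodule.span_induction with
  | zero => simp
  | add x y _ _ hx hy => rw [map_add]; exact Submodule.add_mem _ hx hy
  | smul a x _ hx => rw [map_smul]; exact Submodule.smul_mem _ _ hx
  | mem c hc =>
    obtain ⟨a, ha, rfl⟩ := hc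
    exact h a ha

lemma coneHtpy_natural {V' W' : Type*} {h : ∀ n, Ch V n →ₗ[ZMod 2] Ch W n}
    {c : ∀ n, (Fin (n + 1) → V) → W} {h' : ∀ n, Ch V' n →ₗ[ZMod 2] Ch W' n}
    {c' : ∀ n, (Fin (n + 1) → V') → W'} (g : V → V') (g' : W → W')
    (hh : ∀ n x, chMap g' n (h n x) = h' n (chMap g n x))
    (hc : ∀ n t, g' (c n t) = c' n (g ∘ t)) (n : ℕ) (x : Ch V n) :
    chMap g' (n + 1) (coneHtpy h c n x) = coneHtpy h' c' n (chMap g n x) := by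
  induction n with
  | zero => simp
  | succ n ih =>
    have : chMap g' (n + 2) ∘ₗ coneHtpy h c (n + 1) =
        (coneHtpy h' c' (n + 1) ∘ₗ chMap g (n + 1) : Ch V (n + 1) →ₗ[ZMod 2] _) := by
      refine lin_ext fun t => ?_
      rw [LinearMap.comp_apply, LinearMap.comp_apply, coneHtpy_single, chMap_single,
        coneHtpy_single, chMap_cone, map_add, hh, ih, hc, ← bd_chMap, chMap_single]
    exact LinearMap.congr_fun this x

/-- Subdivision of tuple chains, with respect to a choice `b` of barycenters. -/
def sd (b : ∀ n, (Fin (n + 1) → V) → V) : ∀ n, Ch V n →ₗ[ZMod 2] Ch V n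
  | 0 => LinearMap.id
  | n + 1 => Finsupp.linearCombination (ZMod 2) fun t =>
      cone (b n t) (sd b n (bd (Finsupp.single t 1)))

@[simp]
lemma sd_zero (b : ∀ n, (Fin (n + 1) → V) → V) : sd b 0 = LinearMap.id := rfl

lemma sd_single (b : ∀ n, (Fin (n + 1) → V) → V) (n : ℕ) (t : Fin (n + 1) → V) :
    sd b (n + 1) (Finsupp.single t 1) = cone (b n t) (sd b n (bd (Finsupp.single t 1))) := by
  simp [sd]

lemma bd_sd (b : ∀ n, (Fin (n + 1) → V) → V) (n : ℕ) (x : Ch V (n + 1)) :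
    bd (sd b (n + 1) x) = sd b n (bd x) := by
  have : bd ∘ₗ sd b (n + 1) = (sd b n ∘ₗ bd : Ch V (n + 1) →ₗ[ZMod 2] _) := by
    clear x
    induction n with
    | zero =>
      refine lin_ext fun t => ?_
      rw [LinearMap.comp_apply, LinearMap.comp_apply, sd_single, bd_cone_zero]
    | succ n ih =>
      refine lin_ext fun t => ?_
      have ih' := LinearMap.congr_fun ih (bd (Finsupp.single t 1))
      simp only [LinearMap.comp_apply] at ih'
      rw [LinearMap.comp_apply, LinearMap.comp_apply, sd_single, bd_cone, ih', bd_bd, map_zero,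
        map_zero, add_zero]
  exact LinearMap.congr_fun this x

lemma sd_natural {b : ∀ n, (Fin (n + 1) → V) → V} {b' : ∀ n, (Fin (n + 1) → W) → W} (g : V → W)
    (hb : ∀ n t, g (b n t) = b' n (g ∘ t)) (n : ℕ) (x : Ch V n) :
    chMap g n (sd b n x) = sd b' n (chMap g n x) := by
  induction n with
  | zero => simp
  | succ n ih =>
    have : chMap g (n + 1) ∘ₗ sd b (n + 1) =
        (sd b' (n + 1) ∘ₗ chMap g (n + 1) : Ch V (n + 1) →ₗ[ZMod 2] _) := by
      refine lin_ext fun t => ?_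
      rw [LinearMap.comp_apply, LinearMap.comp_apply, sd_single, chMap_single, sd_single,
        chMap_cone, ih, hb, ← bd_chMap, chMap_single]
    exact LinearMap.congr_fun this x

/-- The homotopy between subdivision and the identity. -/
def sdHtpy (b : ∀ n, (Fin (n + 1) → V) → V) (n : ℕ) : Ch V n →ₗ[ZMod 2] Ch V (n + 1) :=
  coneHtpy (fun n => LinearMap.id + sd b n) b n

lemma bd_sdHtpy (b : ∀ n, (Fin (n + 1) → V) → V) (n : ℕ) (x : Ch V (n + 1)) :
    bd (sdHtpy b (n + 1) x) + sdHtpy b n (bd x) = x + sd b (n + 1) x :=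
  bd_coneHtpy _ b (LinearMap.ext fun x => by simp [ZModModule.add_self])
    (fun n x => by simp [bd_sd]) n x

lemma sdHtpy_natural {b : ∀ n, (Fin (n + 1) → V) → V} {b' : ∀ n, (Fin (n + 1) → W) → W}
    (g : V → W) (hb : ∀ n t, g (b n t) = b' n (g ∘ t)) (n : ℕ) (x : Ch V n) :
    chMap g (n + 1) (sdHtpy b n x) = sdHtpy b' n (chMap g n x) :=
  coneHtpy_natural g g (fun n x => by simp [sd_natural g hb]) hb n x

end Subdivision

/-! ### Affine simplices -/

section Affine

/-- The standard simplex with `n` vertices, that is, of dimension `n - 1`. -/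
abbrev Simp (n : ℕ) : Set (Fin n → ℝ) := stdSimplex ℝ (Fin n)

variable {E F : Type*} [NormedAddCommGroup E] [NormedSpace ℝ E] [NormedAddCommGroup F]
  [NormedSpace ℝ F]

/-- The affine simplex with given vertices in a convex set. -/
def affIn {s : Set E} (hs : Convex ℝ s) {n : ℕ} (t : Fin n → s) : C(Simp n, s) where
  toFun x := ⟨∑ i, x.1 i • (t i : E), hs.sum_mem (fun i _ => x.2.1 i) x.2.2 fun i _ => (t i).2⟩
  continuous_toFun := by
    refine Continuous.subtype_mk (continuous_finsetSum _ fun i _ => ?_) _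
    exact ((continuous_apply i).comp continuous_subtype_val).smul continuous_const

lemma affIn_coe {s : Set E} (hs : Convex ℝ s) {n : ℕ} (t : Fin n → s) (x : Simp n) :
    (affIn hs t x : E) = ∑ i, x.1 i • (t i : E) := rfl

/-- A map of convex sets that preserves affine simplices. -/
def IsAff {s : Set E} (hs : Convex ℝ s) {s' : Set F} (hs' : Convex ℝ s') (g : s → s') : Prop :=
  ∀ (n : ℕ) (t : Fin n → s) (x : Simp n), g (affIn hs t x) = affIn hs' (g ∘ t) x

lemma isAff_of_linear {s : Set E} (hs : Convex ℝ s) {s' : Set F} (hs' : Convex ℝ s') (g : s → s')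
    (L : E →ₗ[ℝ] F) (h : ∀ x, (g x : F) = L x) : IsAff hs hs' g := by
  intro n t x
  ext1
  simp [h, affIn_coe]

lemma isAff_affIn {s : Set E} (hs : Convex ℝ s) {n : ℕ} (t : Fin n → s) :
    IsAff (convex_stdSimplex ℝ (Fin n)) hs (affIn hs t) :=
  isAff_of_linear _ _ _ (∑ i, (LinearMap.proj (R := ℝ) (φ := fun _ : Fin n => ℝ) i).smulRight
    (t i : E)) fun x => by simp [affIn_coe]

/-- The tuple of vertices of the standard simplex. -/
def verts (n : ℕ) (i : Fin n) : Simp n := stdSimplex.vertex i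

lemma affIn_verts {s : Set E} (hs : Convex ℝ s) {n : ℕ} (t : Fin n → s) (i : Fin n) :
    affIn hs t (verts n i) = t i := by
  ext1
  rw [affIn_coe, Finset.sum_eq_single_of_mem i (Finset.mem_univ i)]
  · simp [verts]
  · intro j _ hj
    simp [verts, Pi.single_eq_of_ne hj]

lemma affIn_comp_verts {s : Set E} (hs : Convex ℝ s) {n : ℕ} (t : Fin n → s) :
    affIn hs t ∘ verts n = t := funext (affIn_verts hs t)

lemma affIn_self (n : ℕ) : affIn (convex_stdSimplex ℝ (Fin n)) (verts n) = ContinuousMap.id _ := by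
  refine ContinuousMap.ext fun x => Subtype.ext (funext fun j => ?_)
  rw [affIn_coe, Finset.sum_apply]
  simp [verts, Pi.single_apply]

/-- The barycenter of a tuple in a convex set. -/
def bary {s : Set E} (hs : Convex ℝ s) (n : ℕ) (t : Fin (n + 1) → s) : s :=
  affIn hs t stdSimplex.barycenter

lemma IsAff.bary {s : Set E} {hs : Convex ℝ s} {s' : Set F} {hs' : Convex ℝ s'} {g : s → s'}
    (hg : IsAff hs hs' g) (n : ℕ) (t : Fin (n + 1) → s) :
    g (bary hs n t) = bary hs' n (g ∘ t) := hg _ _ _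

lemma affIn_mem_convexHull {s : Set E} (hs : Convex ℝ s) {n : ℕ} (t : Fin n → s) (x : Simp n) :
    (affIn hs t x : E) ∈ convexHull ℝ (Set.range fun i => (t i : E)) :=
  (convex_convexHull ℝ _).sum_mem (fun i _ => x.2.1 i) x.2.2
    fun i _ => subset_convexHull ℝ _ ⟨i, rfl⟩

lemma sd_mem_convexHull {s : Set E} (hs : Convex ℝ s) {n : ℕ} (t : Fin n → s) {C : Set E}
    (hC : Convex ℝ C) (ht : ∀ i, (t i : E) ∈ C) :
    sd (bary hs) n (Finsupp.single t 1) ∈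
      Finsupp.supported (ZMod 2) (ZMod 2) {u | ∀ i, (u i : E) ∈ C} := by
  induction n with
  | zero => exact Finsupp.single_mem_supported _ _ ht
  | succ n ih =>
    rw [sd_single, bd_single, map_sum]
    refine cone_mem (Submodule.sum_mem _ fun i _ => ih _ fun j => ht _) fun u hu => ?_
    refine Fin.cases ?_ fun i => by simpa using hu i
    rw [Fin.cons_zero]
    exact convexHull_min (Set.range_subset_iff.2 ht) hC (affIn_mem_convexHull hs t _)

/-- The difference of the barycenter and `t k` is the average of `n + 1` vectors `t i - t k`, one of
which vanishes, so its norm is at most `n / (n + 1) * D`. The ratio is weakened to one depending on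
`N` only, so that it serves all faces of a simplex. -/
lemma dist_bary_le {s : Set E} (hs : Convex ℝ s) {n N : ℕ} (hn : n ≤ N) (t : Fin (n + 1) → s)
    {D : ℝ} (hD : ∀ i j, dist (t i : E) (t j) ≤ D) (k : Fin (n + 1)) :
    dist (bary hs n t : E) (t k) ≤ N / (N + 1) * D := by
  have hD0 : 0 ≤ D := dist_nonneg.trans (hD k k)
  have hpos : (0 : ℝ) < n + 1 := by positivity
  have h1 : (bary hs n t : E) - t k = ((n : ℝ) + 1)⁻¹ • ∑ i, ((t i : E) - t k) := by
    rw [Finset.sum_sub_distrib, smul_sub, bary, affIn_coe, Finset.smul_sum]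
    congr 1
    · refine Finset.sum_congr rfl fun i _ => ?_
      rw [stdSimplex.barycenter_apply]; simp
    · rw [Finset.sum_const, Finset.card_univ, Fintype.card_fin, ← Nat.cast_smul_eq_nsmul ℝ,
        smul_smul]
      push_cast
      rw [inv_mul_cancel₀ hpos.ne', one_smul]
  have h2 : ‖∑ i, ((t i : E) - t k)‖ ≤ n * D := by
    rw [← Finset.sum_erase_add _ _ (Finset.mem_univ k), sub_self, add_zero]
    refine (norm_sum_le_of_le (f := fun i => (t i : E) - t k) (n := fun _ => D) _
      fun i _ => by rw [← dist_eq_norm]; exact hD i k).trans ?_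
    rw [Finset.sum_const, Finset.card_erase_of_mem (Finset.mem_univ k)]
    simp
  rw [dist_eq_norm, h1, norm_smul, norm_inv, Real.norm_of_nonneg hpos.le]
  have h3 : ((n : ℝ) + 1)⁻¹ * n ≤ N / (N + 1) := by
    have : (n : ℝ) ≤ N := by exact_mod_cast hn
    rw [inv_mul_eq_div, div_le_div_iff₀ hpos (by positivity)]
    nlinarith
  calc ((n : ℝ) + 1)⁻¹ * ‖∑ i, ((t i : E) - t k)‖ ≤ ((n : ℝ) + 1)⁻¹ * (n * D) := by gcongr
    _ = ((n : ℝ) + 1)⁻¹ * n * D := by ring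
    _ ≤ _ := by gcongr

/-- A simplex of the subdivision is the barycenter followed by a simplex subdividing a facet. Edges
of the latter are handled by induction. An edge at the barycenter is at most as long as the distance
from the barycenter to some vertex of `t`, because distance is maximized over a convex hull at a
vertex. -/
lemma sd_mesh {s : Set E} (hs : Convex ℝ s) {n N : ℕ} (hn : n ≤ N + 1) (t : Fin n → s)
    {D : ℝ} (hD : ∀ i j, dist (t i : E) (t j) ≤ D) :
    sd (bary hs) n (Finsupp.single t 1) ∈ Finsupp.supported (ZMod 2) (ZMod 2)
      {u | ∀ i j, dist (u i : E) (u j) ≤ N / (N + 1) * D} := by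
  induction n with
  | zero => exact Finsupp.single_mem_supported _ _ fun i => i.elim0
  | succ n ih =>
    rw [sd_single, bd_single, map_sum]
    have h1 : ∑ i : Fin (n + 1), sd (bary hs) n (Finsupp.single (t ∘ i.succAbove) 1) ∈
        Finsupp.supported (ZMod 2) (ZMod 2)
          ({u | ∀ i j, dist (u i : E) (u j) ≤ N / (N + 1) * D} ∩
            {u | ∀ i, (u i : E) ∈ convexHull ℝ (Set.range fun i => (t i : E))}) := by
      rw [Finsupp.supported_inter]
      refine Submodule.sum_mem _ fun i _ => ⟨ih (by omega) _ fun j k => hD _ _, ?_⟩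
      exact sd_mem_convexHull hs _ (convex_convexHull ℝ _) fun j =>
        subset_convexHull ℝ _ ⟨i.succAbove j, rfl⟩
    refine cone_mem h1 fun u hu => ?_
    have h2 : ∀ i, dist (bary hs n t : E) (u i) ≤ N / (N + 1) * D := by
      intro i
      obtain ⟨_, ⟨k, rfl⟩, hk⟩ := convexHull_exists_dist_ge (hu.2 i) (bary hs n t : E)
      rw [dist_comm]
      refine hk.trans ?_
      rw [dist_comm]
      exact dist_bary_le hs (by omega) t hD k
    have hpos : 0 ≤ N / (N + 1) * D := by
      have := dist_nonneg.trans (hD 0 0)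
      positivity
    intro i j
    refine Fin.cases ?_ (fun i => ?_) i <;> refine Fin.cases ?_ (fun j => ?_) j
    · simpa using hpos
    · simpa using h2 j
    · simpa [dist_comm] using h2 i
    · simpa using hu.1 i j

lemma sd_iterate_mesh {s : Set E} (hs : Convex ℝ s) {n : ℕ} (t : Fin n → s)
    {D : ℝ} (hD : ∀ i j, dist (t i : E) (t j) ≤ D) (m : ℕ) :
    (sd (bary hs) n)^[m] (Finsupp.single t 1) ∈ Finsupp.supported (ZMod 2) (ZMod 2)
      {u | ∀ i j, dist (u i : E) (u j) ≤ (n / (n + 1) : ℝ) ^ m * D} := by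
  induction m with
  | zero => exact Finsupp.single_mem_supported _ _ (by simpa using hD)
  | succ m ih =>
    rw [Function.iterate_succ_apply']
    refine map_mem_supported _ (fun u hu => ?_) ih
    have := sd_mesh hs (N := n) (by omega) u hu
    rwa [← mul_assoc, ← pow_succ'] at this

lemma sd_iterate_mem_convexHull {s : Set E} (hs : Convex ℝ s) {n : ℕ} (t : Fin n → s) {C : Set E}
    (hC : Convex ℝ C) (ht : ∀ i, (t i : E) ∈ C) (m : ℕ) :
    (sd (bary hs) n)^[m] (Finsupp.single t 1) ∈
      Finsupp.supported (ZMod 2) (ZMod 2) {u | ∀ i, (u i : E) ∈ C} := by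
  induction m with
  | zero => exact Finsupp.single_mem_supported _ _ ht
  | succ m ih =>
    rw [Function.iterate_succ_apply']
    exact map_mem_supported _ (fun u hu => sd_mem_convexHull hs u hC hu) ih

lemma exists_pow_mul_lt (n : ℕ) (D : ℝ) {δ : ℝ} (hδ : 0 < δ) :
    ∃ M : ℕ, ∀ m ≥ M, (n / (n + 1) : ℝ) ^ m * D < δ := by
  have h1 : Filter.Tendsto (fun m : ℕ => (n / (n + 1) : ℝ) ^ m * D) Filter.atTop (nhds 0) := by
    rw [← zero_mul D]
    refine (tendsto_pow_atTop_nhds_zero_of_lt_one (by positivity) ?_).mul_const D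
    rw [div_lt_one (by positivity)]
    linarith
  exact Filter.eventually_atTop.1 (h1.eventually_lt_const hδ)

end Affine

/-! ### Singular chains -/

section Singular

/-- Singular chains with coefficients in `ℤ/2`, graded by the number of vertices. -/
abbrev SC (X : Type*) [TopologicalSpace X] (n : ℕ) := C(Simp n, X) →₀ ZMod 2

variable {X : Type*} [TopologicalSpace X]

/-- The inclusion of a facet of the standard simplex. -/
def coface {n : ℕ} (i : Fin (n + 1)) : C(Simp n, Simp (n + 1)) :=
  affIn (convex_stdSimplex ℝ (Fin (n + 1))) (verts (n + 1) ∘ i.succAbove)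

lemma coface_comp_verts {n : ℕ} (i : Fin (n + 1)) :
    coface i ∘ verts n = verts (n + 1) ∘ i.succAbove := affIn_comp_verts _ _

lemma isAff_coface {n : ℕ} (i : Fin (n + 1)) :
    IsAff (convex_stdSimplex ℝ (Fin n)) (convex_stdSimplex ℝ (Fin (n + 1))) (coface i) :=
  isAff_affIn _ _

/-- The singular boundary. -/
def sbd {n : ℕ} : SC X (n + 1) →ₗ[ZMod 2] SC X n :=
  sumFaces fun i σ => σ.comp (coface i)

lemma sbd_single {n : ℕ} (σ : C(Simp (n + 1), X)) :
    sbd (Finsupp.single σ 1) = ∑ i : Fin (n + 1), Finsupp.single (σ.comp (coface i)) 1 := by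
  simp [sbd]

variable {E F : Type*} [NormedAddCommGroup E] [NormedSpace ℝ E] [NormedAddCommGroup F]
  [NormedSpace ℝ F]

/-- The image under `σ` of chains of affine simplices in a convex set. -/
def push {s : Set E} (hs : Convex ℝ s) (σ : C(s, X)) (n : ℕ) : Ch s n →ₗ[ZMod 2] SC X n :=
  Finsupp.lmapDomain _ _ fun t => σ.comp (affIn hs t)

@[simp]
lemma push_single {s : Set E} (hs : Convex ℝ s) (σ : C(s, X)) {n : ℕ} (t : Fin n → s) :
    push hs σ n (Finsupp.single t 1) = Finsupp.single (σ.comp (affIn hs t)) 1 := by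
  simp [push]

lemma IsAff.comp_affIn {s : Set E} {hs : Convex ℝ s} {s' : Set F} {hs' : Convex ℝ s'}
    {g : C(s, s')} (hg : IsAff hs hs' g) {n : ℕ} (t : Fin n → s) :
    g.comp (affIn hs t) = affIn hs' (g ∘ t) :=
  ContinuousMap.ext fun x => hg n t x

lemma sbd_push {s : Set E} (hs : Convex ℝ s) (σ : C(s, X)) {n : ℕ} (c : Ch s (n + 1)) :
    sbd (push hs σ (n + 1) c) = push hs σ n (bd c) :=
  sumFaces_mapDomain (fun (i : Fin (n + 1)) t => t ∘ i.succAbove)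
    (fun i (σ : C(Simp (n + 1), X)) => σ.comp (coface i))
    (fun t => σ.comp (affIn hs t)) (fun t => σ.comp (affIn hs t)) (fun i t => by
      rw [ContinuousMap.comp_assoc, coface, (isAff_affIn hs t).comp_affIn, ← Function.comp_assoc,
        affIn_comp_verts]) c

lemma push_chMap {s : Set E} (hs : Convex ℝ s) {s' : Set F} (hs' : Convex ℝ s') (σ : C(s', X))
    {g : C(s, s')} (hg : IsAff hs hs' g) {n : ℕ} (c : Ch s n) :
    push hs' σ n (chMap g n c) = push hs (σ.comp g) n c := by
  have : push hs' σ n ∘ₗ chMap g n = push hs (σ.comp g) n := by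
    refine lin_ext fun t => ?_
    rw [LinearMap.comp_apply, chMap_single, push_single, push_single, ContinuousMap.comp_assoc,
      hg.comp_affIn]
  exact LinearMap.congr_fun this c

lemma single_verts_succ_bd (n : ℕ) : bd (Finsupp.single (verts (n + 1)) 1) =
    ∑ i : Fin (n + 1), chMap (coface i) n (Finsupp.single (verts n) 1) := by
  rw [bd_single]
  exact Finset.sum_congr rfl fun i _ => by rw [chMap_single, coface_comp_verts]

/-- Barycentric subdivision of singular chains. -/
def subdiv (n : ℕ) : SC X n →ₗ[ZMod 2] SC X n :=
  Finsupp.linearCombination (ZMod 2) fun σ => push (convex_stdSimplex ℝ (Fin n)) σ n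
    (sd (bary (convex_stdSimplex ℝ (Fin n))) n (Finsupp.single (verts n) 1))

lemma subdiv_single {n : ℕ} (σ : C(Simp n, X)) : subdiv n (Finsupp.single σ 1) =
    push (convex_stdSimplex ℝ (Fin n)) σ n
      (sd (bary (convex_stdSimplex ℝ (Fin n))) n (Finsupp.single (verts n) 1)) := by
  simp [subdiv]

/-- Everything reduces to the identity of the standard simplex. The facet inclusions are affine and
so commute with barycenters, and `sd_natural` moves the subdivision of the boundary into the facets.
-/
lemma sbd_subdiv (n : ℕ) (c : SC X (n + 1)) : sbd (subdiv (n + 1) c) = subdiv n (sbd c) := by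
  have : sbd ∘ₗ subdiv (n + 1) = (subdiv n ∘ₗ sbd : SC X (n + 1) →ₗ[ZMod 2] _) := by
    refine lin_ext fun σ => ?_
    rw [LinearMap.comp_apply, LinearMap.comp_apply, subdiv_single, sbd_push, bd_sd,
      single_verts_succ_bd, map_sum, map_sum, sbd_single, map_sum]
    refine Finset.sum_congr rfl fun i _ => ?_
    rw [← sd_natural _ (isAff_coface i).bary, push_chMap _ _ _ (isAff_coface i), subdiv_single]
  exact LinearMap.congr_fun this c

/-- The homotopy between subdivision and the identity, on singular chains. -/
def subdivHtpy (n : ℕ) : SC X n →ₗ[ZMod 2] SC X (n + 1) :=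
  Finsupp.linearCombination (ZMod 2) fun σ => push (convex_stdSimplex ℝ (Fin n)) σ (n + 1)
    (sdHtpy (bary (convex_stdSimplex ℝ (Fin n))) n (Finsupp.single (verts n) 1))

lemma subdivHtpy_single {n : ℕ} (σ : C(Simp n, X)) : subdivHtpy n (Finsupp.single σ 1) =
    push (convex_stdSimplex ℝ (Fin n)) σ (n + 1)
      (sdHtpy (bary (convex_stdSimplex ℝ (Fin n))) n (Finsupp.single (verts n) 1)) := by
  simp [subdivHtpy]

lemma subdivHtpy_zero (c : SC X 0) : subdivHtpy 0 c = 0 := by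
  have : (subdivHtpy 0 : SC X 0 →ₗ[ZMod 2] _) = 0 :=
    lin_ext fun σ => by rw [subdivHtpy_single]; simp [sdHtpy]
  rw [this]; rfl

lemma sbd_subdivHtpy (n : ℕ) (c : SC X (n + 1)) :
    sbd (subdivHtpy (n + 1) c) + subdivHtpy n (sbd c) = c + subdiv (n + 1) c := by
  have : sbd ∘ₗ subdivHtpy (n + 1) + subdivHtpy n ∘ₗ sbd =
      (LinearMap.id + subdiv (n + 1) : SC X (n + 1) →ₗ[ZMod 2] _) := by
    refine lin_ext fun σ => ?_
    have h := bd_sdHtpy (bary (convex_stdSimplex ℝ (Fin (n + 1)))) n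
      (Finsupp.single (verts (n + 1)) 1)
    have h1 : subdivHtpy n (sbd (Finsupp.single σ 1)) =
        push (convex_stdSimplex ℝ (Fin (n + 1))) σ (n + 1)
          (sdHtpy (bary (convex_stdSimplex ℝ (Fin (n + 1)))) n
            (bd (Finsupp.single (verts (n + 1)) 1))) := by
      rw [single_verts_succ_bd, map_sum, map_sum, sbd_single, map_sum]
      refine Finset.sum_congr rfl fun i _ => ?_
      rw [← sdHtpy_natural _ (isAff_coface i).bary, push_chMap _ _ _ (isAff_coface i),
        subdivHtpy_single]
    rw [LinearMap.add_apply, LinearMap.comp_apply, LinearMap.comp_apply, h1, subdivHtpy_single,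
      sbd_push, ← map_add, h, map_add, push_single, affIn_self, LinearMap.add_apply,
      subdiv_single]
    rfl
  exact LinearMap.congr_fun this c

lemma subdiv_push {s : Set E} (hs : Convex ℝ s) (σ : C(s, X)) {n : ℕ} (c : Ch s n) :
    subdiv n (push hs σ n c) = push hs σ n (sd (bary hs) n c) := by
  have : subdiv n ∘ₗ push hs σ n = push hs σ n ∘ₗ sd (bary hs) n := by
    refine lin_ext fun t => ?_
    rw [LinearMap.comp_apply, LinearMap.comp_apply, push_single, subdiv_single,
      ← push_chMap _ _ _ (isAff_affIn hs t), sd_natural _ (isAff_affIn hs t).bary, chMap_single,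
      affIn_comp_verts]
  exact LinearMap.congr_fun this c

lemma subdiv_iterate_single {n : ℕ} (σ : C(Simp n, X)) (m : ℕ) :
    (subdiv n)^[m] (Finsupp.single σ 1) = push (convex_stdSimplex ℝ (Fin n)) σ n
      ((sd (bary (convex_stdSimplex ℝ (Fin n))) n)^[m] (Finsupp.single (verts n) 1)) := by
  induction m with
  | zero => simp [affIn_self]
  | succ m ih => rw [Function.iterate_succ_apply', ih, subdiv_push, Function.iterate_succ_apply']

/-- Singular chains in a subset of `X`. -/
abbrev chainsIn (A : Set X) (n : ℕ) : Submodule (ZMod 2) (SC X n) :=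
  Finsupp.supported (ZMod 2) (ZMod 2) {σ | ∀ x, σ x ∈ A}

lemma push_mem {s : Set E} (hs : Convex ℝ s) (σ : C(s, X)) {n : ℕ} (c : Ch s n) {A : Set X}
    (hσ : ∀ x, σ x ∈ A) : push hs σ n c ∈ chainsIn A n := by
  refine map_mem_supported (P := Set.univ) _ (fun t _ => ?_) (by simp)
  rw [push_single]
  exact Finsupp.single_mem_supported _ _ fun x => hσ _

lemma subdiv_mem {A : Set X} {n : ℕ} {c : SC X n} (hc : c ∈ chainsIn A n) :
    subdiv n c ∈ chainsIn A n := by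
  refine map_mem_supported _ (fun σ hσ => ?_) hc
  rw [subdiv_single]
  exact push_mem _ _ _ hσ

lemma subdiv_iterate_mem {A : Set X} {n : ℕ} {c : SC X n} (hc : c ∈ chainsIn A n) (m : ℕ) :
    (subdiv n)^[m] c ∈ chainsIn A n := by
  induction m with
  | zero => exact hc
  | succ m ih => rw [Function.iterate_succ_apply']; exact subdiv_mem ih

lemma subdivHtpy_mem {A : Set X} {n : ℕ} {c : SC X n} (hc : c ∈ chainsIn A n) :
    subdivHtpy n c ∈ chainsIn A (n + 1) := by
  refine map_mem_supported _ (fun σ hσ => ?_) hc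
  rw [subdivHtpy_single]
  exact push_mem _ _ _ hσ

/-- The iterate of a linear endomorphism, as a linear map. -/
lemma iterate_eq_pow {M : Type*} [AddCommGroup M] [Module (ZMod 2) M] (f : M →ₗ[ZMod 2] M)
    (m : ℕ) (x : M) : f^[m] x = (f ^ m) x := (Module.End.pow_apply f m x).symm

lemma sbd_subdiv_iterate (n m : ℕ) (c : SC X (n + 1)) :
    sbd ((subdiv (n + 1))^[m] c) = (subdiv n)^[m] (sbd c) := by
  induction m with
  | zero => rfl
  | succ m ih =>
    rw [Function.iterate_succ_apply', sbd_subdiv, ih, Function.iterate_succ_apply']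

/-- Singular simplices all of whose points are within distance `ε`. -/
lemma exists_subdiv_small {Y : Type*} [PseudoMetricSpace Y] {n : ℕ} (σ : C(Simp n, Y)) {ε : ℝ}
    (hε : 0 < ε) : ∃ M : ℕ, ∀ m ≥ M, (subdiv n)^[m] (Finsupp.single σ 1) ∈
      Finsupp.supported (ZMod 2) (ZMod 2) {τ | ∀ x y, dist (τ x) (τ y) < ε} := by
  obtain ⟨δ, hδ, hσ⟩ := Metric.uniformContinuous_iff.1
    (CompactSpace.uniformContinuous_of_continuous σ.continuous) ε hε
  -- The vertices lie in the unit ball about the origin.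
  have hD : ∀ i j, dist (verts n i).1 (verts n j).1 ≤ 2 := by
    intro i j
    have h1 := stdSimplex_subset_closedBall (verts n i).2
    have h2 := stdSimplex_subset_closedBall (verts n j).2
    rw [Metric.mem_closedBall] at h1 h2
    linarith [dist_triangle_right (verts n i).1 (verts n j).1 0]
  obtain ⟨M, hM⟩ := exists_pow_mul_lt n 2 hδ
  refine ⟨M, fun m hm => ?_⟩
  rw [subdiv_iterate_single]
  refine map_mem_supported _ (fun u hu => ?_)
    (sd_iterate_mesh (convex_stdSimplex ℝ (Fin n)) (verts n) hD m)
  rw [push_single]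
  refine Finsupp.single_mem_supported _ _ fun x y => hσ ?_
  obtain ⟨_, ⟨i, rfl⟩, _, ⟨j, rfl⟩, hij⟩ := convexHull_exists_dist_ge2
    (affIn_mem_convexHull (convex_stdSimplex ℝ (Fin n)) u x)
    (affIn_mem_convexHull (convex_stdSimplex ℝ (Fin n)) u y)
  exact (hij.trans (hu i j)).trans_lt (hM m hm)

/-- Smallness for all exponents beyond a threshold, rather than for one exponent, is what allows
finitely many simplices to share an exponent. -/
lemma exists_subdiv_small_chain {Y : Type*} [PseudoMetricSpace Y] {n : ℕ} (c : SC Y n) {ε : ℝ}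
    (hε : 0 < ε) : ∃ M : ℕ, ∀ m ≥ M, (subdiv n)^[m] c ∈
      Finsupp.supported (ZMod 2) (ZMod 2) {τ | ∀ x y, dist (τ x) (τ y) < ε} := by
  induction c using Finsupp.induction_linear with
  | zero => exact ⟨0, fun m _ => by rw [iterate_eq_pow, map_zero]; exact Submodule.zero_mem _⟩
  | add f g hf hg =>
    obtain ⟨M, hM⟩ := hf
    obtain ⟨M', hM'⟩ := hg
    refine ⟨max M M', fun m hm => ?_⟩
    have h1 := hM m (le_of_max_le_left hm)
    have h2 := hM' m (le_of_max_le_right hm)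
    rw [iterate_eq_pow] at h1 h2 ⊢
    rw [map_add]
    exact Submodule.add_mem _ h1 h2
  | single σ a =>
    obtain ⟨M, hM⟩ := exists_subdiv_small σ hε
    refine ⟨M, fun m hm => ?_⟩
    have h1 := hM m hm
    rw [← mul_one a, ← smul_eq_mul, ← Finsupp.smul_single]
    rw [iterate_eq_pow] at h1 ⊢
    rw [map_smul]
    exact Submodule.smul_mem _ _ h1

end Singular

/-! ### Prisms and affine realization -/

section Label

variable {E : Type*} [TopologicalSpace E]

/-- The chain map from singular to tuple chains defined by a labelling of points. -/
def label (l : E → E) (n : ℕ) : SC E n →ₗ[ZMod 2] Ch E n :=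
  Finsupp.lmapDomain _ _ fun σ i => l (σ (verts n i))

@[simp]
lemma label_single (l : E → E) {n : ℕ} (σ : C(Simp n, E)) :
    label l n (Finsupp.single σ 1) = Finsupp.single (fun i => l (σ (verts n i))) 1 := by
  simp [label]

lemma bd_label (l : E → E) (n : ℕ) (c : SC E (n + 1)) :
    bd (label l (n + 1) c) = label l n (sbd c) :=
  sumFaces_mapDomain (fun i (σ : C(Simp (n + 1), E)) => σ.comp (coface i))
    (fun (i : Fin (n + 1)) t => t ∘ i.succAbove) _ _
    (fun i σ => funext fun j => by
      rw [ContinuousMap.comp_apply, ← Function.comp_apply (f := coface i), coface_comp_verts]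
      rfl) c

end Label


/-! ### The straight-line homotopy to affine chains. -/

section Prism

variable {E : Type*} [NormedAddCommGroup E] [NormedSpace ℝ E]

/-- The prism over the standard simplex. -/
abbrev Prism (n : ℕ) : Set ((Fin n → ℝ) × ℝ) := Simp n ×ˢ Set.Icc (0 : ℝ) 1

lemma convex_prism (n : ℕ) : Convex ℝ (Prism n) :=
  (convex_stdSimplex ℝ (Fin n)).prod (convex_Icc 0 1)

/-- The bottom of the prism. -/
def prismBot {n : ℕ} (x : Simp n) : Prism n := ⟨(x, 0), x.2, by simp⟩

/-- The top of the prism. -/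
def prismTop {n : ℕ} (x : Simp n) : Prism n := ⟨(x, 1), x.2, by simp⟩

/-- The chain triangulating the prism over a simplex. -/
def prismOp (n k : ℕ) : Ch (Simp n) k →ₗ[ZMod 2] Ch (Prism n) (k + 1) :=
  coneHtpy (fun k => chMap prismBot k + chMap prismTop k) (fun _ t => prismBot (t 0)) k

lemma bd_prismOp (n k : ℕ) (c : Ch (Simp n) (k + 1)) :
    bd (prismOp n (k + 1) c) + prismOp n k (bd c) =
      chMap prismBot (k + 1) c + chMap prismTop (k + 1) c := by
  refine bd_coneHtpy _ _ ?_ (fun n x => by simp [bd_chMap]) k c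
  refine lin_ext fun t => ?_
  rw [LinearMap.add_apply, chMap_single, chMap_single,
    Subsingleton.elim (prismBot ∘ t) (prismTop ∘ t), ZModModule.add_self, LinearMap.zero_apply]

/-- The inclusion of the prism over a facet. -/
def prismCoface {n : ℕ} (i : Fin (n + 1)) : C(Prism n, Prism (n + 1)) where
  toFun p := ⟨(coface i ⟨p.1.1, p.2.1⟩, p.1.2), (coface i ⟨p.1.1, p.2.1⟩).2, p.2.2⟩
  continuous_toFun := by
    refine Continuous.subtype_mk (Continuous.prodMk ?_ (continuous_snd.comp continuous_subtype_val)) _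
    refine continuous_subtype_val.comp ((coface i).continuous.comp ?_)
    exact Continuous.subtype_mk (continuous_fst.comp continuous_subtype_val) _

lemma isAff_prismCoface {n : ℕ} (i : Fin (n + 1)) :
    IsAff (convex_prism n) (convex_prism (n + 1)) (prismCoface i) :=
  isAff_of_linear _ _ _ (LinearMap.prodMap (∑ j,
    (LinearMap.proj (R := ℝ) (φ := fun _ : Fin n => ℝ) j).smulRight
      (verts (n + 1) (i.succAbove j)).1) LinearMap.id) fun x => by
        refine Prod.ext ?_ rfl
        change (affIn (convex_stdSimplex ℝ (Fin (n + 1))) (verts (n + 1) ∘ i.succAbove)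
          ⟨x.1.1, x.2.1⟩).1 = _
        rw [affIn_coe, LinearMap.prodMap_apply]
        simp only [LinearMap.sum_apply, LinearMap.smulRight_apply, LinearMap.proj_apply]
        rfl

lemma prismOp_coface {n k : ℕ} (i : Fin (n + 1)) (c : Ch (Simp n) k) :
    chMap (prismCoface i) (k + 1) (prismOp n k c) =
      prismOp (n + 1) k (chMap (coface i) k c) := by
  refine coneHtpy_natural _ _ (fun k x => ?_) (fun k t => rfl) k c
  have : chMap (prismCoface i) k ∘ₗ (chMap prismBot k + chMap prismTop k) =
      (chMap prismBot k + chMap prismTop k) ∘ₗ chMap (coface i) k := by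
    refine lin_ext fun t => ?_
    simp only [LinearMap.comp_apply, LinearMap.add_apply, chMap_single, map_add]
    rfl
  exact LinearMap.congr_fun this x

/-- The affine singular simplex with given vertices. -/
def affE {n : ℕ} (t : Fin n → E) : C(Simp n, E) where
  toFun x := ∑ i, x.1 i • t i
  continuous_toFun := continuous_finsetSum _ fun i _ =>
    ((continuous_apply i).comp continuous_subtype_val).smul continuous_const

lemma affE_apply {n : ℕ} (t : Fin n → E) (x : Simp n) : affE t x = ∑ i, x.1 i • t i := rfl

lemma affE_comp_affIn {m n : ℕ} (t : Fin n → E)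
    (u : Fin m → Simp n) :
    (affE t).comp (affIn (convex_stdSimplex ℝ (Fin n)) u) = affE (affE t ∘ u) := by
  ext x
  simp only [ContinuousMap.comp_apply, affE_apply, affIn_coe, Function.comp_apply,
    Finset.sum_apply, Finset.smul_sum, Finset.sum_smul, Pi.smul_apply, smul_smul, smul_eq_mul]
  rw [Finset.sum_comm]

lemma affE_verts {n : ℕ} (t : Fin n → E) (i : Fin n) : affE t (verts n i) = t i := by
  rw [affE_apply, Finset.sum_eq_single_of_mem i (Finset.mem_univ i)]
  · simp [verts]
  · intro j _ hj
    simp [verts, Pi.single_eq_of_ne hj]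

lemma affE_comp_coface {n : ℕ} (t : Fin (n + 1) → E) (i : Fin (n + 1)) :
    (affE t).comp (coface i) = affE (t ∘ i.succAbove) := by
  rw [coface, affE_comp_affIn]
  congr 1
  funext j
  exact affE_verts t _

lemma affE_mem_convexHull {n : ℕ} (t : Fin n → E) (x : Simp n) :
    affE t x ∈ convexHull ℝ (Set.range t) :=
  (convex_convexHull ℝ _).sum_mem (fun i _ => x.2.1 i) x.2.2
    fun i _ => subset_convexHull ℝ _ ⟨i, rfl⟩

/-- The realization of tuple chains as chains of affine singular simplices. -/
def realize (n : ℕ) : Ch E n →ₗ[ZMod 2] SC E n := Finsupp.lmapDomain _ _ affE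

@[simp]
lemma realize_single {n : ℕ} (t : Fin n → E) :
    realize n (Finsupp.single t 1) = Finsupp.single (affE t) 1 := by simp [realize]

lemma sbd_realize (n : ℕ) (c : Ch E (n + 1)) : sbd (realize (n + 1) c) = realize n (bd c) :=
  sumFaces_mapDomain (fun (i : Fin (n + 1)) t => t ∘ i.succAbove)
    (fun i (σ : C(Simp (n + 1), E)) => σ.comp (coface i)) affE affE
    (fun i t => affE_comp_coface t i) c

lemma realize_mem {n : ℕ} {P : Set (Fin n → E)} {A : Set E} {c : Ch E n}
    (hc : c ∈ Finsupp.supported (ZMod 2) (ZMod 2) P)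
    (hP : ∀ t ∈ P, convexHull ℝ (Set.range t) ⊆ A) : realize n c ∈ chainsIn A n := by
  refine map_mem_supported _ (fun t ht => ?_) hc
  rw [realize_single]
  exact Finsupp.single_mem_supported _ _ fun x => hP t ht (affE_mem_convexHull t x)

/-- The straight-line homotopy from a singular simplex to the affine simplex on the labels of its
vertices. -/
def labelHtpy (l : E → E) {n : ℕ} (σ : C(Simp n, E)) : C(Prism n, E) where
  toFun p := (1 - p.1.2) • σ ⟨p.1.1, p.2.1⟩ +
    p.1.2 • affE (fun i => l (σ (verts n i))) ⟨p.1.1, p.2.1⟩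
  continuous_toFun := by
    have h : Continuous fun p : Prism n => (⟨p.1.1, p.2.1⟩ : Simp n) :=
      Continuous.subtype_mk (continuous_fst.comp continuous_subtype_val) _
    have h2 : Continuous fun p : Prism n => p.1.2 := continuous_snd.comp continuous_subtype_val
    exact ((continuous_const.sub h2).smul (σ.continuous.comp h)).add
      (h2.smul ((affE _).continuous.comp h))

lemma labelHtpy_coface (l : E → E) {n : ℕ} (σ : C(Simp (n + 1), E)) (i : Fin (n + 1)) :
    (labelHtpy l σ).comp (prismCoface i) = labelHtpy l (σ.comp (coface i)) := by
  ext p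
  have h : (affE fun j => l (σ (verts (n + 1) j))).comp (coface i) =
      affE fun j => l ((σ.comp (coface i)) (verts n j)) := by
    rw [affE_comp_coface]
    congr 1
    funext j
    rw [ContinuousMap.comp_apply, ← Function.comp_apply (f := coface i), coface_comp_verts]
    rfl
  exact congrArg (fun y => (1 - p.1.2) • σ (coface i ⟨p.1.1, p.2.1⟩) + p.1.2 • y)
    (DFunLike.congr_fun h ⟨p.1.1, p.2.1⟩)

/-- The chain homotopy between the identity and the realization of the labelling. -/
def prismHtpy (l : E → E) (n : ℕ) : SC E n →ₗ[ZMod 2] SC E (n + 1) :=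
  Finsupp.linearCombination (ZMod 2) fun σ => push (convex_prism n) (labelHtpy l σ) (n + 1)
    (prismOp n n (Finsupp.single (verts n) 1))

lemma prismHtpy_single (l : E → E) {n : ℕ} (σ : C(Simp n, E)) :
    prismHtpy l n (Finsupp.single σ 1) = push (convex_prism n) (labelHtpy l σ) (n + 1)
      (prismOp n n (Finsupp.single (verts n) 1)) := by
  simp [prismHtpy]

lemma prismHtpy_zero (l : E → E) (c : SC E 0) : prismHtpy l 0 c = 0 := by
  have : (prismHtpy l 0 : SC E 0 →ₗ[ZMod 2] _) = 0 :=
    lin_ext fun σ => by rw [prismHtpy_single]; simp [prismOp]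
  rw [this]; rfl

/-- This is `bd_prismOp` for the identity simplex, pushed forward along `labelHtpy`: the bottom of
the prism gives `σ`, the top the affine simplex on the labels, and the sides match by naturality in
the facets. -/
lemma sbd_prismHtpy (l : E → E) (n : ℕ) (c : SC E (n + 1)) :
    sbd (prismHtpy l (n + 1) c) + prismHtpy l n (sbd c) =
      c + realize (n + 1) (label l (n + 1) c) := by
  have : sbd ∘ₗ prismHtpy l (n + 1) + prismHtpy l n ∘ₗ sbd =
      (LinearMap.id + realize (n + 1) ∘ₗ label l (n + 1) : SC E (n + 1) →ₗ[ZMod 2] _) := by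
    refine lin_ext fun σ => ?_
    have h := bd_prismOp (n + 1) n (Finsupp.single (verts (n + 1)) 1)
    have h1 : prismHtpy l n (sbd (Finsupp.single σ 1)) =
        push (convex_prism (n + 1)) (labelHtpy l σ) (n + 1)
          (prismOp (n + 1) n (bd (Finsupp.single (verts (n + 1)) 1))) := by
      rw [single_verts_succ_bd, map_sum, map_sum, sbd_single, map_sum]
      refine Finset.sum_congr rfl fun i _ => ?_
      rw [← prismOp_coface, push_chMap _ _ _ (isAff_prismCoface i), labelHtpy_coface,
        prismHtpy_single]
    have hbot : (labelHtpy l σ).comp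
        (affIn (convex_prism (n + 1)) (prismBot ∘ verts (n + 1))) = σ := by
      ext x
      have hx : affIn (convex_prism (n + 1)) (prismBot ∘ verts (n + 1)) x = prismBot x := by
        refine Subtype.ext (Prod.ext ?_ ?_)
        · have := congrArg Subtype.val (DFunLike.congr_fun (affIn_self (n + 1)) x)
          rw [affIn_coe] at this
          rw [affIn_coe, Prod.fst_sum]
          exact this
        · rw [affIn_coe, Prod.snd_sum]; simp [prismBot]
      rw [ContinuousMap.comp_apply, hx]
      simp [labelHtpy, prismBot]
      rfl
    have htop : (labelHtpy l σ).comp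
        (affIn (convex_prism (n + 1)) (prismTop ∘ verts (n + 1))) =
          affE (fun i => l (σ (verts (n + 1) i))) := by
      ext x
      have hx : affIn (convex_prism (n + 1)) (prismTop ∘ verts (n + 1)) x = prismTop x := by
        refine Subtype.ext (Prod.ext ?_ ?_)
        · have := congrArg Subtype.val (DFunLike.congr_fun (affIn_self (n + 1)) x)
          rw [affIn_coe] at this
          rw [affIn_coe, Prod.fst_sum]
          exact this
        · rw [affIn_coe, Prod.snd_sum]; simpa [prismTop] using x.2.2
      rw [ContinuousMap.comp_apply, hx]
      simp [labelHtpy, prismTop]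
      rfl
    rw [LinearMap.add_apply, LinearMap.comp_apply, LinearMap.comp_apply, h1, prismHtpy_single,
      sbd_push, ← map_add, h, map_add, chMap_single, chMap_single, push_single, push_single,
      hbot, htop, LinearMap.add_apply, LinearMap.comp_apply, label_single, realize_single]
    rfl
  exact LinearMap.congr_fun this c

lemma prismHtpy_mem (l : E → E) {n : ℕ} {c : SC E n} {P : Set C(Simp n, E)} {A : Set E}
    (hc : c ∈ Finsupp.supported (ZMod 2) (ZMod 2) P)
    (hP : ∀ σ ∈ P, ∀ p, labelHtpy l σ p ∈ A) : prismHtpy l n c ∈ chainsIn A (n + 1) := by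
  refine map_mem_supported _ (fun σ hσ => ?_) hc
  rw [prismHtpy_single]
  exact push_mem _ _ _ (hP σ hσ)

end Prism

/-! ### Independence of the ordering of vertices. -/

section Order

variable {E : Type*} [DecidableEq E]

/-- The homotopy between the identity of tuple chains and forgetting, then choosing orderings. -/
def orderHtpy (n : ℕ) : Ch E n →ₗ[ZMod 2] Ch E (n + 1) :=
  coneHtpy (fun n => LinearMap.id + toTuples n ∘ₗ toSets n) (fun _ t => t 0) n

lemma bd_orderHtpy (n : ℕ) (c : Ch E (n + 1)) :
    bd (orderHtpy (n + 1) c) + orderHtpy n (bd c) = c + toTuples (n + 1) (toSets (n + 1) c) := by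
  refine bd_coneHtpy _ _ ?_ (fun n x => ?_) n c
  · refine lin_ext fun t => ?_
    rw [LinearMap.add_apply, LinearMap.comp_apply, toSets_single]
    simp [toTuples_zero_single, Subsingleton.elim t Fin.elim0, ZModModule.add_self]
  · simp [bd_toTuples, fd_toSets]

/-- No new vertices appear, so after realization the homotopy stays in any face spanned by vertices
containing those of `t`. -/
lemma orderHtpy_mem (n : ℕ) (t : Fin n → E) : orderHtpy n (Finsupp.single t 1) ∈
    Finsupp.supported (ZMod 2) (ZMod 2) {u | ∀ i, u i ∈ Set.range t} := by
  refine coneHtpy_mem _ _ id monotone_id (fun n t => ?_) (fun n t => ⟨0, rfl⟩) n t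
  rw [LinearMap.add_apply, LinearMap.comp_apply, toSets_single]
  refine Submodule.add_mem _ (Finsupp.single_mem_supported _ _ fun i => ⟨i, rfl⟩) ?_
  split_ifs
  · refine Finsupp.supported_mono (fun u hu i => ?_) (toTuples_mem n _)
    simpa using hu i
  · simp

end Order

/-- The homotopies of the successive subdivisions telescope. The alternative `n = 0` is needed
because a `0`-chain is always a cycle for unreduced homology, although its augmentation `sbd` may be
nonzero. -/
lemma exists_sbd_eq_add_subdiv_iterate {X : Type*} [TopologicalSpace X] {A : Set X}
    {n : ℕ} {y : SC X (n + 1)}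
    (hy : y ∈ chainsIn A (n + 1)) (hcyc : n = 0 ∨ sbd y = 0) (m : ℕ) :
    ∃ w ∈ chainsIn A (n + 2), sbd w = y + (subdiv (n + 1))^[m] y := by
  induction m with
  | zero => exact ⟨0, Submodule.zero_mem _, by simp [ZModModule.add_self]⟩
  | succ m ih =>
    obtain ⟨w, hw, hw'⟩ := ih
    refine ⟨w + subdivHtpy (n + 1) ((subdiv (n + 1))^[m] y),
      Submodule.add_mem _ hw (subdivHtpy_mem (subdiv_iterate_mem hy m)), ?_⟩
    have h := sbd_subdivHtpy n ((subdiv (n + 1))^[m] y)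
    have h0 : subdivHtpy n (sbd ((subdiv (n + 1))^[m] y)) = 0 := by
      rcases hcyc with rfl | hcyc
      · exact subdivHtpy_zero _
      · rw [sbd_subdiv_iterate, hcyc, iterate_eq_pow, map_zero, map_zero]
    rw [h0, add_zero] at h
    rw [map_add, h, hw', Function.iterate_succ_apply', add_assoc, ← add_assoc ((subdiv _)^[m] y),
      ZModModule.add_self, zero_add]

/-! ### Comparison of simplicial and singular chains -/

section Comparison

variable {E : Type*} [NormedAddCommGroup E] [NormedSpace ℝ E]
  {K : Geometry.SimplicialComplex ℝ E}

/-- Take a face of least cardinality whose hull contains `x`. Its intersection with any other such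
face is again such a face, so by minimality it is contained in the other one. A vertex of this
carrier is a vertex whose open star contains `x`. -/
lemma exists_carrier {x : E} (hx : x ∈ K.space) : ∃ σ ∈ K.faces, x ∈ convexHull ℝ (σ : Set E) ∧
    ∀ τ ∈ K.faces, x ∈ convexHull ℝ (τ : Set E) → σ ⊆ τ := by
  classical
  obtain ⟨σ₀, hσ₀, hx₀⟩ := K.mem_space_iff.1 hx
  let S : Set (Finset E) := {σ | σ ∈ K.faces ∧ x ∈ convexHull ℝ (σ : Set E)}
  obtain ⟨σ, ⟨hσ, hxσ⟩, hmin⟩ : ∃ σ ∈ S, ∀ τ ∈ S, σ.card ≤ τ.card := by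
    have hne : S.Nonempty := ⟨σ₀, hσ₀, hx₀⟩
    exact ⟨Function.argminOn Finset.card S hne, Function.argminOn_mem _ _ _,
      fun τ hτ => Function.argminOn_le Finset.card S hτ⟩
  refine ⟨σ, hσ, hxσ, fun τ hτ hxτ => ?_⟩
  have h1 : x ∈ convexHull ℝ ((σ ∩ τ : Finset E) : Set E) := by
    rw [Finset.coe_inter]; exact K.inter_subset_convexHull hσ hτ ⟨hxσ, hxτ⟩
  have hne : (σ ∩ τ).Nonempty := by
    rw [← Finset.coe_nonempty, ← convexHull_nonempty_iff (𝕜 := ℝ)]; exact ⟨x, h1⟩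
  have h2 := hmin _ ⟨K.down_closed hσ Finset.inter_subset_left hne, h1⟩
  rw [← Finset.eq_of_subset_of_card_le Finset.inter_subset_left h2]
  exact Finset.inter_subset_right

/-- A Lebesgue number argument: points of a compact set covered by the open stars of vertices in
`W` can be labelled by such vertices, locally constantly up to moving inside a star. -/
lemma exists_label (hfin : K.faces.Finite) {W Y : Set E} (hYc : IsCompact Y)
    (hY : ∀ x ∈ Y, ∃ v ∈ W, ∀ τ ∈ K.faces, x ∈ convexHull ℝ (τ : Set E) → v ∈ τ) :
    ∃ ε > 0, ∃ l : E → E, ∀ x ∈ Y, l x ∈ W ∧ ∀ y ∈ Y, dist y x < ε → ∀ τ ∈ K.faces,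
      y ∈ convexHull ℝ (τ : Set E) → l x ∈ τ := by
  classical
  -- `c v` meets `|K|` in the open star of `v`. It is open as the complement of a finite union of
  -- compact hulls.
  let c : W → Set E := fun v => (⋃ τ ∈ {τ | τ ∈ K.faces ∧ (v : E) ∉ τ}, convexHull ℝ (τ : Set E))ᶜ
  have hc : ∀ v, IsOpen (c v) := fun v => by
    refine isOpen_compl_iff.2 ((hfin.subset fun τ hτ => hτ.1).isClosed_biUnion fun τ _ => ?_)
    exact (τ.finite_toSet.isCompact_convexHull ℝ).isClosed
  have hmem : ∀ v y, y ∈ c v ↔ ∀ τ ∈ K.faces, y ∈ convexHull ℝ (τ : Set E) → (v : E) ∈ τ := by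
    intro v y
    simp only [c, Set.mem_compl_iff, Set.mem_iUnion, not_exists]
    constructor
    · intro h τ hτ hy
      by_contra hv
      exact h τ ⟨hτ, hv⟩ hy
    · intro h τ hτ hy
      exact hτ.2 (h τ hτ.1 hy)
  obtain ⟨ε, hε, h⟩ := lebesgue_number_lemma_of_metric hYc hc fun x hx => by
    obtain ⟨v, hv, h⟩ := hY x hx
    exact Set.mem_iUnion.2 ⟨⟨v, hv⟩, (hmem _ _).2 h⟩
  have h' : ∀ x, ∃ v : E, x ∈ Y → v ∈ W ∧ ∀ y ∈ Metric.ball x ε, ∀ τ ∈ K.faces,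
      y ∈ convexHull ℝ (τ : Set E) → v ∈ τ := by
    intro x
    by_cases hx : x ∈ Y
    · obtain ⟨v, hv⟩ := h x hx
      exact ⟨v, fun _ => ⟨v.2, fun y hy => (hmem _ _).1 (hv hy)⟩⟩
    · exact ⟨x, fun h => absurd h hx⟩
  choose l hl using h'
  exact ⟨ε, hε, l, fun x hx => ⟨(hl x hx).1, fun y _ hyx => (hl x hx).2 y hyx⟩⟩

/-- The faces of `K`, including the empty one, with vertices in `W`. -/
def facesIn (K : Geometry.SimplicialComplex ℝ E) (W : Set E) : Set (Finset E) :=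
  {F | F = ∅ ∨ (F ∈ K.faces ∧ (F : Set E) ⊆ W)}

lemma isLowerSet_facesIn (W : Set E) : IsLowerSet (facesIn K W) := by
  intro F G hGF hF
  rcases G.eq_empty_or_nonempty with rfl | hG
  · exact Or.inl rfl
  rcases hF with rfl | hF
  · exact Or.inl (Finset.subset_empty.1 hGF)
  · exact Or.inr ⟨K.down_closed hF.1 hGF hG, (Finset.coe_subset.2 hGF).trans hF.2⟩

variable [DecidableEq E]

/-- A simplicial chain bounding in the singular chains of a set covered by the open stars of the
vertices in `W` bounds in the subcomplex spanned by `W`. -/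
theorem exists_fd_eq_of_sbd_eq (hfin : K.faces.Finite) {W U : Set E} (hUK : U ⊆ K.space)
    (hU : ∀ x ∈ U, ∃ v ∈ W, ∀ τ ∈ K.faces, x ∈ convexHull ℝ (τ : Set E) → v ∈ τ)
    {n : ℕ} {z : FC E} (hz : z ∈ chains (facesIn K W) n) {y : SC E (n + 1)}
    (hy : y ∈ chainsIn U (n + 1)) (hyz : sbd y = realize n (toTuples n z)) :
    ∃ z' ∈ chains (facesIn K W) (n + 1), fd z' = z := by
  -- `U` need not be compact. `Y` is compact, contains the simplices of `y` and the subcomplex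
  -- spanned by `W`, and is still covered by the open stars of vertices in `W`.
  set Y : Set E := (⋃ σ ∈ y.support, Set.range σ) ∪
    ⋃ F ∈ {F | F ∈ K.faces ∧ (F : Set E) ⊆ W}, convexHull ℝ (F : Set E) with hYdef
  have hYc : IsCompact Y := by
    refine (y.support.isCompact_biUnion fun σ _ => isCompact_range σ.continuous).union ?_
    exact (hfin.subset fun F hF => hF.1).isCompact_biUnion
      fun F _ => F.finite_toSet.isCompact_convexHull ℝ
  have hYK : Y ⊆ K.space := by
    rintro x (hx | hx)
    · simp only [Set.mem_iUnion] at hx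
      obtain ⟨σ, hσ, p, rfl⟩ := hx
      exact hUK (hy hσ p)
    · simp only [Set.mem_iUnion] at hx
      obtain ⟨F, hF, hx⟩ := hx
      exact K.mem_space_iff.2 ⟨F, hF.1, hx⟩
  have hY : ∀ x ∈ Y, ∃ v ∈ W, ∀ τ ∈ K.faces, x ∈ convexHull ℝ (τ : Set E) → v ∈ τ := by
    rintro x (hx | hx)
    · simp only [Set.mem_iUnion] at hx
      obtain ⟨σ, hσ, p, rfl⟩ := hx
      exact hU _ (hy hσ p)
    · have hxK := hYK (Or.inr hx)
      simp only [Set.mem_iUnion] at hx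
      obtain ⟨F, hF, hx⟩ := hx
      obtain ⟨σ, hσ, hxσ, hmin⟩ := exists_carrier hxK
      obtain ⟨v, hv⟩ := K.nonempty_of_mem_faces hσ
      exact ⟨v, hF.2 (hmin F hF.1 hx hv), fun τ hτ hxτ => hmin τ hτ hxτ hv⟩
  obtain ⟨ε, hε, l, hl⟩ := exists_label hfin hYc hY
  have hyY : y ∈ chainsIn Y (n + 1) := by
    intro σ hσ p
    exact Or.inl (Set.mem_biUnion hσ ⟨p, rfl⟩)
  obtain ⟨M, hM⟩ := exists_subdiv_small_chain y hε
  -- Order, realize, subdivide, label, forget the order: a chain map carried by the faces, hence the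
  -- identity on the subcomplex spanned by `W`. The last three operations, applied to `y`, therefore
  -- give a chain with boundary exactly `z`, not merely homologous to it.
  let f : ℕ → FC E →ₗ[ZMod 2] FC E := fun n =>
    toSets n ∘ₗ label l n ∘ₗ (subdiv n ^ M) ∘ₗ realize n ∘ₗ toTuples n
  have hf : ∀ n x, f n x = toSets n (label l n ((subdiv n)^[M] (realize n (toTuples n x)))) :=
    fun n x => by rw [iterate_eq_pow]; rfl
  have hfid : ∀ F ∈ facesIn K W, f F.card (Finsupp.single F 1) = Finsupp.single F 1 := by
    intro F hF
    refine eq_single_of_carried f (facesIn K W) (isLowerSet_facesIn W) ?_ ?_ ?_ hF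
    · have h0 : (subdiv 0)^[M] = (id : SC E 0 → SC E 0) := by
        have : subdiv 0 = (LinearMap.id : SC E 0 →ₗ[ZMod 2] _) := by
          refine lin_ext fun σ => ?_
          rw [subdiv_single, sd_zero, LinearMap.id_apply, push_single, affIn_self]
          rfl
        rw [this]; exact Function.iterate_id M
      rw [hf, h0, toTuples_zero_single, if_pos rfl, realize_single, id, label_single,
        toSets_single]
      simp
    · intro n x
      rw [hf, hf, fd_toSets, bd_label, sbd_subdiv_iterate, sbd_realize, bd_toTuples]
    · intro F hF
      have h1 : (subdiv F.card)^[M] (realize F.card (toTuples F.card (Finsupp.single F 1))) ∈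
          chainsIn (convexHull ℝ (F : Set E)) F.card := by
        refine subdiv_iterate_mem (realize_mem (toTuples_mem _ F) fun t ht => ?_) M
        exact convexHull_mono (Set.range_subset_iff.2 ht)
      have h2 : label l F.card
          ((subdiv F.card)^[M] (realize F.card (toTuples F.card (Finsupp.single F 1)))) ∈
          Finsupp.supported (ZMod 2) (ZMod 2) {u | ∀ i, u i ∈ (F : Set E)} := by
        refine map_mem_supported _ (fun σ hσ => ?_) h1
        rw [label_single]
        refine Finsupp.single_mem_supported _ _ fun i => ?_
        have hFK : F ∈ K.faces ∧ (F : Set E) ⊆ W := by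
          refine hF.resolve_left fun h => ?_
          have hi := i.2
          have h0 := Finset.card_eq_zero.2 h
          omega
        have hx : σ (verts _ i) ∈ Y := Or.inr (Set.mem_biUnion
          (show F ∈ {F : Finset E | F ∈ K.faces ∧ (F : Set E) ⊆ W} from hFK) (hσ _))
        exact (hl _ hx).2 _ hx (by rwa [dist_self]) F hFK.1 (hσ _)
      rw [hf]
      refine Finsupp.supported_mono ?_ (toSets_mem h2)
      exact fun G hG => ⟨Finset.coe_subset.1 hG.1, hG.2⟩
  have hfz : f n z = z := by
    clear hyz
    rw [chains, Finsupp.supported_eq_span_single] at hz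
    induction hz using Submodule.span_induction with
    | zero => simp
    | add x y _ _ hx hy => rw [map_add, hx, hy]
    | smul a x _ hx => rw [map_smul, hx]
    | mem x hx =>
      obtain ⟨F, ⟨hF, hn⟩, rfl⟩ := hx
      subst hn
      exact hfid F hF
  refine ⟨toSets (n + 1) (label l (n + 1) ((subdiv (n + 1))^[M] y)), ?_, ?_⟩
  · have h1 : (subdiv (n + 1))^[M] y ∈ Finsupp.supported (ZMod 2) (ZMod 2)
        ({τ | ∀ x y, dist (τ x) (τ y) < ε} ∩ {τ | ∀ x, τ x ∈ Y}) := by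
      rw [Finsupp.supported_inter]
      exact ⟨hM M le_rfl, subdiv_iterate_mem hyY M⟩
    change (toSets (n + 1) ∘ₗ label l (n + 1)) _ ∈ _
    refine map_mem_supported _ (fun τ hτ => ?_) h1
    -- The first vertex is within `ε` of every vertex of `τ`, so a face through it contains all the
    -- labels, which therefore span a face.
    obtain ⟨ρ, hρ, hxρ⟩ := K.mem_space_iff.1 (hYK (hτ.2 (verts (n + 1) 0)))
    have h2 : label l (n + 1) (Finsupp.single τ 1) ∈
        Finsupp.supported (ZMod 2) (ZMod 2) {u | ∀ i, u i ∈ (ρ : Set E) ∩ W} := by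
      rw [label_single]
      refine Finsupp.single_mem_supported _ _ fun i => ?_
      obtain ⟨h3, h4⟩ := hl _ (hτ.2 (verts (n + 1) i))
      exact ⟨h4 _ (hτ.2 _) (hτ.1 _ _) ρ hρ hxρ, h3⟩
    refine Finsupp.supported_mono ?_ (toSets_mem h2)
    rintro G ⟨hG, hGn⟩
    refine ⟨Or.inr ⟨K.down_closed hρ (fun v hv => (hG hv).1) ?_, fun v hv => (hG hv).2⟩, hGn⟩
    exact Finset.card_pos.1 (by omega)
  · rw [fd_toSets, bd_label, sbd_subdiv_iterate, hyz, ← hf, hfz]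

/-- Singular cycles of `|K|` are homologous to simplicial ones. -/
theorem exists_simplicial_cycle (hfin : K.faces.Finite) {n : ℕ} {y : SC E (n + 1)}
    (hy : y ∈ chainsIn K.space (n + 1)) (hcyc : n = 0 ∨ sbd y = 0) :
    ∃ z ∈ chains (facesIn K Set.univ) (n + 1), (n = 0 ∨ fd z = 0) ∧
      ∃ w ∈ chainsIn K.space (n + 2), sbd w = y + realize (n + 1) (toTuples (n + 1) z) := by
  have hYc : IsCompact K.space :=
    hfin.isCompact_biUnion fun F _ => F.finite_toSet.isCompact_convexHull ℝ
  obtain ⟨ε, hε, l, hl⟩ := exists_label hfin (W := Set.univ) hYc fun x hx => by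
    obtain ⟨σ, hσ, _, hmin⟩ := exists_carrier hx
    obtain ⟨v, hv⟩ := K.nonempty_of_mem_faces hσ
    exact ⟨v, Set.mem_univ v, fun τ hτ hxτ => hmin τ hτ hxτ hv⟩
  obtain ⟨M, hM⟩ := exists_subdiv_small_chain y hε
  obtain ⟨w₁, hw₁, hw₁'⟩ := exists_sbd_eq_add_subdiv_iterate hy hcyc M
  set y' := (subdiv (n + 1))^[M] y with hy'
  have hsmall : y' ∈ Finsupp.supported (ZMod 2) (ZMod 2)
      ({τ | ∀ x y, dist (τ x) (τ y) < ε} ∩ {τ | ∀ x, τ x ∈ K.space}) := by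
    rw [Finsupp.supported_inter]
    exact ⟨hM M le_rfl, subdiv_iterate_mem hy M⟩
  have hcyc' : n = 0 ∨ sbd y' = 0 := by
    refine hcyc.imp_right fun h => ?_
    rw [hy', sbd_subdiv_iterate, h, iterate_eq_pow, map_zero]
  set c := label l (n + 1) y' with hc
  -- Any face through a point of a small simplex contains all its labels, so the segment from that
  -- point to a point of the affine simplex on the labels stays in the face.
  have hlab : ∀ τ : C(Simp (n + 1), E), (∀ x y, dist (τ x) (τ y) < ε) →
      (∀ x, τ x ∈ K.space) → ∀ x, ∀ ρ ∈ K.faces, τ x ∈ convexHull ℝ (ρ : Set E) →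
        ∀ i, l (τ (verts (n + 1) i)) ∈ ρ := by
    intro τ hτ hτK x ρ hρ hx i
    exact (hl _ (hτK _)).2 _ (hτK x) (hτ _ _) ρ hρ hx
  have hcK : c ∈ Finsupp.supported (ZMod 2) (ZMod 2)
      {u | ∃ ρ ∈ K.faces, ∀ i, u i ∈ ρ} := by
    refine map_mem_supported _ (fun τ hτ => ?_) hsmall
    rw [label_single]
    obtain ⟨ρ, hρ, hxρ⟩ := K.mem_space_iff.1 (hτ.2 (verts (n + 1) 0))
    exact Finsupp.single_mem_supported _ _ ⟨ρ, hρ, hlab τ hτ.1 hτ.2 _ ρ hρ hxρ⟩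
  have hbdc : n = 0 ∨ bd c = 0 := hcyc'.imp_right fun h => by rw [hc, bd_label, h, map_zero]
  -- The homology is the sum of three: subdivision, straight-line motion to the labels, and
  -- reordering of the vertices.
  refine ⟨toSets (n + 1) c, ?_, hbdc.imp_right fun h => by rw [fd_toSets, h, map_zero],
    w₁ + (prismHtpy l (n + 1) y' + realize (n + 2) (orderHtpy (n + 1) c)), ?_, ?_⟩
  · refine map_mem_supported _ (fun u hu => ?_) hcK
    obtain ⟨ρ, hρ, hu⟩ := hu
    have h1 : Finsupp.single u (1 : ZMod 2) ∈
        Finsupp.supported (ZMod 2) (ZMod 2) {u : Fin (n + 1) → E | ∀ i, u i ∈ (ρ : Set E)} :=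
      Finsupp.single_mem_supported _ _ hu
    refine Finsupp.supported_mono ?_ (toSets_mem h1)
    rintro G ⟨hG, hGn⟩
    exact ⟨Or.inr ⟨K.down_closed hρ (Finset.coe_subset.1 hG) (Finset.card_pos.1 (by omega)),
      Set.subset_univ _⟩, hGn⟩
  · refine Submodule.add_mem _ hw₁ (Submodule.add_mem _ ?_ ?_)
    · refine prismHtpy_mem l hsmall fun τ hτ p => ?_
      obtain ⟨ρ, hρ, hxρ⟩ := K.mem_space_iff.1 (hτ.2 ⟨p.1.1, p.2.1⟩)
      refine K.mem_space_iff.2 ⟨ρ, hρ, convex_convexHull ℝ _ hxρ ?_ (sub_nonneg.2 p.2.2.2)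
        p.2.2.1 (by ring)⟩
      refine convexHull_mono ?_ (affE_mem_convexHull _ _)
      exact Set.range_subset_iff.2 (hlab τ hτ.1 hτ.2 _ ρ hρ hxρ)
    · have h1 : orderHtpy (n + 1) c ∈ Finsupp.supported (ZMod 2) (ZMod 2)
          {u | ∃ ρ ∈ K.faces, ∀ i, u i ∈ ρ} := by
        refine map_mem_supported _ (fun u hu => ?_) hcK
        obtain ⟨ρ, hρ, hu⟩ := hu
        refine Finsupp.supported_mono (fun u' hu' => ?_) (orderHtpy_mem (n + 1) u)
        refine ⟨ρ, hρ, fun i => ?_⟩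
        obtain ⟨j, hj⟩ := hu' i
        exact hj ▸ hu j
      refine realize_mem h1 fun t ht => ?_
      obtain ⟨ρ, hρ, ht⟩ := ht
      exact (convexHull_mono (Set.range_subset_iff.2 ht)).trans (K.convexHull_subset_space hρ)
  · have h1 := sbd_prismHtpy l n y'
    have h2 := bd_orderHtpy n c
    have h3 : prismHtpy l n (sbd y') = 0 := by
      rcases hcyc' with rfl | h
      · exact prismHtpy_zero _ _
      · rw [h, map_zero]
    have h4 : orderHtpy n (bd c) = 0 := by
      rcases hbdc with rfl | h
      · rfl
      · rw [h, map_zero]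
    rw [h3, add_zero, ← hc] at h1
    rw [h4, add_zero] at h2
    rw [map_add, map_add, hw₁', h1, sbd_realize, h2, map_add]
    have h5 : ∀ a b : SC E (n + 1), a + (a + b) = b := fun a b => by
      rw [← add_assoc, ZModModule.add_self, zero_add]
    rw [add_assoc y' _, h5 (realize (n + 1) c), add_assoc, h5]

end Comparison

/-! ### Homology of complexes of modules -/

section HomologyClass

variable {R : Type*} [Ring R]

/-- The homology class of a cycle. -/
def homologyClass (S : ShortComplex (ModuleCat R)) :
    LinearMap.ker S.g.hom →ₗ[R] S.homology :=
  (S.moduleCatCyclesIso.inv ≫ S.homologyπ).hom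

lemma homologyClass_surjective (S : ShortComplex (ModuleCat R)) :
    Function.Surjective (homologyClass S) :=
  (ModuleCat.epi_iff_surjective (S.moduleCatCyclesIso.inv ≫ S.homologyπ)).1 inferInstance

lemma homologyClass_eq_zero_iff (S : ShortComplex (ModuleCat R)) (x : LinearMap.ker S.g.hom) :
    homologyClass S x = 0 ↔ ∃ y, S.f.hom y = x := by
  have h : homologyClass S x = S.moduleCatHomologyIso.inv (S.moduleCatLeftHomologyData.π x) := by
    rw [homologyClass, S.moduleCatCyclesIso_inv_π]; rfl
  have hinj : Function.Injective S.moduleCatHomologyIso.inv :=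
    (ModuleCat.mono_iff_injective _).1 inferInstance
  rw [h, map_eq_zero_iff _ hinj]
  refine (Submodule.Quotient.mk_eq_zero _).trans ?_
  constructor
  · rintro ⟨y, hy⟩
    exact ⟨y, congrArg Subtype.val hy⟩
  · rintro ⟨y, hy⟩
    exact ⟨y, Subtype.ext hy⟩

lemma homologyMap_homologyClass {S S' : ShortComplex (ModuleCat R)} (φ : S ⟶ S')
    (x : LinearMap.ker S.g.hom) (x' : LinearMap.ker S'.g.hom) (h : φ.τ₂.hom x = x') :
    (ShortComplex.homologyMap φ).hom (homologyClass S x) = homologyClass S' x' := by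
  have h1 : ShortComplex.cyclesMap φ (S.moduleCatCyclesIso.inv x) =
      S'.moduleCatCyclesIso.inv x' := by
    have hinj : Function.Injective S'.iCycles := (ModuleCat.mono_iff_injective _).1 inferInstance
    apply hinj
    have e1 := ConcreteCategory.congr_hom (ShortComplex.cyclesMap_i φ) (S.moduleCatCyclesIso.inv x)
    have e2 := ConcreteCategory.congr_hom S.moduleCatCyclesIso_inv_iCycles x
    have e3 := ConcreteCategory.congr_hom S'.moduleCatCyclesIso_inv_iCycles x'
    refine e1.trans (Eq.trans ?_ e3.symm)
    refine Eq.trans (congrArg φ.τ₂.hom e2) h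
  have h2 := ConcreteCategory.congr_hom (ShortComplex.homologyπ_naturality φ)
    (S.moduleCatCyclesIso.inv x)
  refine h2.trans ?_
  exact congrArg S'.homologyπ h1

lemma exists_of_homologyMap_injective {S S' : ShortComplex (ModuleCat R)} (φ : S ⟶ S')
    (hφ : Function.Injective (ShortComplex.homologyMap φ)) {x : S.X₂} (hx : S.g.hom x = 0)
    {y : S'.X₁} (hy : S'.f.hom y = φ.τ₂.hom x) : ∃ w, S.f.hom w = x := by
  have hx' : S'.g.hom (φ.τ₂.hom x) = 0 := by
    rw [← hy]; exact S'.moduleCat_zero_apply y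
  have h1 := homologyMap_homologyClass φ ⟨x, hx⟩ ⟨_, hx'⟩ rfl
  have h2 : homologyClass S ⟨x, hx⟩ = 0 := by
    apply hφ
    refine h1.trans (Eq.trans ?_ (map_zero _).symm)
    exact (homologyClass_eq_zero_iff _ _).2 ⟨y, hy⟩
  exact (homologyClass_eq_zero_iff _ _).1 h2

end HomologyClass

lemma hom_sum_apply {R : Type*} [Ring R] {M N : ModuleCat R} {ι : Type*} [Fintype ι]
    (f : ι → (M ⟶ N)) (x : M) : (∑ i, f i).hom x = ∑ i, (f i).hom x := by
  rw [ModuleCat.hom_sum, LinearMap.sum_apply]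

/-! ### Comparison with Mathlib's singular chain complex -/

section Bridge

/-- Mathlib's singular chain complex with coefficients in `ℤ/2`. -/
abbrev singComplex (X : TopCat.{0}) : ChainComplex (ModuleCat.{0} (ZMod 2)) ℕ :=
  (TopCat.toSSet.obj X).chainComplex (ModuleCat.of (ZMod 2) (ZMod 2))

/-- Singular chains as elements of Mathlib's singular chain complex. -/
def toSing (X : TopCat.{0}) (i : ℕ) : SC X (i + 1) →ₗ[ZMod 2] (singComplex X).X i :=
  Finsupp.linearCombination (ZMod 2) fun σ =>
    ((TopCat.toSSet.obj X).ιChainComplex (R := ModuleCat.of (ZMod 2) (ZMod 2)) (n := i)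
      ((X.toSSetObjEquiv (.op (SimplexCategory.mk i))).symm σ)).hom (1 : ZMod 2)

lemma toSing_single {X : TopCat.{0}} {i : ℕ} (σ : C(Simp (i + 1), X)) :
    toSing X i (Finsupp.single σ 1) =
    ((TopCat.toSSet.obj X).ιChainComplex (R := ModuleCat.of (ZMod 2) (ZMod 2)) (n := i)
      ((X.toSSetObjEquiv (.op (SimplexCategory.mk i))).symm σ)).hom (1 : ZMod 2) := by
  rw [toSing, Finsupp.linearCombination_single, one_smul]

/-- The inverse of `toSing`. -/
def ofSing (X : TopCat.{0}) (i : ℕ) :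
    (singComplex X).X i ⟶ ModuleCat.of (ZMod 2) (SC X (i + 1)) :=
  Limits.Cofan.IsColimit.desc
    ((TopCat.toSSet.obj X).isColimitChainComplexXCofan (ModuleCat.of (ZMod 2) (ZMod 2)) i)
    fun x => ModuleCat.ofHom (LinearMap.toSpanSingleton (ZMod 2) (SC X (i + 1))
      (Finsupp.single (X.toSSetObjEquiv (.op (SimplexCategory.mk i)) x) 1))

lemma ι_ofSing (X : TopCat.{0}) (i : ℕ) (x) :
    (TopCat.toSSet.obj X).ιChainComplex (R := ModuleCat.of (ZMod 2) (ZMod 2)) (n := i) x ≫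
      ofSing X i = ModuleCat.ofHom (LinearMap.toSpanSingleton (ZMod 2) (SC X (i + 1))
      (Finsupp.single (X.toSSetObjEquiv (.op (SimplexCategory.mk i)) x) 1)) :=
  Limits.Cofan.IsColimit.fac
    ((TopCat.toSSet.obj X).isColimitChainComplexXCofan (ModuleCat.of (ZMod 2) (ZMod 2)) i) _ _

lemma ofSing_toSing {X : TopCat.{0}} {i : ℕ} (c : SC X (i + 1)) :
    (ofSing X i).hom (toSing X i c) = c := by
  have : (ofSing X i).hom ∘ₗ toSing X i = LinearMap.id := by
    refine lin_ext fun σ => ?_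
    rw [LinearMap.comp_apply, toSing_single]
    refine (ConcreteCategory.congr_hom (ι_ofSing X i _) (1 : ZMod 2)).trans ?_
    refine (LinearMap.toSpanSingleton_apply_one _ _ _).trans ?_
    rw [Equiv.apply_symm_apply]; rfl
  exact LinearMap.congr_fun this c

lemma toSing_injective (X : TopCat.{0}) (i : ℕ) : Function.Injective (toSing X i) :=
  Function.LeftInverse.injective ofSing_toSing

lemma toSing_ofSing {X : TopCat.{0}} {i : ℕ} (c : (singComplex X).X i) :
    toSing X i ((ofSing X i).hom c) = c := by
  have : ofSing X i ≫ ModuleCat.ofHom (toSing X i) = 𝟙 _ := by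
    refine SSet.chainComplex_hom_ext fun x => ?_
    rw [← Category.assoc, ι_ofSing, Category.comp_id]
    refine ModuleCat.hom_ext (LinearMap.ext_ring ?_)
    refine Eq.trans (congrArg (toSing X i) (LinearMap.toSpanSingleton_apply_one _ _ _)) ?_
    rw [toSing_single, Equiv.symm_apply_apply]
  exact ConcreteCategory.congr_hom this c

/-- This matches the affine facet inclusions with the face maps underlying `TopCat.toSSet`. -/
lemma coface_eq_map {n : ℕ} (i : Fin (n + 1)) (x : Simp n) :
    coface i x = stdSimplex.map i.succAbove x := by
  refine stdSimplex.ext ?_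
  funext j
  rw [stdSimplex.map_coe, FunOnFinite.linearMap_apply_apply]
  change (coface i x).1 j = _
  rw [coface, affIn_coe, Finset.sum_apply, Finset.sum_filter]
  refine Finset.sum_congr rfl fun a _ => ?_
  simp only [Function.comp_apply, verts, Pi.smul_apply, smul_eq_mul]
  change x.1 a * (Pi.single (i.succAbove a) 1 : Fin (n + 1) → ℝ) j = _
  rw [Pi.single_apply]
  by_cases h : j = i.succAbove a
  · simp [h]; rfl
  · simp [h, Ne.symm h]

lemma d_toSing {X : TopCat.{0}} {i : ℕ} (c : SC X (i + 2)) :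
    ((singComplex X).d (i + 1) i).hom (toSing X (i + 1) c) = toSing X i (sbd c) := by
  have : ((singComplex X).d (i + 1) i).hom ∘ₗ toSing X (i + 1) = toSing X i ∘ₗ sbd := by
    refine lin_ext fun σ => ?_
    rw [LinearMap.comp_apply, LinearMap.comp_apply, toSing_single, sbd_single, map_sum]
    refine (ConcreteCategory.congr_hom (SSet.ιChainComplex_d (TopCat.toSSet.obj X)
      (R := ModuleCat.of (ZMod 2) (ZMod 2)) _) (1 : ZMod 2)).trans ?_
    refine (hom_sum_apply _ _).trans ?_
    refine Finset.sum_congr rfl fun j _ => ?_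
    rw [toSing_single]
    have hs : (TopCat.toSSet.obj X).δ j ((X.toSSetObjEquiv
        (.op (SimplexCategory.mk (i + 1)))).symm σ) =
        (X.toSSetObjEquiv (.op (SimplexCategory.mk i))).symm (σ.comp (coface j)) := by
      apply (X.toSSetObjEquiv (.op (SimplexCategory.mk i))).injective
      rw [Equiv.apply_symm_apply]
      refine ContinuousMap.ext fun x => ?_
      rw [ContinuousMap.comp_apply, coface_eq_map]
      rfl
    rw [hs]
    -- The alternating signs are invisible over `ℤ/2`.
    have hpow : ∀ (m : ℕ) (a : (singComplex X).X i), (-1 : ℤ) ^ m • a = a := by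
      intro m a
      have hn : -a = a := neg_eq_of_add_eq_zero_left (ZModModule.add_self a)
      rcases neg_one_pow_eq_or ℤ m with h | h <;> rw [h] <;> simp [hn]
    exact hpow _ _
  exact LinearMap.congr_fun this c

/-- The action of a continuous map on singular chains. -/
def scMap {X Y : Type*} [TopologicalSpace X] [TopologicalSpace Y] (g : C(X, Y)) (n : ℕ) :
    SC X n →ₗ[ZMod 2] SC Y n := Finsupp.lmapDomain _ _ fun σ => g.comp σ

@[simp]
lemma scMap_single {X Y : Type*} [TopologicalSpace X] [TopologicalSpace Y] (g : C(X, Y)) {n : ℕ}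
    (σ : C(Simp n, X)) : scMap g n (Finsupp.single σ 1) = Finsupp.single (g.comp σ) 1 := by
  simp [scMap]

lemma sbd_scMap {X Y : Type*} [TopologicalSpace X] [TopologicalSpace Y] (g : C(X, Y)) {n : ℕ}
    (c : SC X (n + 1)) : sbd (scMap g (n + 1) c) = scMap g n (sbd c) :=
  sumFaces_mapDomain (fun i (σ : C(Simp (n + 1), X)) => σ.comp (coface i))
    (fun i (σ : C(Simp (n + 1), Y)) => σ.comp (coface i)) _ _ (fun _ _ => rfl) c

lemma toSing_scMap {X Y : TopCat.{0}} (g : X ⟶ Y) {i : ℕ} (c : SC X (i + 1)) :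
    ((SSet.chainComplexMap (TopCat.toSSet.map g) (ModuleCat.of (ZMod 2) (ZMod 2))).f i).hom
      (toSing X i c) = toSing Y i (scMap g.hom (i + 1) c) := by
  have : ((SSet.chainComplexMap (TopCat.toSSet.map g)
      (ModuleCat.of (ZMod 2) (ZMod 2))).f i).hom ∘ₗ toSing X i =
      toSing Y i ∘ₗ scMap g.hom (i + 1) := by
    refine lin_ext fun σ => ?_
    rw [LinearMap.comp_apply, LinearMap.comp_apply, toSing_single, scMap_single, toSing_single]
    exact ConcreteCategory.congr_hom (SSet.ι_chainComplexMap_f _ _ (TopCat.toSSet.map g)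
      (ModuleCat.of (ZMod 2) (ZMod 2)) _) (1 : ZMod 2)
  exact LinearMap.congr_fun this c

/-- The differential of `singComplex` leaving degree `0` is zero, whereas `sbd` there is the
augmentation; this is the source of the alternative `i = 0`. -/
lemma sc_g_toSing_eq_zero_iff {X : TopCat.{0}} {i : ℕ} (c : SC X (i + 1)) :
    ((singComplex X).sc i).g.hom (toSing X i c) = 0 ↔ i = 0 ∨ sbd c = 0 := by
  rcases i with _ | i
  · have : ((singComplex X).sc 0).g = 0 :=
      (singComplex X).shape _ _ (by simp)
    rw [this]
    exact ⟨fun _ => Or.inl rfl, fun _ => rfl⟩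
  · have h : (ComplexShape.down ℕ).next (i + 1) = i := ChainComplex.next_nat_succ i
    have h2 : ((singComplex X).sc (i + 1)).g.hom (toSing X (i + 1) c) = 0 ↔
        ((singComplex X).d (i + 1) i).hom (toSing X (i + 1) c) = 0 := by
      change ((singComplex X).d (i + 1) ((ComplexShape.down ℕ).next (i + 1))).hom _ = 0 ↔ _
      rw [h]
    rw [h2, d_toSing, map_eq_zero_iff _ (toSing_injective X i)]
    simp

lemma exists_sc_f_eq_toSing_iff {X : TopCat.{0}} {i : ℕ} (c : SC X (i + 1)) :
    (∃ y, ((singComplex X).sc i).f.hom y = toSing X i c) ↔ ∃ w, sbd w = c := by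
  have h : (ComplexShape.down ℕ).prev i = i + 1 := ChainComplex.prev ℕ i
  have h2 : (∃ y, ((singComplex X).sc i).f.hom y = toSing X i c) ↔
      ∃ y, ((singComplex X).d (i + 1) i).hom y = toSing X i c := by
    change (∃ y, ((singComplex X).d ((ComplexShape.down ℕ).prev i) i).hom y = _) ↔ _
    rw [h]
  rw [h2]
  constructor
  · rintro ⟨y, hy⟩
    refine ⟨(ofSing X (i + 1)).hom y, toSing_injective X i ?_⟩
    rw [← d_toSing, toSing_ofSing, hy]
  · rintro ⟨w, rfl⟩
    exact ⟨_, d_toSing w⟩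

/-- Singular cycles, with the convention that all `0`-chains are cycles. -/
def singCycles (X : Type*) [TopologicalSpace X] (i : ℕ) : Submodule (ZMod 2) (SC X (i + 1)) where
  carrier := {c | i = 0 ∨ sbd c = 0}
  add_mem' := by
    rintro a b (h | ha) (h | hb)
    · exact Or.inl h
    · exact Or.inl h
    · exact Or.inl h
    · exact Or.inr (by rw [map_add, ha, hb, add_zero])
  zero_mem' := Or.inr (map_zero _)
  smul_mem' := by
    rintro a b (h | hb)
    · exact Or.inl h
    · exact Or.inr (by rw [map_smul, hb, smul_zero])

/-- Singular homology classes of cycles. -/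
theorem exists_homology_class (X : TopCat.{0}) (i : ℕ) :
    ∃ cls : singCycles X i →ₗ[ZMod 2] (homologyFunctor i).obj X,
      Function.Surjective cls ∧ ∀ c, cls c = 0 ↔ ∃ w, sbd w = (c : SC X (i + 1)) := by
  let f : singCycles X i →ₗ[ZMod 2] LinearMap.ker ((singComplex X).sc i).g.hom :=
    ((toSing X i).domRestrict _).codRestrict _ fun c => (sc_g_toSing_eq_zero_iff _).2 c.2
  let cls : singCycles X i →ₗ[ZMod 2] ((singComplex X).sc i).homology :=
    homologyClass _ ∘ₗ f
  refine ⟨cls, ?_, fun c => ?_⟩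
  · refine (homologyClass_surjective _).comp ?_
    rintro ⟨x, hx⟩
    have hx' : toSing X i ((ofSing X i).hom x) = x := toSing_ofSing x
    refine ⟨⟨(ofSing X i).hom x, (sc_g_toSing_eq_zero_iff _).1 ?_⟩, Subtype.ext hx'⟩
    rw [hx']; exact hx
  · exact (homologyClass_eq_zero_iff _ _).trans (exists_sc_f_eq_toSing_iff _)

/-- A cycle bounding in `Y` bounds in `X`, if the homology of `X` injects into that of `Y`. -/
theorem exists_sbd_eq_of_injective {X Y : TopCat.{0}} (g : X ⟶ Y) {i : ℕ}
    (hg : Function.Injective ((homologyFunctor i).map g)) {c : SC X (i + 1)}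
    (hc : i = 0 ∨ sbd c = 0) {w : SC Y (i + 2)} (hw : sbd w = scMap g.hom (i + 1) c) :
    ∃ w', sbd w' = c := by
  rw [← exists_sc_f_eq_toSing_iff]
  obtain ⟨y, hy⟩ := (exists_sc_f_eq_toSing_iff _).2 ⟨w, hw⟩
  refine exists_of_homologyMap_injective ((HomologicalComplex.shortComplexFunctor _ _ i).map
    (SSet.chainComplexMap (TopCat.toSSet.map g) (ModuleCat.of (ZMod 2) (ZMod 2)))) hg
    ((sc_g_toSing_eq_zero_iff c).2 hc) (y := y) ?_
  exact hy.trans (toSing_scMap g c).symm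

/-! ### Chains of a subspace as chains of the ambient space. -/

section Subspace

variable {E : Type} [TopologicalSpace E]

/-- The inclusion of a subspace. -/
abbrev subIncl (A : Set E) : C(A, E) := ⟨Subtype.val, continuous_subtype_val⟩

lemma scMap_subIncl_injective (A : Set E) (n : ℕ) : Function.Injective (scMap (subIncl A) n) := by
  refine Finsupp.mapDomain_injective fun σ τ h => ContinuousMap.ext fun x => Subtype.ext ?_
  exact DFunLike.congr_fun h x

lemma scMap_subIncl_mem {A : Set E} {n : ℕ} (c : SC A n) :
    scMap (subIncl A) n c ∈ chainsIn A n := by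
  refine map_mem_supported (P := Set.univ) _ (fun σ _ => ?_) (by simp)
  rw [scMap_single]
  exact Finsupp.single_mem_supported _ _ fun x => (σ x).2

lemma exists_scMap_subIncl_eq {A : Set E} {n : ℕ} {c : SC E n} (hc : c ∈ chainsIn A n) :
    ∃ c' : SC A n, scMap (subIncl A) n c' = c := by
  rw [chainsIn, Finsupp.supported_eq_span_single] at hc
  induction hc using Submodule.span_induction with
  | zero => exact ⟨0, map_zero _⟩
  | add x y _ _ hx hy =>
    obtain ⟨x', rfl⟩ := hx
    obtain ⟨y', rfl⟩ := hy
    exact ⟨x' + y', map_add _ _ _⟩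
  | smul a x _ hx =>
    obtain ⟨x', rfl⟩ := hx
    exact ⟨a • x', map_smul _ _ _⟩
  | mem x hx =>
    obtain ⟨σ, hσ, rfl⟩ := hx
    refine ⟨Finsupp.single ⟨fun x => ⟨σ x, hσ x⟩, by fun_prop⟩ 1, ?_⟩
    rw [scMap_single]; rfl

/-- A chain in a subspace, as a chain of the subspace. -/
def restrictChain (A : Set E) (n : ℕ) : chainsIn A n →ₗ[ZMod 2] SC A n :=
  (LinearEquiv.ofInjective _ (scMap_subIncl_injective A n)).symm.toLinearMap ∘ₗ
    Submodule.inclusion fun _ hc => exists_scMap_subIncl_eq hc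

lemma scMap_restrictChain {A : Set E} {n : ℕ} (c : chainsIn A n) :
    scMap (subIncl A) n (restrictChain A n c) = c := by
  have := (LinearEquiv.ofInjective _ (scMap_subIncl_injective A n)).apply_symm_apply
    (Submodule.inclusion (fun _ hc => exists_scMap_subIncl_eq hc) c)
  exact congrArg Subtype.val this

/-- If the homology of a subspace `A` injects into that of `X`, cycles of `A` bounding in `X` bound
in `A`. -/
theorem exists_sbd_eq_of_inclusion {A X : Set E} (h : A ⊆ X) {i : ℕ}
    (hinj : Function.Injective ((homologyFunctor i).map (inclusionMap h))) {c : SC E (i + 1)}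
    (hc : c ∈ chainsIn A (i + 1)) (hcyc : i = 0 ∨ sbd c = 0) {w : SC E (i + 2)}
    (hw : w ∈ chainsIn X (i + 2)) (hwc : sbd w = c) :
    ∃ y ∈ chainsIn A (i + 2), sbd y = c := by
  obtain ⟨c, rfl⟩ := exists_scMap_subIncl_eq hc
  obtain ⟨w, rfl⟩ := exists_scMap_subIncl_eq hw
  have hcomp : scMap (subIncl A) (i + 1) c =
      scMap (subIncl X) (i + 1) (scMap (inclusionMap h).hom (i + 1) c) := by
    have : scMap (subIncl A) (i + 1) =
        scMap (subIncl X) (i + 1) ∘ₗ scMap (inclusionMap h).hom (i + 1) := by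
      refine lin_ext fun σ => ?_
      rw [LinearMap.comp_apply, scMap_single, scMap_single, scMap_single]
      rfl
    exact LinearMap.congr_fun this c
  rw [sbd_scMap, hcomp] at hwc
  obtain ⟨y, hy⟩ := exists_sbd_eq_of_injective _ hinj (hcyc.imp_right fun h => by
    rw [sbd_scMap] at h
    exact scMap_subIncl_injective A i (h.trans (map_zero _).symm))
    (scMap_subIncl_injective X _ hwc)
  exact ⟨scMap (subIncl A) _ y, scMap_subIncl_mem y, by rw [sbd_scMap, hy]⟩

end Subspace

end Bridge

/-! ### Betti numbers -/

section Betti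

variable {V : Type*} [DecidableEq V]

lemma fd_mem_card {A : Set (Finset V)} {n : ℕ} {z : FC V} (hz : z ∈ chains A (n + 1)) :
    fd z ∈ chains Set.univ n := by
  refine fd_mem_chains (fun _ _ _ _ => Set.mem_univ _) (Finsupp.supported_mono ?_ hz)
  exact fun F hF => ⟨Set.mem_univ _, hF.2⟩

lemma ud_eq_fd {A : Set (Finset V)} {n : ℕ} {z : FC V} (hz : z ∈ chains A (n + 2)) :
    ud z = fd z := by
  rw [ud_apply]
  refine dropEmpty_of_mem (Finsupp.supported_mono ?_ (fd_mem_card hz))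
  rintro F ⟨-, hF⟩ rfl
  simp at hF

lemma ud_eq_zero_of_card_one {A : Set (Finset V)} {z : FC V} (hz : z ∈ chains A 1) :
    ud z = 0 := by
  rw [ud_apply]
  have h := fd_mem_card (n := 0) hz
  have h2 : dropEmpty (fd z) ∈ Finsupp.supported (ZMod 2) (ZMod 2) (∅ : Set (Finset V)) := by
    refine map_mem_supported dropEmpty (fun F hF => ?_) h
    rw [dropEmpty_single, if_pos (Finset.card_eq_zero.1 hF.2)]
    exact Submodule.zero_mem _
  rw [Finsupp.supported_empty] at h2
  exact (Submodule.mem_bot _).1 h2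

lemma ud_eq_zero_iff {A : Set (Finset V)} {i : ℕ} {z : FC V} (hz : z ∈ chains A (i + 1)) :
    ud z = 0 ↔ i = 0 ∨ fd z = 0 := by
  rcases i with _ | i
  · simp [ud_eq_zero_of_card_one hz]
  · rw [ud_eq_fd hz]; simp

variable {E : Type} [NormedAddCommGroup E] [NormedSpace ℝ E]
  {K : Geometry.SimplicialComplex ℝ E}

lemma chains_toFinset (hfin : K.faces.Finite) (n : ℕ) :
    chains (hfin.toFinset : Set (Finset E)) (n + 1) = chains (facesIn K Set.univ) (n + 1) := by
  refine congrArg _ (Set.ext fun F => ?_)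
  simp only [facesIn, Set.mem_ofPred_eq, Set.Finite.coe_toFinset, Set.subset_univ, and_true]
  constructor
  · exact fun h => ⟨Or.inr h.1, h.2⟩
  · rintro ⟨rfl | h, h2⟩
    · simp at h2
    · exact ⟨h, h2⟩

variable [DecidableEq E]

lemma realize_toTuples_mem {W : Set E} {n : ℕ} {z : FC E}
    (hz : z ∈ chains (facesIn K W) (n + 1)) {U : Set E}
    (hU : ∀ F ∈ K.faces, (F : Set E) ⊆ W → convexHull ℝ (F : Set E) ⊆ U) :
    realize (n + 1) (toTuples (n + 1) z) ∈ chainsIn U (n + 1) := by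
  change (realize (n + 1) ∘ₗ toTuples (n + 1)) z ∈ _
  refine map_mem_supported _ (fun F hF => ?_) hz
  have hFK : F ∈ K.faces ∧ (F : Set E) ⊆ W := by
    refine hF.1.resolve_left ?_
    rintro rfl
    simpa using hF.2
  refine realize_mem (toTuples_mem _ F) fun t ht => ?_
  exact (convexHull_mono (Set.range_subset_iff.2 ht)).trans (hU F hFK.1 hFK.2)

/-- Sending a simplicial cycle to the class of its realization is onto by `exists_simplicial_cycle`.
Its kernel consists of the simplicial boundaries, by `exists_fd_eq_of_sbd_eq` with all vertices
allowed. The formula is then rank-nullity for this map and for `ud`. -/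
theorem finrank_homology (hfin : K.faces.Finite) (i : ℕ) :
    Module.finrank (ZMod 2) ((homologyFunctor i).obj (TopCat.of K.space)) +
      bdRank ud hfin.toFinset (i + 1) + bdRank ud hfin.toFinset (i + 2) =
      (hfin.toFinset.filter fun F => F.card = i + 1).card := by
  obtain ⟨cls, hsurj, hker⟩ := exists_homology_class (TopCat.of K.space) i
  set A := hfin.toFinset with hA
  set C := chains (A : Set (Finset E)) (i + 1) with hC
  have : FiniteDimensional (ZMod 2) C := by rw [hC, mem_chains_coe]; infer_instance
  set g : C →ₗ[ZMod 2] FC E := ud.domRestrict C with hg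
  have hKU : ∀ F ∈ K.faces, (F : Set E) ⊆ Set.univ → convexHull ℝ (F : Set E) ⊆ K.space :=
    fun F hF _ => K.convexHull_subset_space hF
  let r : LinearMap.ker g →ₗ[ZMod 2] chainsIn K.space (i + 1) :=
    ((realize (i + 1) ∘ₗ toTuples (i + 1)) ∘ₗ C.subtype ∘ₗ (LinearMap.ker g).subtype).codRestrict _
      fun z => realize_toTuples_mem (by rw [← chains_toFinset hfin]; exact z.1.2) hKU
  have hr : ∀ z, (r z : SC E (i + 1)) = realize (i + 1) (toTuples (i + 1) (z.1 : FC E)) :=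
    fun z => rfl
  let s : LinearMap.ker g →ₗ[ZMod 2] singCycles K.space i :=
    (restrictChain K.space (i + 1) ∘ₗ r).codRestrict _ fun z => by
      refine ((ud_eq_zero_iff z.1.2).1 z.2).imp_right fun h => ?_
      apply scMap_subIncl_injective K.space i
      rw [← sbd_scMap, LinearMap.comp_apply, scMap_restrictChain, hr, sbd_realize, bd_toTuples, h,
        map_zero, map_zero, map_zero]
  have hs : ∀ z, scMap (subIncl K.space) (i + 1) (s z : SC K.space (i + 1)) =
      realize (i + 1) (toTuples (i + 1) (z.1 : FC E)) := fun z => scMap_restrictChain (r z)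
  let ψ := cls ∘ₗ s
  have hψsurj : Function.Surjective ψ := by
    intro a
    obtain ⟨⟨y, hy⟩, rfl⟩ := hsurj a
    obtain ⟨z, hz, hzcyc, w, hw, hwz⟩ := exists_simplicial_cycle hfin
      (scMap_subIncl_mem y) (hy.imp_right fun h => by rw [sbd_scMap, h, map_zero])
    rw [← chains_toFinset hfin] at hz
    refine ⟨⟨⟨z, hz⟩, (ud_eq_zero_iff hz).2 hzcyc⟩, ?_⟩
    obtain ⟨w, rfl⟩ := exists_scMap_subIncl_eq hw
    rw [LinearMap.comp_apply, ← sub_eq_zero, ← map_sub, hker]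
    refine ⟨w, scMap_subIncl_injective K.space (i + 1) ?_⟩
    rw [← sbd_scMap, hwz, Submodule.coe_sub, map_sub, hs, ZModModule.sub_eq_add]
    exact add_comm _ _
  have hψker : (LinearMap.ker ψ).map (C.subtype ∘ₗ (LinearMap.ker g).subtype) =
      (chains (A : Set (Finset E)) (i + 2)).map ud := by
    ext z
    constructor
    · rintro ⟨z, hz, rfl⟩
      obtain ⟨w, hw⟩ := (hker _).1 (LinearMap.mem_ker.1 hz)
      have hwz : sbd (scMap (subIncl K.space) (i + 2) w) =
          realize (i + 1) (toTuples (i + 1) (z.1 : FC E)) := by rw [sbd_scMap, hw, hs]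
      obtain ⟨z', hz', hd⟩ := exists_fd_eq_of_sbd_eq hfin (W := Set.univ) subset_rfl
        (fun x hx => by
          obtain ⟨σ, hσ, _, hmin⟩ := exists_carrier hx
          obtain ⟨v, hv⟩ := K.nonempty_of_mem_faces hσ
          exact ⟨v, Set.mem_univ v, fun τ hτ hxτ => hmin τ hτ hxτ hv⟩)
        (by rw [← chains_toFinset hfin]; exact z.1.2) (scMap_subIncl_mem w) hwz
      rw [← chains_toFinset hfin] at hz'
      exact ⟨z', hz', (ud_eq_fd hz').trans hd⟩
    · rintro ⟨z', hz', rfl⟩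
      have hd : ud z' ∈ C := by
        rw [ud_eq_fd hz', hC, chains_toFinset hfin]
        rw [SetLike.mem_coe, chains_toFinset hfin] at hz'
        exact fd_mem_chains (isLowerSet_facesIn _) hz'
      refine ⟨⟨⟨ud z', hd⟩, ud_ud z'⟩, ?_, rfl⟩
      rw [SetLike.mem_coe, LinearMap.mem_ker, LinearMap.comp_apply, hker]
      have hz'' := hz'
      rw [SetLike.mem_coe, chains_toFinset hfin] at hz''
      obtain ⟨w, hw⟩ := exists_scMap_subIncl_eq (realize_toTuples_mem hz'' hKU)
      refine ⟨w, scMap_subIncl_injective K.space (i + 1) ?_⟩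
      rw [← sbd_scMap, hw, hs, sbd_realize, bd_toTuples]
      exact congrArg (fun c => realize (i + 1) (toTuples (i + 1) c)) (ud_eq_fd hz').symm
  have h1 := LinearMap.finrank_range_add_finrank_ker g
  have h2 := LinearMap.finrank_range_add_finrank_ker ψ
  have h3 : Module.finrank (ZMod 2) (LinearMap.range g) = bdRank ud A (i + 1) := by
    rw [hg, LinearMap.range_domRestrict]; rfl
  have h4 : Module.finrank (ZMod 2) (LinearMap.ker ψ) = bdRank ud A (i + 2) := by
    rw [bdRank, ← hψker]
    refine (LinearEquiv.finrank_eq (Submodule.equivMapOfInjective _ ?_ _))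
    exact C.injective_subtype.comp (LinearMap.ker g).injective_subtype
  have h5 : Module.finrank (ZMod 2) C = (A.filter fun F => F.card = i + 1).card := by
    rw [hC, mem_chains_coe, finrank_supported]
  rw [LinearMap.range_eq_top.2 hψsurj, finrank_top] at h2
  rw [h3, h5] at h1
  rw [h4] at h2
  omega

end Betti

/-! ### Brouwer's fixed point theorem -/

section Brouwer

lemma bd_sd_iterate {V : Type*} (b : ∀ n, (Fin (n + 1) → V) → V) (n m : ℕ) (x : Ch V (n + 1)) :
    bd ((sd b (n + 1))^[m] x) = (sd b n)^[m] (bd x) := by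
  induction m with
  | zero => rfl
  | succ m ih => rw [Function.iterate_succ_apply', bd_sd, ih, Function.iterate_succ_apply']

/-- Sperner's lemma, for the iterated barycentric subdivisions of the standard simplex. -/
lemma exists_rainbow {N : ℕ} (l : Simp N → Fin N) (hl : ∀ x : Simp N, x.1 (l x) ≠ 0) {δ : ℝ}
    (hδ : 0 < δ) : ∃ u : Fin N → Simp N, (∀ i j, dist (u i) (u j) < δ) ∧
      ∀ i, ∃ j, l (u j) = i := by
  have hC := convex_stdSimplex ℝ (Fin N)
  have hD : ∀ i j, dist (verts N i).1 (verts N j).1 ≤ 2 := by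
    intro i j
    have h1 := stdSimplex_subset_closedBall (verts N i).2
    have h2 := stdSimplex_subset_closedBall (verts N j).2
    rw [Metric.mem_closedBall] at h1 h2
    linarith [dist_triangle_right (verts N i).1 (verts N j).1 0]
  obtain ⟨M, hM⟩ := exists_pow_mul_lt N 2 hδ
  let S : ∀ n, Ch (Simp N) n →ₗ[ZMod 2] Ch (Simp N) n := fun n => sd (bary hC) n ^ M
  have hS : ∀ n x, S n x = (sd (bary hC) n)^[M] x := fun n x => (iterate_eq_pow _ _ _).symm
  have hbdS : ∀ n x, bd (S (n + 1) x) = S n (bd x) := by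
    intro n x
    rw [hS, hS, bd_sd_iterate]
  -- By `hl`, points of the face `F` have labels in `F`, so this chain map is carried by faces and
  -- fixes the full simplex. Without a rainbow simplex, its value on the full simplex could not
  -- involve `Finset.univ`.
  let f : ℕ → FC (Fin N) →ₗ[ZMod 2] FC (Fin N) := fun n =>
    toSets n ∘ₗ chMap l n ∘ₗ S n ∘ₗ chMap (verts N) n ∘ₗ toTuples n
  have hf : ∀ n x, f n x = toSets n (chMap l n (S n (chMap (verts N) n (toTuples n x)))) :=
    fun n x => rfl
  have key := eq_single_of_carried f Set.univ (fun _ _ _ _ => Set.mem_univ _) (by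
      have h0 : S 0 = LinearMap.id := by
        change LinearMap.id ^ M = LinearMap.id
        exact one_pow M
      rw [hf, h0, toTuples_zero_single, if_pos rfl, chMap_single, LinearMap.id_apply, chMap_single,
        toSets_single]
      simp) (fun n x => by rw [hf, hf, fd_toSets, bd_chMap, hbdS, bd_chMap, bd_toTuples])
    (fun F _ => by
      rw [hf]
      have h1 : chMap (verts N) F.card (toTuples F.card (Finsupp.single F 1)) ∈
          Finsupp.supported (ZMod 2) (ZMod 2)
            {u : Fin F.card → Simp N | ∀ j, ∀ i ∉ F, (u j).1 i = 0} := by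
        refine map_mem_supported _ (fun t ht => ?_) (toTuples_mem _ F)
        rw [chMap_single]
        refine Finsupp.single_mem_supported _ _ fun j i hi => ?_
        simp only [Function.comp_apply, verts]
        exact Pi.single_eq_of_ne (fun h => hi (by rw [h]; exact ht j)) _
      have h2 : S F.card (chMap (verts N) F.card (toTuples F.card (Finsupp.single F 1))) ∈
          Finsupp.supported (ZMod 2) (ZMod 2)
            {u : Fin F.card → Simp N | ∀ j, ∀ i ∉ F, (u j).1 i = 0} := by
        refine map_mem_supported _ (fun u hu => ?_) h1
        rw [hS]
        refine Finsupp.supported_mono ?_ (sd_iterate_mem_convexHull hC u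
          (C := {x | ∀ i ∉ F, x i = 0}) ?_ hu M)
        · exact fun u hu => hu
        · intro x hx y hy a b _ _ _ i hi
          simp [hx i hi, hy i hi]
      have h3 : chMap l F.card (S F.card (chMap (verts N) F.card
          (toTuples F.card (Finsupp.single F 1)))) ∈
          Finsupp.supported (ZMod 2) (ZMod 2) {u | ∀ j, u j ∈ (F : Set (Fin N))} := by
        refine map_mem_supported _ (fun u hu => ?_) h2
        rw [chMap_single]
        refine Finsupp.single_mem_supported _ _ fun j => ?_
        by_contra hj
        exact hl (u j) (hu j _ hj)
      refine Finsupp.supported_mono ?_ (toSets_mem h3)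
      exact fun G hG => ⟨Finset.coe_subset.1 hG.1, hG.2⟩) (Set.mem_univ Finset.univ)
  rw [Finset.card_fin] at key
  by_contra hcon
  push Not at hcon
  have h1 : S N (chMap (verts N) N (toTuples N (Finsupp.single Finset.univ 1))) ∈
      Finsupp.supported (ZMod 2) (ZMod 2) {u : Fin N → Simp N | ∀ i j, dist (u i) (u j) < δ} := by
    refine map_mem_supported (S N) (P := {u | ∃ t, u = verts N ∘ t}) ?_
      (map_mem_supported (P := Set.univ) _ (fun t _ => ?_) (by simp))
    · rintro _ ⟨t, rfl⟩
      rw [hS]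
      refine Finsupp.supported_mono ?_
        (sd_iterate_mesh hC (verts N ∘ t) (fun i j => hD (t i) (t j)) M)
      exact fun u hu i j => (hu i j).trans_lt (hM M le_rfl)
    · rw [chMap_single]
      exact Finsupp.single_mem_supported _ _ ⟨t, rfl⟩
  have h2 : f N (Finsupp.single Finset.univ 1) ∈
      Finsupp.supported (ZMod 2) (ZMod 2) {G : Finset (Fin N) | G ≠ Finset.univ} := by
    rw [hf]
    change (toSets N ∘ₗ chMap l N) _ ∈ _
    refine map_mem_supported _ (fun u hu => ?_) h1
    obtain ⟨i, hi⟩ := hcon u hu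
    rw [LinearMap.comp_apply, chMap_single]
    have h3 : Finsupp.single (l ∘ u) (1 : ZMod 2) ∈
        Finsupp.supported (ZMod 2) (ZMod 2) {t : Fin N → Fin N | ∀ j, t j ∈ ({i}ᶜ : Set (Fin N))} :=
      Finsupp.single_mem_supported _ _ fun j => hi j
    refine Finsupp.supported_mono ?_ (toSets_mem h3)
    rintro G ⟨hG, -⟩ rfl
    exact hG (Finset.mem_coe.2 (Finset.mem_univ i)) rfl
  rw [key] at h2
  exact h2 (by simp) rfl

/-- Brouwer's fixed point theorem for the standard simplex. -/
theorem brouwer_stdSimplex {N : ℕ} (f : C(Simp (N + 1), Simp (N + 1))) : ∃ x, f x = x := by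
  by_contra hcon
  push Not at hcon
  have hlt : ∀ x y : Simp (N + 1), x ≠ y → ∃ i, y.1 i < x.1 i := by
    intro x y hxy
    by_contra h
    push Not at h
    refine hxy (Subtype.ext (funext fun i => ?_))
    refine (Finset.sum_eq_sum_iff_of_le fun i _ => h i).1 ?_ i (Finset.mem_univ i)
    rw [x.2.2, y.2.2]
  -- Label `x` by a coordinate that `f` strictly decreases. That coordinate is positive at `x`, as
  -- Sperner's lemma requires.
  choose l hl using fun x => hlt x (f x) (hcon x).symm
  let g : Simp (N + 1) → Fin (N + 1) → ℝ := fun x => (f x).1 - x.1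
  have hg : Continuous g :=
    (continuous_subtype_val.comp f.continuous).sub continuous_subtype_val
  have hg0 : ∀ x, g x ≠ 0 := fun x h => hcon x (Subtype.ext (sub_eq_zero.1 h))
  -- The largest increase of a coordinate, bounded below by `h x₀ > 0`. In a small rainbow simplex
  -- some coordinate increases by at least that much at one vertex and decreases at another, against
  -- uniform continuity.
  let h : Simp (N + 1) → ℝ := fun x => Finset.univ.sup' Finset.univ_nonempty (g x)
  have hh : Continuous h := Continuous.finset_sup'_apply _ fun i _ => (continuous_apply i).comp hg
  obtain ⟨x₀, -, hx₀⟩ := isCompact_univ.exists_isMinOn (Set.univ_nonempty (α := Simp (N + 1)))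
    hh.continuousOn
  have hpos : 0 < h x₀ := by
    obtain ⟨i, hi⟩ := hlt (f x₀) x₀ (hcon x₀)
    exact (sub_pos.2 hi).trans_le (Finset.le_sup' (g x₀) (Finset.mem_univ i))
  obtain ⟨δ, hδ, hgδ⟩ := Metric.uniformContinuous_iff.1
    (CompactSpace.uniformContinuous_of_continuous hg) (h x₀) hpos
  obtain ⟨u, hu, hrain⟩ := exists_rainbow l (fun x => by
    have h1 := hl x
    have h2 := (f x).2.1 (l x)
    exact (h2.trans_lt h1).ne') hδ
  obtain ⟨i, -, hi⟩ := Finset.exists_mem_eq_sup' Finset.univ_nonempty (g (u 0))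
  obtain ⟨j, hj⟩ := hrain i
  have h1 : h x₀ ≤ g (u 0) i := by rw [← hi]; exact hx₀ (Set.mem_univ _)
  have h2 : g (u j) i < 0 := by
    have := hl (u j)
    rw [hj] at this
    exact sub_neg.2 this
  have h3 := (dist_le_pi_dist (g (u 0)) (g (u j)) i).trans_lt (hgδ (hu 0 j))
  rw [Real.dist_eq] at h3
  linarith [le_abs_self (g (u 0) i - g (u j) i)]

/-- A simplex in `ℝⁿ` with the origin in its interior. -/
def bigSimplex (n : ℕ) : Set (Fin n → ℝ) := {y | (∀ i, -1 ≤ y i) ∧ ∑ i, y i ≤ 1}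

lemma isCompact_bigSimplex (n : ℕ) : IsCompact (bigSimplex n) := by
  refine Metric.isCompact_of_isClosed_isBounded ?_ ?_
  · have h : bigSimplex n = (⋂ i, {y | -1 ≤ y i}) ∩ {y | ∑ i, y i ≤ 1} := by
      ext y; simp [bigSimplex]
    rw [h]
    exact (isClosed_iInter fun i => isClosed_le (by fun_prop) (by fun_prop)).inter
      (isClosed_le (by fun_prop) (by fun_prop))
  · refine (Metric.isBounded_Icc (fun _ : Fin n => (-1 : ℝ)) fun _ => (n + 1 : ℝ)).subset ?_
    rintro y ⟨h1, h2⟩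
    refine ⟨h1, fun i => ?_⟩
    have h3 : ∑ j ∈ Finset.univ.erase i, (-1 : ℝ) ≤ ∑ j ∈ Finset.univ.erase i, y j :=
      Finset.sum_le_sum fun j _ => h1 j
    rw [← Finset.add_sum_erase _ _ (Finset.mem_univ i)] at h2
    rw [Finset.sum_const, Finset.card_erase_of_mem (Finset.mem_univ i), nsmul_eq_mul,
      Finset.card_fin] at h3
    have h4 : ((n - 1 : ℕ) : ℝ) ≤ n := by exact_mod_cast Nat.sub_le n 1
    simp only
    linarith

lemma mem_bigSimplex_of_norm_le {n : ℕ} {y : Fin n → ℝ} (hy : ‖y‖ ≤ 1 / (n + 1)) :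
    y ∈ bigSimplex n := by
  have h0 : (1 / (n + 1) : ℝ) ≤ 1 := by
    rw [div_le_one (by positivity)]; linarith [Nat.cast_nonneg (α := ℝ) n]
  have h1 : ∀ i, |y i| ≤ 1 / (n + 1) := fun i => (norm_le_pi_norm y i).trans hy
  refine ⟨fun i => by linarith [neg_abs_le (y i), h1 i], ?_⟩
  calc ∑ i, y i ≤ ∑ _i : Fin n, (1 / (n + 1) : ℝ) :=
        Finset.sum_le_sum fun i _ => (le_abs_self _).trans (h1 i)
    _ = n / (n + 1) := by simp; ring
    _ ≤ 1 := by rw [div_le_one (by positivity)]; linarith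

/-- Brouwer's fixed point theorem for `bigSimplex`. -/
theorem brouwer_bigSimplex {n : ℕ} {g : (Fin n → ℝ) → Fin n → ℝ}
    (hg : ContinuousOn g (bigSimplex n)) (hmaps : Set.MapsTo g (bigSimplex n) (bigSimplex n)) :
    ∃ x ∈ bigSimplex n, g x = x := by
  have hn : (0 : ℝ) < n + 1 := by positivity
  -- `a` forgets the last barycentric coordinate and rescales; `b` recovers that coordinate from the
  -- sum of the others.
  let a : (Fin (n + 1) → ℝ) → Fin n → ℝ := fun x i => (n + 1) * x i.castSucc - 1
  let b : (Fin n → ℝ) → Fin (n + 1) → ℝ := fun y =>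
    Fin.snoc (fun i => (y i + 1) / (n + 1)) ((1 - ∑ i, y i) / (n + 1))
  have ha : ∀ x ∈ stdSimplex ℝ (Fin (n + 1)), a x ∈ bigSimplex n := by
    rintro x ⟨h1, h2⟩
    refine ⟨fun i => ?_, ?_⟩
    · have := mul_nonneg hn.le (h1 i.castSucc)
      simp only [a]; linarith
    · rw [Fin.sum_univ_castSucc] at h2
      simp only [a, Finset.sum_sub_distrib, ← Finset.mul_sum, Finset.sum_const, Finset.card_fin,
        nsmul_eq_mul, mul_one]
      have h3 : ∑ i : Fin n, x i.castSucc ≤ 1 := by linarith [h1 (Fin.last n)]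
      have := mul_le_mul_of_nonneg_left h3 hn.le
      linarith
  have hb : ∀ y ∈ bigSimplex n, b y ∈ stdSimplex ℝ (Fin (n + 1)) := by
    rintro y ⟨h1, h2⟩
    refine ⟨fun i => ?_, ?_⟩
    · refine Fin.lastCases ?_ (fun i => ?_) i
      · simp only [b, Fin.snoc_last]
        exact div_nonneg (by linarith) hn.le
      · simp only [b, Fin.snoc_castSucc]
        exact div_nonneg (by linarith [h1 i]) hn.le
    · rw [Fin.sum_univ_castSucc]
      simp only [b, Fin.snoc_last, Fin.snoc_castSucc]
      rw [← Finset.sum_div, Finset.sum_add_distrib, ← add_div]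
      simp only [Finset.sum_const, Finset.card_fin, nsmul_eq_mul, mul_one]
      rw [div_eq_one_iff_eq hn.ne']
      ring
  have hab : ∀ y, a (b y) = y := by
    intro y
    funext i
    simp only [a, b, Fin.snoc_castSucc]
    field_simp
    ring
  have hac : Continuous a := by fun_prop
  have hbc : Continuous b := by
    refine continuous_pi fun i => ?_
    refine Fin.lastCases ?_ (fun i => ?_) i
    · simp only [b, Fin.snoc_last]; fun_prop
    · simp only [b, Fin.snoc_castSucc]; fun_prop
  let F : C(Simp (n + 1), Simp (n + 1)) :=
    ⟨fun x => ⟨b (g (a x.1)), hb _ (hmaps (ha _ x.2))⟩, by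
      refine Continuous.subtype_mk (hbc.comp ?_) _
      exact hg.comp_continuous (hac.comp continuous_subtype_val) fun x => ha _ x.2⟩
  obtain ⟨x, hx⟩ := brouwer_stdSimplex F
  refine ⟨a x.1, ha _ x.2, ?_⟩
  have := congrArg (fun z : Simp (n + 1) => a z.1) hx
  simpa only [F, ContinuousMap.coe_mk, hab] using this

end Brouwer

/-! ### Invariance of domain -/

section InvarianceOfDomain

open MeasureTheory in
/-- Smooth approximations on a compact set may be chosen to avoid the origin on a sphere. -/
lemma exists_approx_ne_zero {n : ℕ} (G : C(Fin n → ℝ, Fin n → ℝ)) {Q : Set (Fin n → ℝ)}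
    (hQ : IsCompact Q) {ε δ : ℝ} (hε : 0 < ε) (hδ : 0 < δ) :
    ∃ P : (Fin n → ℝ) → Fin n → ℝ, Continuous P ∧ (∀ x ∈ Q, dist (P x) (G x) < δ) ∧
      ∀ x, ‖x‖ = ε → P x ≠ 0 := by
  obtain ⟨P, hP, hPG⟩ : ∃ P : (Fin n → ℝ) → Fin n → ℝ, Differentiable ℝ P ∧
      ∀ x ∈ Q, dist (P x) (G x) < δ / 2 := by
    have h := ContinuousMap.dense_setOfPred_contDiff G
    rw [mem_closure_iff_nhds_basis
      (nhds_basis_uniformity Metric.uniformity_basis_dist.compactConvergenceUniformity)] at h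
    obtain ⟨P, hP, hPG⟩ := h (Q, δ / 2) ⟨hQ, half_pos hδ⟩
    have hP' : ContDiff ℝ ((⊤ : ℕ∞) : WithTop ℕ∞) P := hP
    exact ⟨P, hP'.differentiable (by simp), hPG⟩
  -- A differentiable map sends the null sphere to a null set, so an arbitrarily small translation
  -- moves its image off the origin.
  have hnull : volume (P '' Metric.sphere 0 ε) = 0 :=
    addHaar_image_eq_zero_of_differentiableOn_of_addHaar_eq_zero volume
      hP.differentiableOn (Measure.addHaar_sphere_of_ne_zero _ _ hε.ne')
  obtain ⟨v, hv, hvP⟩ : ∃ v ∈ Metric.ball (0 : Fin n → ℝ) (δ / 2), v ∉ P '' Metric.sphere 0 ε := by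
    by_contra hcon
    push Not at hcon
    have h1 := measure_mono_null hcon hnull
    exact (Metric.measure_ball_pos volume (0 : Fin n → ℝ) (half_pos hδ)).ne' h1
  refine ⟨fun x => P x - v, hP.continuous.sub continuous_const, fun x hx => ?_, fun x hx h => ?_⟩
  · rw [mem_ball_zero_iff] at hv
    have h1 := hPG x hx
    rw [dist_eq_norm] at h1 ⊢
    calc ‖P x - v - G x‖ = ‖(P x - G x) - v‖ := by congr 1; abel
      _ ≤ ‖P x - G x‖ + ‖v‖ := norm_sub_le _ _
      _ < δ := by linarith
  · exact hvP ⟨x, by simpa using hx, sub_eq_zero.1 h⟩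

/-- Invariance of domain, for a simplex about the origin. -/
theorem image_bigSimplex_mem_nhds {n : ℕ} {f : (Fin n → ℝ) → Fin n → ℝ}
    (hf : ContinuousOn f (bigSimplex n)) (hinj : Set.InjOn f (bigSimplex n)) :
    f '' bigSimplex n ∈ nhds (f 0) := by
  set S := bigSimplex n with hS
  have hSc : IsCompact S := isCompact_bigSimplex n
  have h0S : (0 : Fin n → ℝ) ∈ S := mem_bigSimplex_of_norm_le (by rw [norm_zero]; positivity)
  by_contra hcon
  have : CompactSpace S := isCompact_iff_compactSpace.1 hSc
  -- The inverse of `f`, continuous by compactness, extended to all of `ℝⁿ` by Tietze's theorem.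
  obtain ⟨G, hG⟩ : ∃ G : C(Fin n → ℝ, Fin n → ℝ), ∀ s ∈ S, G (f s) = s := by
    have he : Topology.IsClosedEmbedding (S.domRestrict f) :=
      Continuous.isClosedEmbedding (continuousOn_iff_continuous_domRestrict.1 hf)
        (Set.injOn_iff_injective.1 hinj)
    obtain ⟨G, hG⟩ := ContinuousMap.exists_extension' he
      (⟨Subtype.val, continuous_subtype_val⟩ : C(S, Fin n → ℝ))
    exact ⟨G, fun s hs => congrFun hG ⟨s, hs⟩⟩
  set r : ℝ := 1 / (n + 1) with hr
  have hr0 : 0 < r := by positivity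
  obtain ⟨ε, hε, hGε⟩ := Metric.continuousAt_iff.1 (G.continuous.continuousAt (x := f 0)) (r / 4)
    (by positivity)
  -- A point near `f 0` missed by the image, made the origin by translation below. `r` is the radius
  -- of a ball inside the simplex, and `G` stays below `r / 4` in norm on the `ε`-ball about `f 0`.
  obtain ⟨c, hc, hcS⟩ : ∃ c, dist c (f 0) < ε / 2 ∧ c ∉ f '' S := by
    by_contra h
    push Not at h
    exact hcon (Filter.mem_of_superset (Metric.ball_mem_nhds (f 0) (half_pos hε)) fun c hc => h c hc)
  set e := ε / 2 with he
  have he0 : 0 < e := half_pos hε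
  let f' : (Fin n → ℝ) → Fin n → ℝ := fun s => f s - c
  have hf' : ContinuousOn f' S := hf.sub continuousOn_const
  let G' : C(Fin n → ℝ, Fin n → ℝ) := G.comp ⟨fun y => y + c, by fun_prop⟩
  have hG' : ∀ s ∈ S, G' (f' s) = s := fun s hs => by
    simp only [G', f', ContinuousMap.comp_apply, ContinuousMap.coe_mk, sub_add_cancel, hG s hs]
  have hne : ∀ s ∈ S, f' s ≠ 0 := fun s hs h => hcS ⟨s, hs, sub_eq_zero.1 h⟩
  have hf0 : ‖f' 0‖ < e := by rw [dist_comm, dist_eq_norm] at hc; exact hc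
  have hsmall : ∀ y, ‖y‖ ≤ e → ‖G' y‖ < r / 4 := by
    intro y hy
    have h1 : dist (y + c) (f 0) < ε := by
      calc dist (y + c) (f 0) ≤ dist (y + c) c + dist c (f 0) := dist_triangle _ _ _
        _ = ‖y‖ + dist c (f 0) := by rw [dist_eq_norm, add_sub_cancel_right]
        _ < ε := by rw [he] at hy; linarith
    have h2 := hGε h1
    rwa [hG 0 h0S, dist_zero_right] at h2
  set T := f' '' S ∩ {y | e ≤ ‖y‖} with hT
  have hTc : IsCompact T :=
    (hSc.image_of_continuousOn hf').inter_right (isClosed_le continuous_const continuous_norm)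
  have hTG : ∀ y ∈ T, 0 < ‖G' y‖ := by
    rintro _ ⟨⟨s, hs, rfl⟩, hy⟩
    rw [hG' s hs, norm_pos_iff]
    rintro rfl
    exact absurd hf0 (not_lt.2 hy)
  obtain ⟨δ, hδ, hδr, hδT⟩ : ∃ δ > 0, δ ≤ r / 4 ∧ ∀ y ∈ T, δ ≤ ‖G' y‖ := by
    rcases T.eq_empty_or_nonempty with hE | hE
    · exact ⟨r / 4, by positivity, le_rfl, by simp [hE]⟩
    · obtain ⟨y, hy, hmin⟩ := hTc.exists_isMinOn hE
        (continuous_norm.comp G'.continuous).continuousOn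
      exact ⟨min (r / 4) ‖G' y‖, lt_min (by positivity) (hTG y hy), min_le_left _ _,
        fun z hz => (min_le_right _ _).trans (hmin hz)⟩
  obtain ⟨P, hPc, hP, hP0⟩ := exists_approx_ne_zero G'
    (hTc.union (isCompact_sphere (0 : Fin n → ℝ) e)) he0 hδ
  have hPT : ∀ y ∈ T, P y ≠ 0 := by
    intro y hy h
    have := hP y (Or.inl hy)
    rw [h, dist_zero_left] at this
    exact absurd (hδT y hy) (not_le.2 this)
  -- `Φ` pushes the ball of radius `e`, minus its center, radially to the sphere and fixes the
  -- outside. As `f'` misses the center, `Φ ∘ f'` is continuous on `S` with values in `T` or on the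
  -- sphere, where `P` has no zeros.
  let Φ : (Fin n → ℝ) → Fin n → ℝ := fun y => max (e / ‖y‖) 1 • y
  have hΦ1 : ∀ y, e ≤ ‖y‖ → Φ y = y := by
    intro y hy
    have : e / ‖y‖ ≤ 1 := (div_le_one (he0.trans_le hy)).2 hy
    simp only [Φ, max_eq_right this, one_smul]
  have hΦ2 : ∀ y, y ≠ 0 → ‖y‖ ≤ e → ‖Φ y‖ = e := by
    intro y hy0 hy
    have hy0' := norm_pos_iff.2 hy0
    have : 1 ≤ e / ‖y‖ := (one_le_div hy0').2 hy
    simp only [Φ, max_eq_left this]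
    rw [norm_smul, Real.norm_eq_abs, abs_of_pos (div_pos he0 hy0'), div_mul_cancel₀ _ hy0'.ne']
  have hcont : ContinuousOn (fun s => s - P (Φ (f' s))) S := by
    refine continuousOn_id.sub (hPc.comp_continuousOn ?_)
    have h1 : ContinuousOn (fun s => e / ‖f' s‖) S :=
      continuousOn_const.div hf'.norm fun s hs => norm_ne_zero_iff.2 (hne s hs)
    exact ContinuousOn.smul (h1.sup continuousOn_const) hf'
  -- A fixed point of `s - P (Φ (f' s))` is a zero of `P ∘ Φ ∘ f'`. The map stays in the ball of
  -- radius `r`: outside radius `e`, `P` is within `δ` of `G' (f' s) = s`; inside, both terms are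
  -- small by the choice of `ε`.
  obtain ⟨s, hs, hfix⟩ := brouwer_bigSimplex hcont (by
    intro s hs
    refine mem_bigSimplex_of_norm_le ?_
    rw [← hr]
    change ‖s - P (Φ (f' s))‖ ≤ r
    have hs' := hG' s hs
    rcases le_total e ‖f' s‖ with h | h
    · have h1 := hP (f' s) (Or.inl ⟨⟨s, hs, rfl⟩, h⟩)
      rw [hs', dist_comm, dist_eq_norm] at h1
      rw [hΦ1 _ h]
      linarith
    · have h1 := hΦ2 _ (hne s hs) h
      have h2 := hP (Φ (f' s)) (Or.inr (by simpa using h1))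
      have h3 := hsmall _ h
      have h4 := hsmall _ h1.le
      rw [hs'] at h3
      rw [dist_eq_norm] at h2
      have h5 : ‖P (Φ (f' s))‖ ≤ ‖P (Φ (f' s)) - G' (Φ (f' s))‖ + ‖G' (Φ (f' s))‖ := by
        simpa using norm_add_le (P (Φ (f' s)) - G' (Φ (f' s))) (G' (Φ (f' s)))
      have h6 := norm_sub_le s (P (Φ (f' s)))
      linarith)
  have hzero : P (Φ (f' s)) = 0 := by simpa using hfix
  rcases le_total e ‖f' s‖ with h | h
  · rw [hΦ1 _ h] at hzero
    exact hPT _ ⟨⟨s, hs, rfl⟩, h⟩ hzero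
  · exact hP0 _ (hΦ2 _ (hne s hs) h) hzero

/-- Invariance of domain: an injective continuous map between open subsets of `ℝⁿ` is open. -/
theorem image_mem_nhds_of_injOn {n : ℕ} {f : (Fin n → ℝ) → Fin n → ℝ} {U : Set (Fin n → ℝ)}
    {x : Fin n → ℝ} (hU : U ∈ nhds x) (hf : ContinuousOn f U) (hinj : Set.InjOn f U) :
    f '' U ∈ nhds (f x) := by
  obtain ⟨ε, hε, hball⟩ := Metric.mem_nhds_iff.1 hU
  obtain ⟨R, hR, hSR⟩ := (isCompact_bigSimplex n).isBounded.exists_pos_norm_le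
  set t := ε / (2 * R) with ht
  have ht0 : 0 < t := by positivity
  let a : (Fin n → ℝ) → Fin n → ℝ := fun y => x + t • y
  have ha : Set.MapsTo a (bigSimplex n) U := by
    intro y hy
    refine hball ?_
    have h1 : t * ‖y‖ ≤ t * R := mul_le_mul_of_nonneg_left (hSR y hy) ht0.le
    have h2 : t * R = ε / 2 := by rw [ht]; field_simp
    rw [Metric.mem_ball, dist_eq_norm, add_sub_cancel_left, norm_smul, Real.norm_eq_abs,
      abs_of_pos ht0]
    linarith
  have hinja : Function.Injective a := fun y z h =>
    smul_right_injective _ ht0.ne' (add_left_cancel h)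
  have := image_bigSimplex_mem_nhds (f := f ∘ a) (hf.comp (by fun_prop) ha)
    (hinj.comp hinja.injOn ha)
  have ha0 : a 0 = x := by simp [a]
  rw [Function.comp_apply, ha0, Set.image_comp] at this
  exact Filter.mem_of_superset this (Set.image_mono ha.image_subset)

end InvarianceOfDomain

/-! ### Local structure of triangulated 3-manifolds -/

section LocalStructure

variable {E : Type*} [NormedAddCommGroup E] [NormedSpace ℝ E] {K : Geometry.SimplicialComplex ℝ E}

lemma affineIndependent_tuple {G : Finset E} (hG : G ∈ K.faces) {m : ℕ} {t : Fin m → E}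
    (ht : Function.Injective t) (htG : Set.range t = G) : AffineIndependent ℝ t := by
  let emb : Fin m ↪ G :=
    ⟨fun i => ⟨t i, Finset.mem_coe.1 (htG ▸ ⟨i, rfl⟩)⟩, fun i j h => ht (congrArg Subtype.val h)⟩
  exact (K.indep hG).comp_embedding emb

lemma weights_unique {m : ℕ} {t : Fin m → E} (ht : AffineIndependent ℝ t) {x y : Fin m → ℝ}
    (hx : ∑ i, x i = 1) (hy : ∑ i, y i = 1) (h : ∑ i, x i • t i = ∑ i, y i • t i) : x = y := by
  have := affineIndependent_iff.1 ht Finset.univ (x - y) (by simp [hx, hy])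
    (by simp [sub_smul, h])
  exact funext fun i => sub_eq_zero.1 (this i (Finset.mem_univ i))

lemma exists_weights {m : ℕ} (t : Fin m → E) (I : Set (Fin m)) {p : E}
    (hp : p ∈ convexHull ℝ (t '' I)) :
    ∃ x ∈ stdSimplex ℝ (Fin m), (∀ i ∉ I, x i = 0) ∧ ∑ i, x i • t i = p := by
  let C : Set (Fin m → ℝ) := {x | x ∈ stdSimplex ℝ (Fin m) ∧ ∀ i ∉ I, x i = 0}
  have hC : Convex ℝ C := by
    rintro x ⟨hx, hx'⟩ y ⟨hy, hy'⟩ a b ha hb hab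
    exact ⟨convex_stdSimplex ℝ _ hx hy ha hb hab, fun i hi => by simp [hx' i hi, hy' i hi]⟩
  have h1 : convexHull ℝ (t '' I) ⊆ Fintype.linearCombination ℝ t '' C := by
    refine convexHull_min ?_ (hC.linear_image _)
    rintro _ ⟨i, hi, rfl⟩
    refine ⟨Pi.single i 1, ⟨single_mem_stdSimplex ℝ i, fun j hj => Pi.single_eq_of_ne ?_ _⟩, ?_⟩
    · rintro rfl; exact hj hi
    · simp [Fintype.linearCombination_apply_single]
  obtain ⟨x, hx, rfl⟩ := h1 hp
  exact ⟨x, hx.1, hx.2, (Fintype.linearCombination_apply ℝ t x).symm⟩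

/-- A point in the relative interior of a face lies only in faces containing that face. -/
lemma subset_of_weights_pos {G τ : Finset E} (hG : G ∈ K.faces) (hτ : τ ∈ K.faces) {m : ℕ}
    {t : Fin m → E} (ht : Function.Injective t) (htG : Set.range t = G) {x : Fin m → ℝ}
    (hx0 : ∀ i, 0 < x i) (hx1 : ∑ i, x i = 1) (hxτ : ∑ i, x i • t i ∈ convexHull ℝ (τ : Set E)) :
    G ⊆ τ := by
  have h1 : ∑ i, x i • t i ∈ convexHull ℝ (G : Set E) := by
    refine (convex_convexHull ℝ _).sum_mem (fun i _ => (hx0 i).le) hx1 fun i _ => ?_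
    exact subset_convexHull ℝ _ (htG ▸ ⟨i, rfl⟩)
  have h2 := K.inter_subset_convexHull hG hτ ⟨h1, hxτ⟩
  have h3 : (G : Set E) ∩ τ = t '' {i | t i ∈ τ} := by
    ext y
    rw [← htG]
    constructor
    · rintro ⟨⟨i, rfl⟩, hi⟩
      exact ⟨i, hi, rfl⟩
    · rintro ⟨i, hi, rfl⟩
      exact ⟨⟨i, rfl⟩, hi⟩
  rw [h3] at h2
  -- Weights supported on the vertices lying in `τ` must agree with the positive weights `x`, so no
  -- vertex of `G` is missing from `τ`.
  obtain ⟨y, ⟨-, hy1⟩, hy0, hy⟩ := exists_weights t _ h2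
  have hxy := weights_unique (affineIndependent_tuple hG ht htG) hx1 hy1 hy.symm
  intro v hv
  obtain ⟨i, rfl⟩ : v ∈ Set.range t := htG ▸ hv
  by_contra hi
  exact (hx0 i).ne' (by rw [hxy]; exact hy0 i hi)

/-- The image of an embedded 3-ball in a triangulated 3-manifold is a neighborhood of its
center. -/
lemma image_mem_nhdsWithin_space {k : ℕ} {K : Geometry.SimplicialComplex ℝ (Euc k)}
    (hman : TriangulatesThreeManifold K) {Ψ : (Fin 3 → ℝ) → Euc k} {U : Set (Fin 3 → ℝ)}
    (hU : U ∈ nhds 0) (hΨ : ContinuousOn Ψ U) (hinj : Set.InjOn Ψ U)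
    (hmaps : Set.MapsTo Ψ U K.space) : Ψ '' U ∈ nhdsWithin (Ψ 0) K.space := by
  classical
  obtain ⟨cs⟩ := hman
  have h0 : Ψ 0 ∈ K.space := hmaps (mem_of_mem_nhds hU)
  let e := cs.chartAt ⟨Ψ 0, h0⟩
  have he0 : (⟨Ψ 0, h0⟩ : K.space) ∈ e.source := cs.mem_chart_source _
  obtain ⟨V, hV, hVe⟩ := isOpen_induced_iff.1 e.open_source
  have h0V : Ψ 0 ∈ V := by
    have : (⟨Ψ 0, h0⟩ : K.space) ∈ Subtype.val ⁻¹' V := hVe ▸ he0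
    exact this
  -- The chart, followed by the inclusion of the half-space in `ℝ³`. Only continuity and injectivity
  -- matter, so boundary charts need no separate treatment.
  let C : Euc k → Fin 3 → ℝ := fun x => if h : x ∈ K.space then fun i => (e ⟨x, h⟩).1 i else 0
  have hCval : ∀ q : K.space, C q = fun i => (e q).1 i := fun q => dif_pos q.2
  have himage : Subtype.val '' e.source = K.space ∩ V := by
    rw [← hVe, Subtype.image_preimage_coe]
  have hCc : ContinuousOn C (K.space ∩ V) := by
    rw [← himage, Topology.IsInducing.subtypeVal.continuousOn_image_iff]
    have h1 : ContinuousOn (fun q : K.space => fun i => (e q).1 i) e.source := by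
      refine continuousOn_pi.2 fun i => ?_
      have h2 : Continuous fun z : EuclideanHalfSpace 3 => z.1 i :=
        (EuclideanSpace.proj (𝕜 := ℝ) i).continuous.comp continuous_subtype_val
      exact h2.comp_continuousOn e.continuousOn
    exact h1.congr fun q _ => hCval q
  have hCinj : Set.InjOn C (K.space ∩ V) := by
    rw [← himage]
    rintro _ ⟨q, hq, rfl⟩ _ ⟨q', hq', rfl⟩ h
    rw [hCval, hCval] at h
    refine congrArg _ (e.injOn hq hq' (Subtype.ext ?_))
    ext i
    exact congrFun h i
  have hΨ0 : ContinuousAt Ψ 0 := hΨ.continuousAt hU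
  have hU' : U ∩ Ψ ⁻¹' V ∈ nhds 0 := Filter.inter_mem hU (hΨ0 (hV.mem_nhds h0V))
  have hmaps' : Set.MapsTo Ψ (U ∩ Ψ ⁻¹' V) (K.space ∩ V) := fun y hy => ⟨hmaps hy.1, hy.2⟩
  have key := image_mem_nhds_of_injOn (f := C ∘ Ψ) hU'
    (hCc.comp (hΨ.mono Set.inter_subset_left) hmaps')
    (hCinj.comp (hinj.mono Set.inter_subset_left) hmaps')
  -- Invariance of domain applies to `C ∘ Ψ`, a map between copies of `ℝ³`; injectivity of `C` pulls
  -- the resulting neighbourhood back to `|K|`.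
  have h1 : C ⁻¹' ((C ∘ Ψ) '' (U ∩ Ψ ⁻¹' V)) ∈ nhdsWithin (Ψ 0) (K.space ∩ V) :=
    hCc (Ψ 0) ⟨h0, h0V⟩ key
  have h2 : nhdsWithin (Ψ 0) (K.space ∩ V) = nhdsWithin (Ψ 0) K.space :=
    nhdsWithin_inter_of_mem' (nhdsWithin_le_nhds (hV.mem_nhds h0V))
  have h3 := Filter.inter_mem h1 self_mem_nhdsWithin
  rw [h2] at h3
  refine Filter.mem_of_superset h3 ?_
  rintro x ⟨⟨y, hy, hyx⟩, hx⟩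
  exact ⟨y, hy.1, hCinj (hmaps' hy) hx hyx⟩

/-! ### Triangles and the tetrahedra around them. -/

section Book

variable {k : ℕ} {K : Geometry.SimplicialComplex ℝ (Euc k)}

/-- Barycentric coordinates near the barycenter of a triangle, on a tetrahedron containing it. -/
def pageWeights (y : Fin 3 → ℝ) : Fin 4 → ℝ :=
  ![1 / 3 + y 0, 1 / 3 + y 1, 1 / 3 - y 0 - y 1 - |y 2|, |y 2|]

lemma sum_pageWeights (y : Fin 3 → ℝ) : ∑ i, pageWeights y i = 1 := by
  simp only [pageWeights, Fin.sum_univ_four]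
  simp
  ring

/-- The radius is chosen so that `1 / 3 - 3 * (1 / 12) > 0`. -/
lemma pageWeights_pos {y : Fin 3 → ℝ} (hy : ‖y‖ < 1 / 12) {i : Fin 4} (hi : i ≠ 3) :
    0 < pageWeights y i := by
  have h : ∀ j, |y j| < 1 / 12 := fun j => (norm_le_pi_norm y j).trans_lt hy
  have h0 := abs_lt.1 (h 0)
  have h1 := abs_lt.1 (h 1)
  have h2 := h 2
  fin_cases i
  · simp [pageWeights]; linarith
  · simp [pageWeights]; linarith
  · simp [pageWeights]; linarith
  · exact absurd rfl hi

lemma pageWeights_nonneg {y : Fin 3 → ℝ} (hy : ‖y‖ < 1 / 12) (i : Fin 4) :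
    0 ≤ pageWeights y i := by
  by_cases hi : i = 3
  · subst hi; simp [pageWeights]
  · exact (pageWeights_pos hy hi).le

/-- The two tetrahedra `v ∪ a` and `v ∪ b`, parametrized near the barycenter of the triangle `v`. -/
def book {E : Type*} [AddCommGroup E] [Module ℝ E] (v : Fin 3 → E) (a b : E) (y : Fin 3 → ℝ) : E :=
  (1 / 3 + y 0) • v 0 + (1 / 3 + y 1) • v 1 + (1 / 3 - y 0 - y 1 - |y 2|) • v 2 +
    (max (y 2) 0 • a + max (-y 2) 0 • b)

lemma book_of_nonneg {E : Type*} [AddCommGroup E] [Module ℝ E] (v : Fin 3 → E) (a b : E)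
    {y : Fin 3 → ℝ} (hy : 0 ≤ y 2) :
    book v a b y = ∑ i, pageWeights y i • (Fin.snoc v a : Fin 4 → E) i := by
  rw [Fin.sum_univ_castSucc]
  simp only [Fin.snoc_castSucc, Fin.snoc_last, Fin.sum_univ_three]
  simp [book, pageWeights, abs_of_nonneg hy, hy]

lemma book_of_nonpos {E : Type*} [AddCommGroup E] [Module ℝ E] (v : Fin 3 → E) (a b : E)
    {y : Fin 3 → ℝ} (hy : y 2 ≤ 0) :
    book v a b y = ∑ i, pageWeights y i • (Fin.snoc v b : Fin 4 → E) i := by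
  rw [Fin.sum_univ_castSucc]
  simp only [Fin.snoc_castSucc, Fin.snoc_last, Fin.sum_univ_three]
  simp [book, pageWeights, abs_of_nonpos hy, hy]

/-- The weights forget only the sign of `y 2`, which selects the page. -/
lemma pageWeights_injOn {y z : Fin 3 → ℝ} (h : pageWeights y = pageWeights z)
    (h2 : |y 2| = |z 2| → y 2 = z 2) : y = z := by
  have e0 := congrFun h 0
  have e1 := congrFun h 1
  have e3 := congrFun h 3
  simp only [pageWeights] at e0 e1 e3
  simp at e0 e1 e3
  funext i
  fin_cases i
  · exact e0
  · exact e1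
  · exact h2 e3

variable [DecidableEq (Euc k)]

/-- In a triangulated 3-manifold, a triangle shared by two tetrahedra lies in no other face. -/
theorem subset_of_book (hman : TriangulatesThreeManifold K) {F G : Finset (Euc k)} {a b : Euc k}
    (hF : F.card = 3) (haF : a ∉ F) (hbF : b ∉ F) (hab : a ≠ b) (ha : insert a F ∈ K.faces)
    (hb : insert b F ∈ K.faces) (hG : G ∈ K.faces) (hFG : F ⊆ G) :
    G ⊆ insert a F ∨ G ⊆ insert b F := by
  obtain ⟨v, hv, hvF⟩ : ∃ v : Fin 3 → Euc k, Function.Injective v ∧ Set.range v = F :=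
    ⟨fun i => (F.equivFinOfCardEq hF).symm i,
      Subtype.val_injective.comp (F.equivFinOfCardEq hF).symm.injective, by
        ext x
        constructor
        · rintro ⟨i, rfl⟩; exact Subtype.prop _
        · exact fun hx => ⟨F.equivFinOfCardEq hF ⟨x, hx⟩, by simp⟩⟩
  have hrange : ∀ c, Set.range (Fin.snoc v c : Fin 4 → Euc k) = (insert c F : Finset (Euc k)) := by
    intro c
    rw [Finset.coe_insert, ← hvF]
    exact Fin.range_snoc v c
  have hsnoc : ∀ c ∉ F, Function.Injective (Fin.snoc v c : Fin 4 → Euc k) := by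
    intro c hc
    refine Fin.snoc_injective_iff.2 ⟨hv, ?_⟩
    rw [hvF]; exact hc
  have hmem : ∀ c, ∀ y : Fin 3 → ℝ, ‖y‖ < 1 / 12 →
      ∑ i, pageWeights y i • (Fin.snoc v c : Fin 4 → Euc k) i ∈
        convexHull ℝ ((insert c F : Finset (Euc k)) : Set (Euc k)) := by
    intro c y hy
    refine (convex_convexHull ℝ _).sum_mem (fun i _ => pageWeights_nonneg hy i)
      (sum_pageWeights y) fun i _ => subset_convexHull ℝ _ ?_
    rw [← hrange]; exact ⟨i, rfl⟩
  -- Off the triangle, a point of one page has all weights positive, so a face containing it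
  -- contains the whole tetrahedron, including the apex that the other page lacks.
  have hab' : ∀ a b, a ≠ b → a ∉ F → insert a F ∈ K.faces → insert b F ∈ K.faces →
      ∀ y z : Fin 3 → ℝ, ‖y‖ < 1 / 12 → ‖z‖ < 1 / 12 → y 2 ≠ 0 →
      ∑ i, pageWeights y i • (Fin.snoc v a : Fin 4 → Euc k) i ≠
        ∑ i, pageWeights z i • (Fin.snoc v b : Fin 4 → Euc k) i := by
    intro a b hab haF ha hb y z hy hz hy2 h
    have h1 := subset_of_weights_pos ha hb (hsnoc a haF) (hrange a) (x := pageWeights y) (fun i => by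
      by_cases hi : i = 3
      · subst hi; simpa [pageWeights] using hy2
      · exact pageWeights_pos hy hi) (sum_pageWeights y) (h ▸ hmem b z hz)
    rcases Finset.mem_insert.1 (h1 (Finset.mem_insert_self a F)) with h2 | h2
    · exact hab h2
    · exact haF h2
  set U := Metric.ball (0 : Fin 3 → ℝ) (1 / 12) with hU
  have hUn : ∀ y ∈ U, ‖y‖ < 1 / 12 := fun y hy => by simpa [hU] using hy
  have hbook : ∀ y ∈ U, book v a b y ∈ convexHull ℝ ((insert a F : Finset _) : Set (Euc k)) ∨
      book v a b y ∈ convexHull ℝ ((insert b F : Finset _) : Set (Euc k)) := by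
    intro y hy
    rcases le_total 0 (y 2) with h | h
    · rw [book_of_nonneg v a b h]; exact Or.inl (hmem a y (hUn y hy))
    · rw [book_of_nonpos v a b h]; exact Or.inr (hmem b y (hUn y hy))
  have hinj : Set.InjOn (book v a b) U := by
    intro y hy z hz hyz
    have hy' := hUn y hy
    have hz' := hUn z hz
    have haI := affineIndependent_tuple ha (hsnoc a haF) (hrange a)
    have hbI := affineIndependent_tuple hb (hsnoc b hbF) (hrange b)
    rcases le_or_gt 0 (y 2) with h | h <;> rcases le_or_gt 0 (z 2) with h' | h'
    · rw [book_of_nonneg v a b h, book_of_nonneg v a b h'] at hyz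
      refine pageWeights_injOn (weights_unique haI (sum_pageWeights y) (sum_pageWeights z) hyz) ?_
      rw [abs_of_nonneg h, abs_of_nonneg h']; exact id
    · rw [book_of_nonneg v a b h, book_of_nonpos v a b h'.le] at hyz
      exact absurd hyz.symm (hab' b a hab.symm hbF hb ha z y hz' hy' h'.ne)
    · rw [book_of_nonpos v a b h.le, book_of_nonneg v a b h'] at hyz
      exact absurd hyz (hab' b a hab.symm hbF hb ha y z hy' hz' h.ne)
    · rw [book_of_nonpos v a b h.le, book_of_nonpos v a b h'.le] at hyz
      refine pageWeights_injOn (weights_unique hbI (sum_pageWeights y) (sum_pageWeights z) hyz) ?_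
      rw [abs_of_neg h, abs_of_neg h']; exact neg_inj.1
  have hcont : Continuous (book v a b) := by unfold book; fun_prop
  have key := image_mem_nhdsWithin_space hman (Metric.ball_mem_nhds 0 (by norm_num))
    hcont.continuousOn hinj (fun y hy => (hbook y hy).elim
      (fun h => K.convexHull_subset_space ha h) fun h => K.convexHull_subset_space hb h)
  let t : Fin G.card → Euc k := fun i => G.equivFin.symm i
  have ht : Function.Injective t := Subtype.val_injective.comp G.equivFin.symm.injective
  have htG : Set.range t = G := by
    ext x
    constructor
    · rintro ⟨i, rfl⟩; exact Subtype.prop _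
    · exact fun hx => ⟨G.equivFin ⟨x, hx⟩, by simp [t]⟩
  have hpG : book v a b 0 ∈ convexHull ℝ (t '' Set.univ) := by
    rw [Set.image_univ, htG]
    refine convexHull_mono (Finset.coe_subset.2 hFG) ?_
    have h1 : book v a b 0 = ∑ i, (fun _ => 1 / 3 : Fin 3 → ℝ) i • v i := by
      simp [book, Fin.sum_univ_three]
    rw [h1]
    refine (convex_convexHull ℝ _).sum_mem (fun i _ => by norm_num) (by simp) fun i _ => ?_
    exact subset_convexHull ℝ _ (hvF ▸ ⟨i, rfl⟩)
  obtain ⟨x, hx, -, hxp⟩ := exists_weights t _ hpG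
  have hm : 0 < G.card := (K.nonempty_of_mem_faces hG).card_pos
  have hm' : (0 : ℝ) < G.card := by exact_mod_cast hm
  -- `γ` runs from the barycenter of `F` towards that of `G`, and for parameters in `(0, 1)` lies in
  -- the relative interior of `G`.
  let w : ℝ → Fin G.card → ℝ := fun s i => (1 - s) * x i + s * (1 / G.card)
  let γ : ℝ → Euc k := fun s => ∑ i, w s i • t i
  have hw1 : ∀ s, ∑ i, w s i = 1 := by
    intro s
    simp only [w, Finset.sum_add_distrib, ← Finset.mul_sum, hx.2]
    simp [hm'.ne']
  have hw0 : ∀ s ∈ Set.Ioo (0 : ℝ) 1, ∀ i, 0 < w s i := fun s hs i =>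
    add_pos_of_nonneg_of_pos (mul_nonneg (by linarith [hs.2]) (hx.1 i))
      (mul_pos hs.1 (by positivity))
  have hγ0 : γ 0 = book v a b 0 := by simp [γ, w, hxp]
  have hγc : Continuous γ := by fun_prop
  have hγK : ∀ s ∈ Set.Ioo (0 : ℝ) 1, γ s ∈ K.space := by
    intro s hs
    refine K.convexHull_subset_space hG ?_
    refine (convex_convexHull ℝ _).sum_mem (fun i _ => (hw0 s hs i).le) (hw1 s) fun i _ => ?_
    exact subset_convexHull ℝ _ (htG ▸ ⟨i, rfl⟩)
  have hIoo : Set.Ioo (0 : ℝ) 1 ∈ nhdsWithin 0 (Set.Ioi 0) := Ioo_mem_nhdsGT one_pos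
  have htend : Filter.Tendsto γ (nhdsWithin 0 (Set.Ioi 0))
      (nhdsWithin (book v a b 0) K.space) := by
    refine tendsto_nhdsWithin_of_tendsto_nhds_of_eventually_within _ ?_
      (Filter.mem_of_superset hIoo hγK)
    rw [← hγ0]
    exact (hγc.tendsto 0).mono_left nhdsWithin_le_nhds
  -- For small `s > 0` the path is in the neighbourhood covered by the two pages, so an interior
  -- point of `G` lies in one of the two tetrahedra.
  obtain ⟨s, hs, y, hy, hys⟩ := Filter.nonempty_of_mem (Filter.inter_mem hIoo (htend key))
  exact (hbook y hy).imp
    (fun h => subset_of_weights_pos hG ha ht htG (hw0 s hs) (hw1 s) (by rw [hys] at h; exact h))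
    (fun h => subset_of_weights_pos hG hb ht htG (hw0 s hs) (hw1 s) (by rw [hys] at h; exact h))

/-- Faces of a triangulated 3-manifold have dimension at most `3`. -/
lemma card_le_four (hman : TriangulatesThreeManifold K) {G : Finset (Euc k)} (hG : G ∈ K.faces) :
    G.card ≤ 4 := by
  by_contra h
  -- Three vertices of `G` and two further ones give two tetrahedra sharing a triangle, one of which
  -- would have to contain `G`.
  obtain ⟨F, hFG, hF⟩ := Finset.exists_subset_card_eq (show 3 ≤ G.card by omega)
  have h2 : 1 < (G \ F).card := by rw [Finset.card_sdiff_of_subset hFG]; omega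
  obtain ⟨a, ha, b, hb, hab⟩ := Finset.one_lt_card.1 h2
  rw [Finset.mem_sdiff] at ha hb
  have hins : ∀ c ∈ G, insert c F ∈ K.faces := fun c hc =>
    K.down_closed hG (Finset.insert_subset hc hFG) (Finset.insert_nonempty _ _)
  rcases subset_of_book hman hF ha.2 hb.2 hab (hins a ha.1) (hins b hb.1) hG hFG with h3 | h3
  all_goals
    have h4 := (Finset.card_le_card h3).trans (Finset.card_insert_le _ _)
    omega

/-- In a triangulated 3-manifold, triangles lie in at most two tetrahedra. -/
lemma card_tetrahedra_le_two (hman : TriangulatesThreeManifold K) {F : Finset (Euc k)}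
    (hF : F.card = 3) (S : Finset (Euc k)) (hS : ∀ a ∈ S, a ∉ F ∧ insert a F ∈ K.faces) :
    S.card ≤ 2 := by
  by_contra h
  obtain ⟨a, b, c, ha, hb, hc, hab, hac, hbc⟩ := Finset.two_lt_card_iff.1 (not_le.1 h)
  have := subset_of_book hman hF (hS a ha).1 (hS b hb).1 hab (hS a ha).2 (hS b hb).2 (hS c hc).2
    (Finset.subset_insert c F)
  rcases this with h1 | h1
  · rcases Finset.mem_insert.1 (h1 (Finset.mem_insert_self c F)) with h2 | h2
    · exact hac h2.symm
    · exact (hS c hc).1 h2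
  · rcases Finset.mem_insert.1 (h1 (Finset.mem_insert_self c F)) with h2 | h2
    · exact hbc h2.symm
    · exact (hS c hc).1 h2

end Book

end LocalStructure

/-! ### The main theorem -/

section Main

variable {k : ℕ} {K : Geometry.SimplicialComplex ℝ (Euc k)} {π : Euc k}

lemma convex_upperHalfspace (π : Euc k) (c : ℝ) : Convex ℝ (upperHalfspace π c) :=
  convex_halfSpace_gt (innerSL ℝ π).toLinearMap.isLinear c

lemma convex_compl_upperHalfspace (π : Euc k) (c : ℝ) : Convex ℝ (upperHalfspace π c)ᶜ := by
  have : (upperHalfspace π c)ᶜ = {x | innerSL ℝ π x ≤ c} := by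
    ext x; simp [upperHalfspace]
  rw [this]
  exact convex_halfSpace_le (innerSL ℝ π).toLinearMap.isLinear c

/-- The complement of the open halfspace is convex, so it cannot contain all vertices of the carrier
of `x`. Hence the open stars of the vertices above cover the part of `|K|` above, and no deformation
retraction is needed. -/
lemma exists_vertex_above {c : ℝ} {x : Euc k} (hx : x ∈ upperHalfspace π c ∩ K.space) :
    ∃ v ∈ upperHalfspace π c, ∀ τ ∈ K.faces, x ∈ convexHull ℝ (τ : Set (Euc k)) → v ∈ τ := by
  obtain ⟨σ, hσ, hxσ, hmin⟩ := exists_carrier hx.2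
  have : ∃ v ∈ σ, v ∈ upperHalfspace π c := by
    by_contra h
    push Not at h
    exact convexHull_min (fun v hv => h v hv) (convex_compl_upperHalfspace π c) hxσ hx.1
  obtain ⟨v, hv, hvc⟩ := this
  exact ⟨v, hvc, fun τ hτ hxτ => hmin τ hτ hxτ hv⟩

variable [DecidableEq (Euc k)]

/-- By tightness, cycles in the upper link of a vertex bound above the vertex. -/
lemma exists_fd_eq_of_tight (hfin : K.faces.Finite) (htight : IsTight π K) {c : ℝ} {v : Euc k}
    {L : Set (Finset (Euc k))} (hL : ∀ F ∈ L, insert v F ∈ K.faces ∧ (F : Set (Euc k)) ⊆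
      upperHalfspace π c) {n : ℕ} (hn : n ≠ 0) {z : FC (Euc k)} (hz : z ∈ chains L n)
    (hzcyc : fd z = 0) :
    ∃ z' ∈ chains (facesIn K (upperHalfspace π c)) (n + 1), fd z' = z := by
  obtain ⟨i, rfl⟩ := Nat.exists_eq_succ_of_ne_zero hn
  set W := upperHalfspace π c with hW
  have hzW : z ∈ chains (facesIn K W) (i + 1) := by
    refine Finsupp.supported_mono ?_ hz
    rintro F ⟨hF, hFn⟩
    refine ⟨Or.inr ⟨K.down_closed (hL F hF).1 (Finset.subset_insert _ _) ?_, (hL F hF).2⟩, hFn⟩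
    exact Finset.card_pos.1 (by omega)
  -- The cone from `v` shows that the link cycle bounds in `|K|`, though not above `v`; tightness
  -- supplies a filling above.
  have hcone : fcone v z ∈ chains (facesIn K Set.univ) (i + 2) :=
    fcone_mem hz fun F hF _ => Or.inr ⟨(hL F hF).1, Set.subset_univ _⟩
  have hr : realize (i + 1) (toTuples (i + 1) z) ∈ chainsIn (W ∩ K.space) (i + 1) :=
    realize_toTuples_mem hzW fun F hF hFW => Set.subset_inter
      (convexHull_min hFW (convex_upperHalfspace π c)) (K.convexHull_subset_space hF)
  have hw : realize (i + 2) (toTuples (i + 2) (fcone v z)) ∈ chainsIn K.space (i + 2) :=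
    realize_toTuples_mem hcone fun F hF _ => K.convexHull_subset_space hF
  obtain ⟨y, hy, hyz⟩ := exists_sbd_eq_of_inclusion Set.inter_subset_right (htight c i) hr
    (Or.inr (by rw [sbd_realize, bd_toTuples, hzcyc, map_zero, map_zero])) hw
    (by rw [sbd_realize, bd_toTuples, fd_fcone, hzcyc, map_zero, add_zero])
  exact exists_fd_eq_of_sbd_eq hfin Set.inter_subset_right (fun x hx => exists_vertex_above hx)
    hzW hy hyz

/-- The upper link of a vertex in a triangulated 3-manifold can be built from nothing. -/
lemma build_link (hman : TriangulatesThreeManifold K) {v : Euc k} {s : Finset (Euc k)}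
    (hvs : v ∉ s) {L : Finset (Finset (Euc k))}
    (hL : ∀ σ, σ ∈ L ↔ σ ⊆ s ∧ insert v σ ∈ K.faces) : Build fd L := by
  have hvL : ∀ σ ∈ L, v ∉ σ := fun σ hσ h => hvs (((hL σ).1 hσ).1 h)
  refine build_of_edges_le_two L ?_ ?_ ?_
  · intro σ τ hτσ hσ
    rw [Finset.mem_coe, hL] at hσ ⊢
    exact ⟨hτσ.trans hσ.1, K.down_closed hσ.2 (Finset.insert_subset_insert v hτσ)
      (Finset.insert_nonempty _ _)⟩
  · intro σ hσ
    have h := card_le_four hman ((hL σ).1 hσ).2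
    rw [Finset.card_insert_of_notMem (hvL σ hσ)] at h
    omega
  · classical
    intro e he he2
    -- Triangles of the link on the edge `e` correspond to tetrahedra on the triangle `insert v e`.
    set S := s.filter fun a => a ∉ insert v e ∧ insert a (insert v e) ∈ K.faces with hS
    have h1 : S.card ≤ 2 := by
      refine card_tetrahedra_le_two hman (F := insert v e) ?_ S fun a ha => ?_
      · rw [Finset.card_insert_of_notMem (hvL e he), he2]
      · rw [hS, Finset.mem_filter] at ha
        exact ha.2
    refine (Finset.card_le_card (t := S.image fun a => insert a e) fun t ht => ?_).trans
      (Finset.card_image_le.trans h1)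
    rw [Finset.mem_filter] at ht
    obtain ⟨htL, het, ht3⟩ := ht
    obtain ⟨a, hae, rfl⟩ := Finset.exists_eq_insert_iff.2 ⟨het, by rw [he2, ht3]⟩
    refine Finset.mem_image.2 ⟨a, ?_, rfl⟩
    have h2 := (hL _).1 htL
    have has := h2.1 (Finset.mem_insert_self a e)
    rw [hS, Finset.mem_filter, Finset.insert_comm]
    refine ⟨has, ?_, h2.2⟩
    rw [Finset.mem_insert, not_or]
    exact ⟨fun h => hvs (h ▸ has), hae⟩

/-- A tight triangulated 3-manifold can be built vertex by vertex. -/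
theorem build_of_tight (hfin : K.faces.Finite) (hman : TriangulatesThreeManifold K)
    (hgen : InGeneralPosition π K) (htight : IsTight π K) : Build ud hfin.toFinset := by
  set A := hfin.toFinset with hA
  have hmemA : ∀ σ, σ ∈ A ↔ σ ∈ K.faces := fun σ => hfin.mem_toFinset
  have hvert : ∀ σ ∈ K.faces, ∀ v ∈ σ, {v} ∈ K.faces := fun σ hσ v hv =>
    K.down_closed hσ (Finset.singleton_subset_iff.2 hv) (Finset.singleton_nonempty v)
  -- The induction runs over sets of vertices closed upwards under `⟪π, -⟫`, the lowest vertex being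
  -- inserted last.
  suffices h : ∀ s : Finset (Euc k), (∀ v ∈ s, {v} ∈ K.faces) →
      (∀ v ∈ s, ∀ w, {w} ∈ K.faces → inner ℝ π v ≤ inner ℝ π w → w ∈ s) →
      Build ud (A.filter fun σ => σ ⊆ s) by
    have hs := h (A.biUnion id) (fun v hv => ?_) fun v _ w hw _ => ?_
    · rwa [Finset.filter_true_of_mem] at hs
      exact fun σ hσ => Finset.subset_biUnion_of_mem id hσ
    · obtain ⟨σ, hσ, hv⟩ := Finset.mem_biUnion.1 hv
      exact hvert σ ((hmemA σ).1 hσ) v hv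
    · exact Finset.mem_biUnion.2 ⟨{w}, (hmemA _).2 hw, Finset.mem_singleton_self w⟩
  intro s
  induction s using Finset.induction_on_min_value (fun v : Euc k => inner ℝ π v) with
  | empty =>
    intro _ _
    rw [Finset.filter_false_of_mem]
    · exact Build.nil
    · exact fun σ hσ h => (K.nonempty_of_mem_faces ((hmemA σ).1 hσ)).ne_empty
        (Finset.subset_empty.1 h)
  | insert v s hvs hmin ih =>
    intro hK hup
    have hvK := hK v (Finset.mem_insert_self v s)
    -- General position makes the inequality strict, so the older vertices are exactly those in the
    -- open halfspace above `v`.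
    have hlt : ∀ w ∈ s, w ∈ upperHalfspace π (inner ℝ π v) := by
      intro w hw
      refine lt_of_le_of_ne (hmin w hw) fun h => hvs ?_
      rwa [hgen hvK (hK w (Finset.mem_insert_of_mem hw)) h]
    have hs := ih (fun w hw => hK w (Finset.mem_insert_of_mem hw)) fun u hu w hw huw => by
      refine Finset.mem_of_mem_insert_of_ne (hup u (Finset.mem_insert_of_mem hu) w hw huw) ?_
      rintro rfl
      exact absurd huw (not_le.2 (hlt u hu))
    have habove : ∀ w, {w} ∈ K.faces → w ∈ upperHalfspace π (inner ℝ π v) → w ∈ s := by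
      intro w hw hwv
      refine Finset.mem_of_mem_insert_of_ne
        (hup v (Finset.mem_insert_self v s) w hw (le_of_lt hwv)) ?_
      rintro rfl
      exact lt_irrefl (inner ℝ π w : ℝ) hwv
    classical
    set L := s.powerset.filter fun σ => insert v σ ∈ K.faces with hLdef
    have hL : ∀ σ, σ ∈ L ↔ σ ⊆ s ∧ insert v σ ∈ K.faces := fun σ => by
      rw [hLdef, Finset.mem_filter, Finset.mem_powerset]
    have key := Build.join (v := v) (L := L) hs
      (fun ρ hρ h => hvs ((Finset.mem_filter.1 hρ).2 h))
      (fun ρ hρ h => hvs (((hL ρ).1 hρ).1 h))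
      (fun ρ hρ hne => Finset.mem_filter.2 ⟨(hmemA ρ).2 (K.down_closed ((hL ρ).1 hρ).2
        (Finset.subset_insert _ _) (Finset.nonempty_iff_ne_empty.2 hne)), ((hL ρ).1 hρ).1⟩)
      (fun n hn z hz hzcyc => by
        obtain ⟨z', hz', hd⟩ := exists_fd_eq_of_tight hfin htight (c := inner ℝ π v) (v := v)
          (fun F hF => ⟨((hL F).1 hF).2, fun w hw => hlt w (((hL F).1 hF).1 hw)⟩) hn hz hzcyc
        refine ⟨z', Finsupp.supported_mono ?_ hz', hd⟩
        rintro F ⟨hF, hFn⟩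
        have hF' : F ∈ K.faces ∧ (F : Set (Euc k)) ⊆ upperHalfspace π (inner ℝ π v) := by
          refine hF.resolve_left ?_
          rintro rfl
          simp at hFn
        refine ⟨Finset.mem_coe.2 (Finset.mem_filter.2 ⟨(hmemA F).2 hF'.1, fun w hw => ?_⟩), hFn⟩
        exact habove w (hvert F hF'.1 w hw) (hF'.2 hw))
      (build_link hman hvs hL) subset_rfl
    convert key using 1
    ext σ
    simp only [Finset.mem_filter, Finset.mem_union, Finset.mem_image, hmemA, hL]
    constructor
    · rintro ⟨hσ, hσs⟩
      by_cases hv : v ∈ σ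
      · exact Or.inr ⟨σ.erase v, ⟨Finset.subset_insert_iff.1 hσs, by rwa [Finset.insert_erase hv]⟩,
          Finset.insert_erase hv⟩
      · exact Or.inl ⟨hσ, (Finset.subset_insert_iff_of_notMem hv).1 hσs⟩
    · rintro (⟨hσ, hσs⟩ | ⟨ρ, ⟨hρs, hρ⟩, rfl⟩)
      · exact ⟨hσ, hσs.trans (Finset.subset_insert v s)⟩
      · exact ⟨hρ, Finset.insert_subset_insert v hρs⟩

end Main

end TightMorse

end

theorem theorem2p6 (k : ℕ) (K : Geometry.SimplicialComplex ℝ (TightMorse.Euc k))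
    (hfin : K.faces.Finite) (hman : TightMorse.TriangulatesThreeManifold K)
    (π : TightMorse.Euc k) (hπ : π ≠ 0)
    (hgen : TightMorse.InGeneralPosition π K) (htight : TightMorse.IsTight π K) :
    ∃ f : K.faces → ℤ, TightMorse.IsPerfectMorse f := by
  classical
  obtain ⟨f, N, C, hCA, -, hmono, htwo, hcomp, hcrit, hcount⟩ :=
    (TightMorse.build_of_tight hfin hman hgen htight).exists_morse TightMorse.ud_ud
      TightMorse.ud_single_mem
  have hmem : ∀ σ : K.faces, σ.1 ∈ hfin.toFinset := fun σ => hfin.mem_toFinset.2 σ.2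
  refine ⟨fun σ => f σ.1, ⟨fun σ τ h => hmono _ (hmem σ) _ (hmem τ) h, fun m => ?_⟩, fun i => ?_⟩
  · rw [← Subtype.val_injective.encard_image]
    refine (Set.encard_le_encard (t := ((hfin.toFinset.filter fun σ => f σ = m : Finset _) :
      Set (Finset (TightMorse.Euc k)))) ?_).trans ?_
    · rintro _ ⟨σ, hσ, rfl⟩
      exact Finset.mem_coe.2 (Finset.mem_filter.2 ⟨hmem σ, hσ⟩)
    · rw [Set.encard_coe_eq_coe_finsetCard]
      exact_mod_cast htwo m
  -- Two faces with the same value are comparable, so sharing a value is the same as failing strict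
  -- monotonicity at a face or a coface.
  · have hC : ∀ σ : K.faces,
        TightMorse.IsCritical (fun σ : K.faces => f σ.1) σ ↔ σ.1 ∈ C := by
      intro σ
      rw [hcrit _ (hmem σ)]
      constructor
      · rintro ⟨hup, hdown⟩ τ hτ hf
        by_contra hne
        have hτK := hfin.mem_toFinset.1 hτ
        rcases hcomp _ hτ _ (hmem σ) hf with h | h
        · exact (hdown ⟨τ, hτK⟩ (lt_of_le_of_ne h fun e => hne (congrArg Subtype.val e))).ne hf
        · exact (hup ⟨τ, hτK⟩ (lt_of_le_of_ne h fun e => hne (congrArg Subtype.val e).symm)).ne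
            hf.symm
      · intro h
        refine ⟨fun τ hτ => lt_of_le_of_ne (hmono _ (hmem σ) _ (hmem τ) hτ.le) fun e => ?_,
          fun τ hτ => lt_of_le_of_ne (hmono _ (hmem τ) _ (hmem σ) hτ.le) fun e => ?_⟩
        · exact hτ.ne' (Subtype.ext (h τ.1 (hmem τ) e.symm))
        · exact hτ.ne (Subtype.ext (h τ.1 (hmem τ) e))
    have himage : Subtype.val '' TightMorse.criticalFaces (fun σ : K.faces => f σ.1) i =
        ((C.filter fun F => F.card = i + 1 : Finset _) : Set (Finset (TightMorse.Euc k))) := by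
      ext F
      rw [Finset.mem_coe, Finset.mem_filter]
      constructor
      · rintro ⟨σ, ⟨hσ, hσi⟩, rfl⟩
        exact ⟨(hC σ).1 hσ, hσi⟩
      · rintro ⟨hF, hFi⟩
        exact ⟨⟨F, hfin.mem_toFinset.1 (hCA hF)⟩, ⟨(hC _).2 hF, hFi⟩, rfl⟩
    rw [← Subtype.val_injective.encard_image, himage, Set.encard_coe_eq_coe_finsetCard]
    -- The Morse count and the homology count contain the same two ranks; cancelling them leaves the
    -- Betti number.
    have h1 : _ = _ + _ + TightMorse.bdRank TightMorse.ud hfin.toFinset (i + 2) := hcount (i + 1)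
    have h2 := TightMorse.finrank_homology hfin i
    have h3 : (C.filter fun F => F.card = i + 1).card = TightMorse.bettiNumber K i := by
      rw [TightMorse.bettiNumber]; omega
    exact_mod_cast h3
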